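/- **Infinite product representation of $S_2^C$.** For plane vectors write $u\times v=\det[u,v]=u_1v_2-u_2v_1$. Let $v_1,v_2\in\mathbb Z^2$ be primitive and let $C=\{x\in\mathbb R^2: x\cdot v_1\ge 0,\ x\cdot v_2\ge 0\}$ be a strictly convex cone (it contains no line) which is good: at each face other than the apex, the integral points of the real span of the normals at that face are the integral span of these normals. Let $C^\circ$ be its interior, $C^*=\{y: y\cdot u\ge 0\ \forall u\in C\}$ its dual cone, and let $\underline\omega\in\mathbb C^2$ be generic: $\mathrm{Im}\left(\frac{\underline\omega\cdot p}{\underline\omega\cdot q}\right)\ne 0$ for all linearly independent $p,q\in\mathbb Z^2$. Fix $c\in\mathbb C^*$ with $\mathrm{Re}(c\,\underline\omega)\in (C^*)^\circ$. *Definitions.* For $L=C$ or $L=C^\circ$ let $\zeta_2^{L}(s,z|\underline\omega)=\sum_{n\in L\cap\mathbb Z^2}(z+n\cdot\underline\omega)^{-s}$ for $\mathrm{Re}\,s>2$, where $x^{-s}=e^{-s(\log(cx)-\log c)}$ with principal logarithms, continued analytically to $s\in\mathbb C\setminus\{1,2\}$. Put $\Gamma_2^{L}(z|\underline\omega)=\exp\left(\partial_s\zeta_2^{L}(s,z|\underline\omega)|_{s=0}\right)$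 and $$S_2^C(z|\underline\omega)=\Gamma_2^C(z|\underline\omega)^{-1}\,\Gamma_2^{C^\circ}(-z|\underline\omega).$$ The generalized Bernoulli polynomials $B^C_{2,k}$ and the double Bernoulli polynomials $B_{2,k}$ are defined, for small $t$ at which the left sides are defined (in the first case: at which the sum converges absolutely), by $$t^2e^{zt}\sum_{n\in C^\circ\cap\mathbb Z^2}e^{-(\underline\omega\cdot n)t}=\sum_{k\ge 0}B^C_{2,k}(z|\underline\omega)\frac{t^k}{k!},\qquad \frac{t^2e^{zt}}{(e^{at}-1)(e^{bt}-1)}=\sum_{k\ge0}B_{2,k}(z|a,b)\frac{t^k}{k!}.$$ Further $(x|q)_\infty=\prod_{j\ge0}(1-xq^j)$ for $|q|<1$ and $(x|q)_\infty=\prod_{j\ge0}(1-xq^{-j-1})^{-1}$ for $|q|>1$. For the 1-dimensional face $f\in\{1,2\}$, the ray $\{x\in C: x\cdot v_f=0\}$ with generator $x_f$, choose any $n^f\in\mathbb Z^2$ with $\det[n^f,v_f]=\pm1$ and $n^f\cdot x_f>0$, and put $$\underline\tau^f=SK_f\begin{pmatrix}\omega_1\\ \omega_2\\ 1\end{pmatrix},\qquad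 K_f=\begin{pmatrix}[n^f,v_f]^{-1}&0\\0&1\end{pmatrix},\qquad S=\begin{pmatrix}0&0&-1\\0&1&0\\1&0&0\end{pmatrix}.$$ *Statement.* The continuation of $\zeta_2^C(s,z|\underline\omega)$ and that of $\zeta_2^{C^\circ}(s,-z|\underline\omega)$ to $s\in\mathbb C\setminus\{1,2\}$ exist for every $z$ that is not in $-(C\cap\mathbb Z^2)\cdot\underline\omega$ or in $(C^\circ\cap\mathbb Z^2)\cdot\underline\omega$; the expansion defining $B^C_{2,k}(z|\underline\omega)$ exists for every $z\in\mathbb C$; and, as an identity of meromorphic functions of $z$, $$S_2^C(z|\underline\omega)=e^{\frac{\pi i}{2}B^C_{2,2}(z|\underline\omega)}\prod_{f=1}^{2}\left(e^{2\pi i z/\tau^f_3}\,\middle|\,e^{2\pi i\tau^f_2/\tau^f_3}\right)_\infty .$$ Precisely, it holds at each $z\notin\mathbb Z\omega_1+\mathbb Z\omega_2$; and at each $z$ outside $-(C\cap\mathbb Z^2)\cdot\underline\omega$ and $(C^\circ\cap\mathbb Z^2)\cdot\underline\omega$ the right side tends to $S_2^C(z|\underline\omega)$ along the punctured neighbourhoods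 of $z$. Moreover $B_{2,2}^C$ is given explicitly as follows. Call $u_0,\dots,u_{m+1}\in\mathbb Z^2$ a subdivision of $C$ if $u_0=v_1$, $u_{m+1}=-v_2$, $u_j\times u_{j+1}=1$ for $0\le j\le m$, and each vector $(u_{j,2},-u_{j,1})$ lies in $C$. If $v_1\times v_2<0$ (which holds after relabelling the normals if necessary), a subdivision exists, and for every subdivision and every $z\in\mathbb C$ $$B_{2,2}^C(z|\underline\omega)=B_{2,2}(z|\underline\omega\times u_m,\underline\omega\times u_{m+1})+\sum_{j=0}^{m-1}B_{2,2}(z+\underline\omega\times u_j|\underline\omega\times u_j,\underline\omega\times u_{j+1}).$$ -/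

import Mathlib

open Filter Topology

noncomputable section

namespace GenSine

/-! ### Plane vectors -/

/-- The standard bilinear pairing `x · y` of real plane vectors. -/
def rdot (x y : Fin 2 → ℝ) : ℝ := x 0 * y 0 + x 1 * y 1

/-- An integral vector seen in `ℝ²`. -/
def toReal (n : Fin 2 → ℤ) : Fin 2 → ℝ := fun i => (n i : ℝ)

/-- The pairing `n · ω = n₁ ω₁ + n₂ ω₂` of an integral vector with complex parameters. -/
def cdot (n : Fin 2 → ℤ) (ω : Fin 2 → ℂ) : ℂ := (n 0 : ℂ) * ω 0 + (n 1 : ℂ) * ω 1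

/-- `u × v = det [u, v]` for integral vectors (the columns are `u` and `v`). -/
def cross (u v : Fin 2 → ℤ) : ℤ := u 0 * v 1 - u 1 * v 0

/-- `ω × u = det [ω, u]` for complex parameters and an integral vector. -/
def ccross (ω : Fin 2 → ℂ) (u : Fin 2 → ℤ) : ℂ := ω 0 * (u 1 : ℂ) - ω 1 * (u 0 : ℂ)

/-! ### Cones -/

/-- The set `{x ∈ ℝ² | x · v₁ ≥ 0, x · v₂ ≥ 0}`. -/
def coneSet (v : Fin 2 → Fin 2 → ℤ) : Set (Fin 2 → ℝ) :=
  {x | ∀ i, 0 ≤ rdot x (toReal (v i))}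

/-- A two-dimensional strictly convex rational polyhedral cone, given by its two primitive
inward pointing normals.  Strict convexity (the cone contains no line) makes the two normals
linearly independent, hence the cone full-dimensional and the set of normals minimal. -/
structure Cone2 where
  normal : Fin 2 → Fin 2 → ℤ
  primitive : ∀ i, Int.gcd (normal i 0) (normal i 1) = 1
  strictlyConvex : ∀ x, x ∈ coneSet normal → -x ∈ coneSet normal → x = 0

namespace Cone2

/-- The underlying closed subset of `ℝ²`. -/
def carrier (C : Cone2) : Set (Fin 2 → ℝ) := coneSet C.normal

/-- The dual cone `C* = {y | y · u ≥ 0 for all u ∈ C}`. -/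
def dual (C : Cone2) : Set (Fin 2 → ℝ) := {y | ∀ u ∈ C.carrier, 0 ≤ rdot y u}

/-- Goodness: at every face different from the apex, the integral points of the real span of
the normals at the face form the integral span of these normals. The face belonging to the set
`I` of normals is `{x ∈ C | x · vᵢ = 0 for i ∈ I}`. -/
def IsGood (C : Cone2) : Prop :=
  ∀ I : Set (Fin 2), (∃ x ∈ C.carrier, x ≠ 0 ∧ ∀ i ∈ I, rdot x (toReal (C.normal i)) = 0) →
    ∀ m : Fin 2 → ℤ,
      toReal m ∈ Submodule.span ℝ ((fun i => toReal (C.normal i)) '' I) ↔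
        m ∈ Submodule.span ℤ (C.normal '' I)

/-- The lattice points `C ∩ ℤ²`. -/
def points (C : Cone2) : Set (Fin 2 → ℤ) := {n | toReal n ∈ C.carrier}

/-- The lattice points `C° ∩ ℤ²` of the interior of the cone. -/
def interiorPoints (C : Cone2) : Set (Fin 2 → ℤ) := {n | toReal n ∈ interior C.carrier}

/-- The one-dimensional face (ray) of the cone along which the normal `v_f` vanishes. -/
def face (C : Cone2) (f : Fin 2) : Set (Fin 2 → ℝ) :=
  {x | x ∈ C.carrier ∧ rdot x (toReal (C.normal f)) = 0}

/-- `n` is an admissible choice of the vector `n^f`: `det [n, v_f] = ± 1` and `n · x_f > 0`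
for every generator `x_f` of the ray `f`.  (The sign of `det [n, v_f]` is then the sign of
`det [x_f, v_f]`.) -/
def IsFaceVector (C : Cone2) (f : Fin 2) (n : Fin 2 → ℤ) : Prop :=
  (cross n (C.normal f) = 1 ∨ cross n (C.normal f) = -1) ∧
    ∀ x ∈ C.face f, x ≠ 0 → 0 < rdot (toReal n) x

/-- `u 0, …, u (m + 1)` are the normals of the lines of a unimodular subdivision of `C`, running
from `v₁` to `-v₂`: consecutive normals satisfy `u_j × u_{j+1} = 1`, and the ray spanned by
`(u_j,2 , -u_j,1)`, which is orthogonal to `u_j`, lies in `C`. -/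
def IsSubdivision (C : Cone2) (m : ℕ) (u : ℕ → Fin 2 → ℤ) : Prop :=
  u 0 = C.normal 0 ∧ u (m + 1) = -C.normal 1 ∧
    (∀ j, j ≤ m → cross (u j) (u (j + 1)) = 1) ∧
    ∀ j, j ≤ m + 1 → toReal ![u j 1, -u j 0] ∈ C.carrier

end Cone2

/-! ### The generalized double sine function -/

/-- The power `x ^ (-s)`, taken with the branch of the logarithm that is continuous on the
half-plane `Re (c x) > 0`, namely `log (c x) - log c` with principal logarithms. -/
def negPow (c x s : ℂ) : ℂ := Complex.exp (-s * (Complex.log (c * x) - Complex.log c))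

/-- `Z` is the analytic continuation in `s` (with possible poles only at `s = 1, 2`) of the
zeta series `∑_{n ∈ L} (z + n · ω)^(-s)`, which converges (absolutely) for `Re s > 2`. -/
def IsZetaContinuation (L : Set (Fin 2 → ℤ)) (c : ℂ) (ω : Fin 2 → ℂ) (z : ℂ) (Z : ℂ → ℂ) :
    Prop :=
  DifferentiableOn ℂ Z ({1, 2} : Set ℂ)ᶜ ∧
    ∀ s : ℂ, 2 < s.re → HasSum (fun n : L => negPow c (z + cdot n ω) s) (Z s)

open Classical in
/-- The continued zeta function `ζ₂^L (s, z | ω)`. -/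
def zeta (L : Set (Fin 2 → ℤ)) (c : ℂ) (ω : Fin 2 → ℂ) (s z : ℂ) : ℂ :=
  if h : ∃ Z, IsZetaContinuation L c ω z Z then h.choose s else 0

/-- The gamma function `Γ₂^L (z | ω) = exp (∂ζ₂^L/∂s (0, z | ω))`. -/
def gamma (L : Set (Fin 2 → ℤ)) (c : ℂ) (ω : Fin 2 → ℂ) (z : ℂ) : ℂ :=
  Complex.exp (deriv (fun s => zeta L c ω s z) 0)

/-- The generalized double sine function `S₂^C (z | ω) = Γ₂^C (z | ω)⁻¹ Γ₂^{C°} (-z | ω)`. -/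
def doubleSine (C : Cone2) (c : ℂ) (ω : Fin 2 → ℂ) (z : ℂ) : ℂ :=
  (gamma C.points c ω z)⁻¹ * gamma C.interiorPoints c ω (-z)

/-- `z` is a point at which neither zeta series entering `S₂^C (z | ω)` has a vanishing base. -/
def IsRegularPoint (C : Cone2) (ω : Fin 2 → ℂ) (z : ℂ) : Prop :=
  (∀ n ∈ C.points, z + cdot n ω ≠ 0) ∧ ∀ n ∈ C.interiorPoints, -z + cdot n ω ≠ 0

/-! ### Bernoulli polynomials -/

/-- `F t = ∑ₖ b k * t ^ k / k!` for all sufficiently small `t` in the domain `D` of `F`. -/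
def IsExpansion (F : ℂ → ℂ) (D : Set ℂ) (b : ℕ → ℂ) : Prop :=
  ∃ ε : ℝ, 0 < ε ∧ ∀ t ∈ D, ‖t‖ < ε →
    HasSum (fun k : ℕ => b k * t ^ k / (k.factorial : ℂ)) (F t)

open Classical in
/-- The coefficient `b k` of the expansion `F t = ∑ₖ b k * t ^ k / k!`. -/
def expansionCoeff (F : ℂ → ℂ) (D : Set ℂ) (k : ℕ) : ℂ :=
  if h : ∃ b, IsExpansion F D b then h.choose k else 0

/-- The generating function of the double Bernoulli polynomials. -/
def bernoulliGen (z a b t : ℂ) : ℂ :=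
  t ^ 2 * Complex.exp (z * t) / ((Complex.exp (a * t) - 1) * (Complex.exp (b * t) - 1))

/-- The double Bernoulli polynomial `B_{2,k} (z | a, b)`. -/
def bernoulli2 (k : ℕ) (z a b : ℂ) : ℂ := expansionCoeff (bernoulliGen z a b) {0}ᶜ k

/-- The set of `t` for which `∑_{n ∈ C° ∩ ℤ²} exp (-(ω · n) t)` converges (absolutely). -/
def coneBernoulliDomain (C : Cone2) (ω : Fin 2 → ℂ) : Set ℂ :=
  {t | Summable fun n : C.interiorPoints => Complex.exp (-(cdot n ω) * t)}

/-- The generating function of the generalized Bernoulli polynomials of the cone `C`. -/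
def coneBernoulliGen (C : Cone2) (ω : Fin 2 → ℂ) (z t : ℂ) : ℂ :=
  t ^ 2 * Complex.exp (z * t) * ∑' n : C.interiorPoints, Complex.exp (-(cdot n ω) * t)

/-- The generalized Bernoulli polynomial `B_{2,k}^C (z | ω)`. -/
def coneBernoulli (C : Cone2) (k : ℕ) (ω : Fin 2 → ℂ) (z : ℂ) : ℂ :=
  expansionCoeff (coneBernoulliGen C ω z) (coneBernoulliDomain C ω) k

/-! ### The infinite product -/

open Classical in
/-- The `q`-shifted factorial `(x | q)_∞` in one variable `q` with `|q| ≠ 1`. -/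
def qFactorial (x q : ℂ) : ℂ :=
  if ‖q‖ < 1 then ∏' j : ℕ, (1 - x * q ^ j) else (∏' j : ℕ, (1 - x * q⁻¹ ^ (j + 1)))⁻¹

/-- The matrix `K̃ = [n, v]⁻¹`, where `n` and `v` are the columns. -/
def smallK (n v : Fin 2 → ℤ) : Matrix (Fin 2) (Fin 2) ℤ := (!![n 0, v 0; n 1, v 1])⁻¹

/-- The matrix `K` obtained from `K̃` by adjoining a `1` at the lower right entry. -/
def bigK (n v : Fin 2 → ℤ) : Matrix (Fin 3) (Fin 3) ℤ :=
  !![smallK n v 0 0, smallK n v 0 1, 0; smallK n v 1 0, smallK n v 1 1, 0; 0, 0, 1]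

/-- The S-duality matrix. -/
def matS : Matrix (Fin 3) (Fin 3) ℤ := !![0, 0, -1; 0, 1, 0; 1, 0, 0]

/-- The parameters `τ = S K (ω₁, ω₂, 1)`. -/
def tau (n v : Fin 2 → ℤ) (ω : Fin 2 → ℂ) : Fin 3 → ℂ :=
  ((matS * bigK n v).map (fun k : ℤ => (k : ℂ))).mulVec ![ω 0, ω 1, 1]

/-- `e^{πi B_{22}^C (z|ω) / 2} ∏_f (e^{2πi z/τ₃^f} | e^{2πi τ₂^f/τ₃^f})_∞`, where `n f` is the
vector chosen at the face `f`. -/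
def productSide (C : Cone2) (ω : Fin 2 → ℂ) (n : Fin 2 → Fin 2 → ℤ) (z : ℂ) : ℂ :=
  Complex.exp (Real.pi * Complex.I / 2 * coneBernoulli C 2 ω z) *
    ∏ f : Fin 2,
      qFactorial (Complex.exp (2 * Real.pi * Complex.I * (z / tau (n f) (C.normal f) ω 2)))
        (Complex.exp (2 * Real.pi * Complex.I *
          (tau (n f) (C.normal f) ω 1 / tau (n f) (C.normal f) ω 2)))

end GenSine

end

noncomputable section

namespace GenSine

/-! ### Analytic preliminaries -/

/-! The theorem is proved for a quadrant {k a + l b : k, l ≥ 0}, and then assembled from the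
quadrants of a unimodular subdivision of the cone.

Quadrant. Dividing D²e^{xD} formally by (e^{aD} - 1)(e^{bD} - 1) gives coefficients β (`IsEM`). The
function (2 - s)(1 - s) w^{-s}, taken at w + x, is then the mixed difference in a and b of a finite
combination of derivatives of w^{2-s}, up to a remainder O(|w|^{-(N + Re s)}) (`exists_emR_bound`).
The mixed differences telescope over the quadrant, so a main term plus a convergent remainder sum
continues the zeta function to Re s > 2 - N (`hasSum_emY`, `exists_entire`). With N = 3 and the
s-derivative at 0 this becomes a formula `lg` for the logarithm of the gamma function. The formula
shows how log Γ behaves at infinity, and that its third derivative in z is -2 ∑ (z + k a + l b)^{-3}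
(`iterate_deriv_lg`).

By Lipschitz's formula the third derivative of the logarithm of ∏ (1 - e^{2πi(z + k b)/a}) is twice
the same lattice sum over a half-plane, which is a union of two quadrants (`iterate_deriv_qlog_eq`).
In log Γ(a + b - z) - log Γ(z), corrected by the logarithms of the two q-products, all quadrant sums
cancel, so a quadratic polynomial remains. Subtract the Bernoulli polynomial, which comes from the
jump πi between log z and log(-z) in the main terms (`phi_reflection`). The difference is still
quadratic, and it tends to 0 along a line running to infinity, hence it is 0
(`lg_reflection_halfStrip`). Analytic continuation off the lattice gives the product formula of the
quadrant (`exp_lg_reflection`, `IsQuadrantZeta.reflection`).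

Cone. A Euclidean algorithm yields rays w 0, …, w (m + 1) with consecutive determinants 1
(`exists_unimodular_chain`). Points of the closed cone and of its interior are partitioned into
half-open quadrants with opposite boundary conventions (`IsFan.hasSum_points`,
`IsFan.hasSum_interiorPoints`), so each cone of the fan contributes one quadrant sine. On an inner
ray the two neighbouring cones contribute mutually inverse q-factorials (`IsFan.nome_eq_inv`,
`qFactorial_mul_inv`). Only the two outer rays survive (`IsFan.doubleSine_eq`), and their factors
are those of the matrices S K_f (`face_factor`). The same partition splits the Bernoulli generating
function (`IsFan.coneBernoulliGen_eq`), which gives both the exponent and the explicit formula for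
B₂₂. -/

/-- Taylor's formula along a chain `f 0, f 1, …` of successive derivatives on a convex set, with a
crude bound of the remainder. -/
lemma norm_sub_taylor_le {U : Set ℂ} (hU : Convex ℝ U) (K : ℕ) :
    ∀ (f : ℕ → ℂ → ℂ) (_ : ∀ j, ∀ y ∈ U, HasDerivAt (f j) (f (j + 1) y) y) {M : ℝ}
      (_ : ∀ y ∈ U, ‖f K y‖ ≤ M) {w h : ℂ} (_ : w ∈ U) (_ : w + h ∈ U),
      ‖f 0 (w + h) - ∑ i ∈ Finset.range K, f i w * (h ^ i / (i.factorial : ℂ))‖ ≤ M * ‖h‖ ^ K := by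
  induction K with
  | zero => intro f _ M hM w h _ hwh; simpa using hM _ hwh
  | succ K ih =>
    intro f hf M hM w h hw hwh
    have hseg : ∀ t ∈ Set.Icc (0 : ℝ) 1, w + t * h ∈ U := by
      intro t ht
      have := hU hw hwh (sub_nonneg.2 ht.2) ht.1 (by ring)
      convert this using 1
      simp only [Complex.real_smul]; push_cast; ring
    have hM0 : 0 ≤ M := (norm_nonneg _).trans (hM _ hw)
    -- The remainder is followed along the segment: its derivative in t is h times the remainder of
    -- order K for the chain shifted by one, to which the induction hypothesis applies.
    set g : ℝ → ℂ := fun t => f 0 (w + t * h) -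
      ∑ i ∈ Finset.range (K + 1), f i w * ((t * h) ^ i / (i.factorial : ℂ)) with hg
    set g' : ℝ → ℂ := fun t => h * (f 1 (w + t * h) -
      ∑ i ∈ Finset.range K, f (i + 1) w * ((t * h) ^ i / (i.factorial : ℂ))) with hg'
    have hder : ∀ t ∈ Set.Icc (0 : ℝ) 1, HasDerivWithinAt g (g' t) (Set.Icc 0 1) t := by
      intro t ht
      apply HasDerivAt.hasDerivWithinAt
      have hlin : HasDerivAt (fun t : ℂ => t * h) h (t : ℂ) := by
        simpa using (hasDerivAt_id (t : ℂ)).mul_const h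
      have h1 : HasDerivAt (fun t : ℂ => f 0 (w + t * h)) (f 1 (w + t * h) * h) (t : ℂ) :=
        HasDerivAt.comp (t : ℂ) (hf 0 _ (hseg t ht)) (hlin.const_add w)
      have h2 : HasDerivAt (fun t : ℂ => ∑ i ∈ Finset.range (K + 1),
          f i w * ((t * h) ^ i / (i.factorial : ℂ)))
          (∑ i ∈ Finset.range (K + 1),
            f i w * (((i : ℂ) * (t * h) ^ (i - 1) * h) / (i.factorial : ℂ))) (t : ℂ) := by
        apply HasDerivAt.fun_sum
        intro i _
        exact ((hlin.pow i).div_const _).const_mul _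
      have h3 : HasDerivAt g _ t := (h1.sub h2).comp_ofReal
      refine h3.congr_deriv ?_
      rw [Finset.sum_range_succ']
      simp only [hg', Nat.cast_zero, zero_mul, zero_div, mul_zero, add_zero, mul_sub]
      rw [mul_comm h, Finset.mul_sum]
      congr 1
      apply Finset.sum_congr rfl
      intro i _
      rw [Nat.factorial_succ, Nat.add_sub_cancel]
      have : (i.factorial : ℂ) ≠ 0 := by exact_mod_cast i.factorial_ne_zero
      have : ((i + 1 : ℕ) : ℂ) ≠ 0 := by exact_mod_cast i.succ_ne_zero
      push_cast at *
      field_simp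
    have hbd : ∀ t ∈ Set.Ico (0 : ℝ) 1, ‖g' t‖ ≤ M * ‖h‖ ^ (K + 1) := by
      intro t ht
      have ht' : t ∈ Set.Icc (0 : ℝ) 1 := ⟨ht.1, ht.2.le⟩
      have h1 := ih (fun j => f (j + 1)) (fun j y hy => hf (j + 1) y hy) hM hw (hseg t ht')
      have h2 : ‖(t : ℂ) * h‖ ≤ ‖h‖ := by
        rw [norm_mul, Complex.norm_real, Real.norm_of_nonneg ht.1]
        exact mul_le_of_le_one_left (norm_nonneg _) ht.2.le
      calc ‖g' t‖ ≤ ‖h‖ * (M * ‖(t : ℂ) * h‖ ^ K) := by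
            rw [hg', norm_mul]; exact mul_le_mul_of_nonneg_left h1 (norm_nonneg _)
        _ ≤ ‖h‖ * (M * ‖h‖ ^ K) := by gcongr
        _ = M * ‖h‖ ^ (K + 1) := by ring
    have := norm_image_sub_le_of_norm_deriv_le_segment' hder hbd 1 ⟨zero_le_one, le_rfl⟩
    have h0 : g 0 = 0 := by
      simp [hg, Finset.sum_range_succ', zero_pow]
    have h1 : g 1 = f 0 (w + h) -
      ∑ i ∈ Finset.range (K + 1), f i w * (h ^ i / (i.factorial : ℂ)) := by simp [hg]
    rw [h0, h1] at this
    simpa using this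

/-- A series of holomorphic functions that is, locally, dominated by a summable sequence apart from
finitely many terms may be differentiated term by term. -/
lemma tsum_differentiableAt {ι : Type*} {f : ι → ℂ → ℂ} {s₀ : ℂ} {r : ℝ} (hr : 0 < r)
    (hf : ∀ i, DifferentiableOn ℂ (f i) (Metric.ball s₀ r)) {u : ι → ℝ} (hu : Summable u)
    (hfu : ∀ᶠ i in cofinite, ∀ s ∈ Metric.ball s₀ r, ‖f i s‖ ≤ u i) :
    DifferentiableOn ℂ (fun s => ∑' i, f i s) (Metric.ball s₀ (r / 2)) ∧
      (∀ s ∈ Metric.ball s₀ (r / 2), HasSum (fun i => deriv (f i) s)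
        (deriv (fun s => ∑' i, f i s) s)) ∧
      ∃ v : ι → ℝ, Summable v ∧ ∀ i, ∀ s ∈ Metric.ball s₀ (r / 2), ‖f i s‖ ≤ v i := by
  have hb : ∀ i, ∃ M, ∀ s ∈ Metric.closedBall s₀ (r / 2), ‖f i s‖ ≤ M := fun i =>
    (isCompact_closedBall s₀ (r / 2)).exists_bound_of_continuousOn
      ((hf i).continuousOn.mono (Metric.closedBall_subset_ball (by linarith)))
  choose M hM using hb
  classical
  -- At the finitely many exceptional indices the majorant is replaced by a maximum over the smaller
  -- closed ball. This is why the radius is halved.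
  let v : ι → ℝ := fun i => if ∀ s ∈ Metric.ball s₀ r, ‖f i s‖ ≤ u i then u i else M i
  have hv : Summable v := by
    refine (summable_congr_cofinite ?_).2 hu
    filter_upwards [hfu] with i hi
    exact if_pos hi
  have hfv : ∀ i, ∀ s ∈ Metric.ball s₀ (r / 2), ‖f i s‖ ≤ v i := by
    intro i s hs
    by_cases h : ∀ s ∈ Metric.ball s₀ r, ‖f i s‖ ≤ u i
    · simp only [v, if_pos h]
      exact h s (Metric.ball_subset_ball (by linarith) hs)
    · simp only [v, if_neg h]
      exact hM i s (Metric.ball_subset_closedBall hs)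
  have hf' : ∀ i, DifferentiableOn ℂ (f i) (Metric.ball s₀ (r / 2)) := fun i =>
    (hf i).mono (Metric.ball_subset_ball (by linarith))
  exact ⟨Complex.differentiableOn_tsum_of_summable_norm hv hf' Metric.isOpen_ball hfv,
    fun s hs => Complex.hasSum_deriv_of_summable_norm hv hf' Metric.isOpen_ball hfv hs, v, hv, hfv⟩

/-- Threefold termwise differentiation. -/
lemma hasSum_iterate_deriv {ι : Type*} {f : ι → ℂ → ℂ} {s₀ : ℂ} {r : ℝ} (hr : 0 < r)
    (hf : ∀ i, DifferentiableOn ℂ (f i) (Metric.ball s₀ r)) {u : ι → ℝ} (hu : Summable u)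
    (hfu : ∀ i, ∀ s ∈ Metric.ball s₀ r, ‖f i s‖ ≤ u i) (k : ℕ) :
    HasSum (fun i => deriv^[k] (f i) s₀) (deriv^[k] (fun s => ∑' i, f i s) s₀) := by
  -- Locally uniform convergence of holomorphic functions passes to derivatives, so it is carried
  -- through the induction together with the finite-sum formula.
  have key : ∀ k : ℕ, TendstoLocallyUniformlyOn
      (fun (t : Finset ι) => deriv^[k] (fun s => ∑ i ∈ t, f i s))
      (deriv^[k] (fun s => ∑' i, f i s)) atTop (Metric.ball s₀ r) ∧
      (∀ i, DifferentiableOn ℂ (deriv^[k] (f i)) (Metric.ball s₀ r)) ∧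
      ∀ t : Finset ι, Set.EqOn (deriv^[k] (fun s => ∑ i ∈ t, f i s))
        (fun s => ∑ i ∈ t, deriv^[k] (f i) s) (Metric.ball s₀ r) := by
    intro k
    induction k with
    | zero =>
      exact ⟨(tendstoUniformlyOn_tsum hu hfu).tendstoLocallyUniformlyOn, hf, fun t s _ => rfl⟩
    | succ k ih =>
      obtain ⟨h1, h2, h3⟩ := ih
      have h2' : ∀ t : Finset ι, DifferentiableOn ℂ (fun s => ∑ i ∈ t, deriv^[k] (f i) s)
        (Metric.ball s₀ r) := fun t => DifferentiableOn.fun_sum fun i _ => h2 i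
      refine ⟨?_, ?_, ?_⟩
      · have := h1.deriv (Eventually.of_forall fun t => (h2' t).congr (h3 t)) Metric.isOpen_ball
        simpa only [Function.iterate_succ_apply', Function.comp_def] using this
      · intro i
        rw [Function.iterate_succ_apply']
        exact (h2 i).deriv Metric.isOpen_ball
      · intro t s hs
        simp only [Function.iterate_succ_apply']
        have : (deriv^[k] (fun s => ∑ i ∈ t, f i s)) =ᶠ[𝓝 s]
            (fun s => ∑ i ∈ t, deriv^[k] (f i) s) := by
          filter_upwards [Metric.isOpen_ball.mem_nhds hs] with y hy using h3 t hy
        rw [this.deriv_eq, deriv_fun_sum]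
        exact fun i _ => (h2 i).differentiableAt (Metric.isOpen_ball.mem_nhds hs)
  obtain ⟨h1, -, h3⟩ := key k
  have hs : s₀ ∈ Metric.ball s₀ r := Metric.mem_ball_self hr
  have := h1.tendsto_at hs
  rw [HasSum]
  exact this.congr fun t => h3 t hs

/-! ### Mixed differences and telescoping over the quadrant. -/

/-- The mixed second difference. -/
def dd (a b : ℂ) (F : ℂ → ℂ) (w : ℂ) : ℂ := F (w + (a + b)) - F (w + a) - F (w + b) + F w

lemma sum_box_telescope (g : ℕ × ℕ → ℂ) (K : ℕ) :
    ∑ n ∈ Finset.range K ×ˢ Finset.range K,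
      (g (n.1 + 1, n.2 + 1) - g (n.1 + 1, n.2) - g (n.1, n.2 + 1) + g n) =
      g (K, K) - g (K, 0) - g (0, K) + g (0, 0) := by
  rw [Finset.sum_product]
  have : ∀ k ∈ Finset.range K, ∑ l ∈ Finset.range K,
      (g (k + 1, l + 1) - g (k + 1, l) - g (k, l + 1) + g (k, l)) =
      (g (k + 1, K) - g (k + 1, 0)) - (g (k, K) - g (k, 0)) := by
    intro k _
    rw [← Finset.sum_range_sub (fun l => g (k + 1, l)), ← Finset.sum_range_sub (fun l => g (k, l)),
      ← Finset.sum_sub_distrib]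
    exact Finset.sum_congr rfl fun l _ => by ring
  rw [Finset.sum_congr rfl this, Finset.sum_range_sub (fun k => g (k, K) - g (k, 0))]
  ring

/-- Telescoping of a mixed second difference over the quadrant. -/
lemma hasSum_telescope {g : ℕ × ℕ → ℂ} (hg : Tendsto g cofinite (𝓝 0))
    (hs : Summable fun n : ℕ × ℕ =>
      g (n.1 + 1, n.2 + 1) - g (n.1 + 1, n.2) - g (n.1, n.2 + 1) + g n) :
    HasSum (fun n : ℕ × ℕ =>
      g (n.1 + 1, n.2 + 1) - g (n.1 + 1, n.2) - g (n.1, n.2 + 1) + g n) (g (0, 0)) := by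
  -- As the family is summable, its sum may be computed along growing squares, where only the four
  -- corner values survive and three of them tend to 0.
  have hsq : Tendsto (fun K : ℕ => Finset.range K ×ˢ Finset.range K) atTop atTop := by
    apply Filter.tendsto_atTop_finset_of_monotone
    · intro K L h
      exact Finset.product_subset_product (Finset.range_mono h) (Finset.range_mono h)
    · rintro ⟨k, l⟩
      refine ⟨max k l + 1, ?_⟩
      simp only [Finset.mem_product, Finset.mem_range]
      omega
  have inj1 : Function.Injective (fun K : ℕ => ((K, K) : ℕ × ℕ)) := fun _ _ h => (Prod.ext_iff.1 h).1
  have inj2 : Function.Injective (fun K : ℕ => ((K, 0) : ℕ × ℕ)) := fun _ _ h => (Prod.ext_iff.1 h).1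
  have inj3 : Function.Injective (fun K : ℕ => ((0, K) : ℕ × ℕ)) := fun _ _ h => (Prod.ext_iff.1 h).2
  have lim : ∀ φ : ℕ → ℕ × ℕ, Function.Injective φ → Tendsto (fun K => g (φ K)) atTop (𝓝 0) := by
    intro φ hφ
    have := hg.comp hφ.tendsto_cofinite
    rwa [Nat.cofinite_eq_atTop] at this
  have h2 := hs.hasSum.comp hsq
  have h3 : Tendsto (fun K : ℕ => g (K, K) - g (K, 0) - g (0, K) + g (0, 0)) atTop
      (𝓝 (0 - 0 - 0 + g (0, 0))) :=
    (((lim _ inj1).sub (lim _ inj2)).sub (lim _ inj3)).add tendsto_const_nhds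
  have h4 := tendsto_nhds_unique (h2.congr (sum_box_telescope g)) h3
  rw [sub_zero, sub_zero, zero_add] at h4
  exact h4 ▸ hs.hasSum

/-! ### Powers along a branch of the logarithm -/

/-- The branch `log (c w) - log c` of the logarithm. -/
def br (c w : ℂ) : ℂ := Complex.log (c * w) - Complex.log c

/-- The `j`-th derivative of `w ^ (2 - s)`. -/
def pw (c : ℂ) (j : ℕ) (s w : ℂ) : ℂ :=
  (∏ i ∈ Finset.range j, (2 - s - i)) * Complex.exp ((2 - s - j) * br c w)

lemma exp_br {c w : ℂ} (hc : c ≠ 0) (hw : w ≠ 0) : Complex.exp (br c w) = w := by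
  rw [br, Complex.exp_sub, Complex.exp_log (mul_ne_zero hc hw), Complex.exp_log hc,
    mul_div_cancel_left₀ _ hc]

lemma br_re {c w : ℂ} (hc : c ≠ 0) (hw : w ≠ 0) : (br c w).re = Real.log ‖w‖ := by
  have := congrArg (fun x => Real.log ‖x‖) (exp_br hc hw)
  simpa [Complex.norm_exp] using this

lemma abs_br_im_le (c w : ℂ) : |(br c w).im| ≤ 2 * Real.pi := by
  rw [br, Complex.sub_im, Complex.log_im, Complex.log_im]
  have h1 := Complex.abs_arg_le_pi (c * w)
  have h2 := Complex.abs_arg_le_pi c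
  calc _ ≤ |(c * w).arg| + |c.arg| := abs_sub _ _
    _ ≤ 2 * Real.pi := by linarith

lemma hasDerivAt_br {c w : ℂ} (hc : c ≠ 0) (hw : c * w ∈ Complex.slitPlane) :
    HasDerivAt (br c) w⁻¹ w := by
  have h1 : HasDerivAt (fun w => c * w) c w := by simpa using (hasDerivAt_id w).const_mul c
  have h2 := (h1.clog hw).sub_const (Complex.log c)
  refine h2.congr_deriv ?_
  have : w ≠ 0 := by rintro rfl; simp at hw
  field_simp

lemma hasDerivAt_pw {c w : ℂ} (hc : c ≠ 0) (hw : c * w ∈ Complex.slitPlane) (j : ℕ) (s : ℂ) :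
    HasDerivAt (pw c j s) (pw c (j + 1) s w) w := by
  have hw0 : w ≠ 0 := by rintro rfl; simp at hw
  have h := (((hasDerivAt_br hc hw).const_mul (2 - s - (j : ℂ))).cexp).const_mul
    (∏ i ∈ Finset.range j, (2 - s - (i : ℂ)))
  refine h.congr_deriv ?_
  rw [pw, Finset.prod_range_succ]
  have : (2 - s - ((j + 1 : ℕ) : ℂ)) * br c w = (2 - s - j) * br c w - br c w := by push_cast; ring
  rw [this, Complex.exp_sub, exp_br hc hw0]
  field_simp

lemma differentiable_pw (c : ℂ) (j : ℕ) (w : ℂ) : Differentiable ℂ (fun s => pw c j s w) := by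
  unfold pw
  fun_prop

/-- The modulus of w^α is |w|^{Re α} times a factor from the argument. The branch has imaginary part
at most 2π, so that factor depends on Im α only. -/
lemma norm_exp_br_le {c w : ℂ} (hc : c ≠ 0) (hw : w ≠ 0) (α : ℂ) :
    ‖Complex.exp (α * br c w)‖ ≤ ‖w‖ ^ α.re * Real.exp (2 * Real.pi * |α.im|) := by
  rw [Complex.norm_exp, Complex.mul_re, br_re hc hw, Real.rpow_def_of_pos (norm_pos_iff.2 hw),
    ← Real.exp_add, Real.exp_le_exp]
  have h : |α.im * (br c w).im| ≤ |α.im| * (2 * Real.pi) := by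
    rw [abs_mul]; exact mul_le_mul_of_nonneg_left (abs_br_im_le c w) (abs_nonneg _)
  have := neg_abs_le (α.im * (br c w).im)
  linarith [mul_comm α.re (Real.log ‖w‖)]

/-- Points of modulus at least `R` of the sector `Re (c w) > -|c w| / 2`. -/
def sector (c : ℂ) (R : ℝ) : Set ℂ := {w | R ≤ ‖w‖ ∧ -(‖c * w‖ / 2) < (c * w).re}

/-- A shift by at most |w|/4 cannot reach the cut. On the cut the modulus of c(w + v) equals minus
its real part, which would give |c w| < |c w|/2 + 2|c v| ≤ |c w|. The sector is wider than a
half-plane because the limit along a line below uses points with Re(c w) slightly negative. -/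
lemma mem_sector_add {c : ℂ} (hc : c ≠ 0) {ρ : ℝ} (hρ : 0 < ρ) {w v : ℂ}
    (hw : w ∈ sector c (4 * ρ)) (hv : ‖v‖ ≤ ρ) :
    c * (w + v) ∈ Complex.slitPlane ∧ ‖w‖ / 2 ≤ ‖w + v‖ ∧ ‖w + v‖ ≤ 2 * ‖w‖ := by
  obtain ⟨h1, h2⟩ := hw
  have hw0 : 0 < ‖w‖ := by linarith
  have h3 : ‖w‖ ≤ ‖w + v‖ + ‖v‖ := by simpa using norm_sub_le (w + v) v
  have h4 := norm_add_le w v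
  refine ⟨?_, by linarith, by linarith⟩
  rw [Complex.mem_slitPlane_iff_not_le_zero]
  intro hle
  rw [Complex.nonpos_iff] at hle
  have hcpos : 0 < ‖c‖ := norm_pos_iff.2 hc
  have hcv : ‖c * v‖ ≤ ‖c * w‖ / 4 := by
    rw [norm_mul, norm_mul]; nlinarith
  have hcw : 0 < ‖c * w‖ := by rw [norm_mul]; positivity
  obtain ⟨hre, him⟩ := hle
  have e1 : ‖c * (w + v)‖ = -(c * (w + v)).re := by
    rw [← Complex.abs_re_eq_norm.2 him, abs_of_nonpos hre]
  have e2 : ‖c * w‖ ≤ ‖c * (w + v)‖ + ‖c * v‖ := by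
    have := norm_sub_le (c * (w + v)) (c * v)
    rwa [mul_add, add_sub_cancel_right, ← mul_add] at this
  have e3 : (c * w).re = (c * (w + v)).re - (c * v).re := by rw [mul_add, Complex.add_re]; ring
  have e4 := Complex.abs_re_le_norm (c * v)
  have e5 := neg_abs_le (c * v).re
  linarith

lemma rpow_le_of_comparable {x y e E : ℝ} (hx : 0 < x) (h1 : x / 2 ≤ y) (h2 : y ≤ 2 * x)
    (he : |e| ≤ E) : y ^ e ≤ 2 ^ E * x ^ e := by
  have hy : 0 < y := by linarith
  have h : (y / x) ^ e ≤ 2 ^ E := by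
    rw [Real.rpow_def_of_pos (by positivity), Real.rpow_def_of_pos two_pos, Real.exp_le_exp]
    have hl : |Real.log (y / x)| ≤ Real.log 2 := by
      rw [abs_le]
      constructor
      · rw [← Real.log_inv]
        apply Real.log_le_log (by norm_num)
        rw [le_div_iff₀ hx]; linarith
      · apply Real.log_le_log (by positivity)
        rw [div_le_iff₀ hx]; linarith
    calc Real.log (y / x) * e ≤ |Real.log (y / x) * e| := le_abs_self _
      _ = |Real.log (y / x)| * |e| := abs_mul _ _
      _ ≤ Real.log 2 * E := by gcongr
  rw [Real.div_rpow hy.le hx.le, div_le_iff₀ (by positivity)] at h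
  exact h

lemma exists_pw_bound {c : ℂ} (hc : c ≠ 0) {ρ : ℝ} (hρ : 0 < ρ) (S : ℝ) (j : ℕ) :
    ∃ C : ℝ, 0 ≤ C ∧ ∀ s : ℂ, ‖s‖ ≤ S → ∀ w ∈ sector c (4 * ρ), ∀ v : ℂ, ‖v‖ ≤ ρ →
      ‖pw c j s (w + v)‖ ≤ C * ‖w‖ ^ (2 - s.re - j) := by
  rcases lt_or_ge S 0 with hS | hS
  · exact ⟨0, le_rfl, fun s hs => absurd (norm_nonneg s) (by linarith)⟩
  refine ⟨(∏ i ∈ Finset.range j, (2 + S + i)) *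
    (2 ^ (2 + S + j) * Real.exp (2 * Real.pi * S)), by positivity, ?_⟩
  intro s hs w hw v hv
  obtain ⟨-, h2, h3⟩ := mem_sector_add hc hρ hw hv
  have hw0 : 0 < ‖w‖ := by linarith [hw.1]
  have hwv : w + v ≠ 0 := norm_pos_iff.1 (by linarith)
  have hre := (Complex.abs_re_le_norm s).trans hs
  have him := (Complex.abs_im_le_norm s).trans hs
  rw [pw, norm_mul, mul_assoc]
  apply mul_le_mul
  · rw [norm_prod]
    apply Finset.prod_le_prod (fun _ _ => norm_nonneg _)
    intro i _
    calc ‖2 - s - (i : ℂ)‖ ≤ ‖(2 : ℂ)‖ + ‖s‖ + ‖(i : ℂ)‖ :=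
          (norm_sub_le _ _).trans (by gcongr; exact norm_sub_le _ _)
      _ ≤ 2 + S + i := by simp [hs]
  · refine (norm_exp_br_le hc hwv _).trans ?_
    have e1 : (2 - s - (j : ℂ)).re = 2 - s.re - j := by simp
    have e2 : |(2 - s - (j : ℂ)).im| = |s.im| := by simp
    rw [e1, e2]
    have h4 := rpow_le_of_comparable (e := 2 - s.re - j) (E := 2 + S + j) hw0 h2 h3 (by
      rw [abs_le] at hre ⊢
      have : (0 : ℝ) ≤ j := j.cast_nonneg
      constructor <;> linarith)
    calc _ ≤ (2 ^ (2 + S + j) * ‖w‖ ^ (2 - s.re - j)) * Real.exp (2 * Real.pi * S) := by gcongr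
      _ = _ := by ring
  · positivity
  · exact Finset.prod_nonneg fun i _ => by positivity

/-! ### Two-dimensional Euler–Maclaurin summation -/

/-- The Taylor coefficients of `(e^{a D} - 1) (e^{b D} - 1)`. -/
def diffCoeff (a b : ℂ) (i : ℕ) : ℂ := ((a + b) ^ i - a ^ i - b ^ i + 0 ^ i) / (i.factorial : ℂ)

/-- `β` is the coefficient sequence of `D ^ 2 e^{x D} / ((e^{a D} - 1) (e^{b D} - 1))`. -/
def IsEM (a b x : ℂ) (β : ℕ → ℂ) : Prop :=
  ∀ M : ℕ, ∑ j ∈ Finset.range (M + 1), β j * diffCoeff a b (M - j) =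
    if 2 ≤ M then x ^ (M - 2) / ((M - 2).factorial : ℂ) else 0

lemma diffCoeff_zero (a b : ℂ) : diffCoeff a b 0 = 0 := by simp [diffCoeff]
lemma diffCoeff_one (a b : ℂ) : diffCoeff a b 1 = 0 := by simp [diffCoeff]
lemma diffCoeff_two (a b : ℂ) : diffCoeff a b 2 = a * b := by
  simp [diffCoeff, Nat.factorial]; ring
lemma diffCoeff_three (a b : ℂ) : diffCoeff a b 3 = a * b * (a + b) / 2 := by
  simp [diffCoeff, Nat.factorial]; ring
lemma diffCoeff_four (a b : ℂ) : diffCoeff a b 4 = a * b * (2 * a ^ 2 + 3 * a * b + 2 * b ^ 2) / 12 := by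
  simp [diffCoeff, Nat.factorial]; ring

/-- The series of (e^{aD} - 1)(e^{bD} - 1) begins with a b D². Once D² is removed it is invertible
as a power series. -/
lemma exists_isEM {a b : ℂ} (ha : a ≠ 0) (hb : b ≠ 0) (x : ℂ) : ∃ β, IsEM a b x β := by
  let g : PowerSeries ℂ := PowerSeries.mk fun i => diffCoeff a b (i + 2)
  let e : PowerSeries ℂ := PowerSeries.mk fun i => x ^ i / (i.factorial : ℂ)
  have hg : PowerSeries.constantCoeff g ≠ 0 := by
    rw [← PowerSeries.coeff_zero_eq_constantCoeff_apply, PowerSeries.coeff_mk, zero_add,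
      diffCoeff_two]
    exact mul_ne_zero ha hb
  refine ⟨fun j => PowerSeries.coeff j (g⁻¹ * e), fun M => ?_⟩
  have hmul : (g⁻¹ * e) * g = e := by
    rw [mul_comm, ← mul_assoc, PowerSeries.mul_inv_cancel _ hg, one_mul]
  rcases M with _ | _ | M
  · simp [diffCoeff_zero]
  · simp [Finset.sum_range_succ, diffCoeff_zero, diffCoeff_one]
  · have := congrArg (PowerSeries.coeff M) hmul
    rw [PowerSeries.coeff_mul, Finset.Nat.sum_antidiagonal_eq_sum_range_succ_mk] at this
    rw [Finset.sum_range_succ, Finset.sum_range_succ]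
    simp only [PowerSeries.coeff_mk, g, e] at this
    rw [if_pos (by omega), show M + 1 + 1 - 2 = M by omega, ← this,
      show M + 1 + 1 - (M + 1) = 1 by omega, show M + 1 + 1 - (M + 1 + 1) = 0 by omega,
      diffCoeff_zero, diffCoeff_one, mul_zero, mul_zero, add_zero, add_zero]
    apply Finset.sum_congr rfl
    intro j hj
    rw [Finset.mem_range] at hj
    rw [show M + 1 + 1 - j = M - j + 2 by omega]

/-- The Euler–Maclaurin main term. -/
def emF (β : ℕ → ℂ) (N : ℕ) (c s w : ℂ) : ℂ := ∑ j ∈ Finset.range N, β j * pw c j s w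

/-- The Euler–Maclaurin remainder. -/
def emR (β : ℕ → ℂ) (N : ℕ) (c a b x s w : ℂ) : ℂ :=
  pw c 2 s (w + x) - dd a b (emF β N c s) w

/-- This is the formal identity behind `IsEM` applied to a truncated jet P. The indices j = N and N
+ 1 can be added at no cost since `diffCoeff` vanishes at 0 and 1. Summing along diagonals then
brings in the defining relations of β. -/
lemma sum_taylor_eq {a b x : ℂ} {β : ℕ → ℂ} (hβ : IsEM a b x β) (N : ℕ) (P : ℕ → ℂ) :
    ∑ j ∈ Finset.range N, β j * ∑ i ∈ Finset.range (N + 2 - j), P (j + i) * diffCoeff a b i =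
      ∑ i ∈ Finset.range N, P (2 + i) * (x ^ i / (i.factorial : ℂ)) := by
  have h1 : ∑ j ∈ Finset.range N, β j * ∑ i ∈ Finset.range (N + 2 - j), P (j + i) * diffCoeff a b i
      = ∑ j ∈ Finset.range (N + 2), ∑ i ∈ Finset.range (N + 2 - j),
        β j * diffCoeff a b i * P (j + i) := by
    rw [Finset.sum_range_succ, Finset.sum_range_succ, show N + 2 - N = 2 by omega,
      show N + 2 - (N + 1) = 1 by omega]
    simp only [Finset.sum_range_succ, Finset.range_zero, Finset.sum_empty, diffCoeff_zero,
      diffCoeff_one, mul_zero, zero_mul, add_zero]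
    apply Finset.sum_congr rfl
    intro j _
    rw [Finset.mul_sum]
    exact Finset.sum_congr rfl fun i _ => by ring
  rw [h1, ← Finset.sum_range_diag_flip (N + 2) fun j i => β j * diffCoeff a b i * P (j + i)]
  have h2 : ∀ M ∈ Finset.range (N + 2), ∑ j ∈ Finset.range (M + 1),
      β j * diffCoeff a b (M - j) * P (j + (M - j)) =
      (if 2 ≤ M then x ^ (M - 2) / ((M - 2).factorial : ℂ) else 0) * P M := by
    intro M _
    rw [← hβ M, Finset.sum_mul]
    apply Finset.sum_congr rfl
    intro j hj
    rw [Finset.mem_range] at hj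
    rw [show j + (M - j) = M by omega]
  rw [Finset.sum_congr rfl h2, Finset.sum_range_succ', Finset.sum_range_succ']
  simp only [show ¬ (2 ≤ 0) by omega, show ¬ (2 ≤ 0 + 1) by omega, if_false, zero_mul, add_zero]
  apply Finset.sum_congr rfl
  intro i _
  rw [if_pos (by omega), show i + 1 + 1 - 2 = i by omega, show i + 1 + 1 = 2 + i by omega]
  ring

/-- Expand every term around w up to total derivative order N + 2. The Taylor polynomials cancel by
`sum_taylor_eq`, and each Taylor remainder is of the size of the derivative of order N + 2 of
w^{2-s}. -/
lemma exists_emR_bound {c : ℂ} (hc : c ≠ 0) {a b x : ℂ} {β : ℕ → ℂ} (hβ : IsEM a b x β) (N : ℕ)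
    (S : ℝ) : ∃ C R : ℝ, 0 ≤ C ∧ 0 < R ∧ ∀ s : ℂ, ‖s‖ ≤ S → ∀ w ∈ sector c R,
      ‖emR β N c a b x s w‖ ≤ C * ‖w‖ ^ (-(N + s.re)) := by
  -- One radius that covers all the shifts a, b, a + b and x, and is positive.
  set ρ : ℝ := ‖a‖ + ‖b‖ + ‖x‖ + 1 with hρdef
  have hρ : 0 < ρ := by positivity
  have hT : ∀ j ≤ N + 2, ∃ C : ℝ, 0 ≤ C ∧ ∀ s : ℂ, ‖s‖ ≤ S → ∀ w ∈ sector c (4 * ρ),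
      ∀ h : ℂ, ‖h‖ ≤ ρ → ‖pw c j s (w + h) - ∑ i ∈ Finset.range (N + 2 - j),
        pw c (j + i) s w * (h ^ i / (i.factorial : ℂ))‖ ≤ C * ‖w‖ ^ (-(N + s.re)) := by
    intro j hj
    obtain ⟨C, hC0, hC⟩ := exists_pw_bound hc hρ S (N + 2)
    refine ⟨C * ρ ^ (N + 2 - j), by positivity, fun s hs w hw h hh => ?_⟩
    have hB : ∀ y ∈ Metric.closedBall w ρ, ∃ v : ℂ, ‖v‖ ≤ ρ ∧ y = w + v := fun y hy =>
      ⟨y - w, by rwa [mem_closedBall_iff_norm] at hy, by ring⟩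
    have := norm_sub_taylor_le (convex_closedBall w ρ) (N + 2 - j) (fun i => pw c (j + i) s)
      (by
        intro i y hy
        obtain ⟨v, hv, rfl⟩ := hB y hy
        exact hasDerivAt_pw hc (mem_sector_add hc hρ hw hv).1 (j + i) s)
      (M := C * ‖w‖ ^ (-(N + s.re)))
      (by
        intro y hy
        obtain ⟨v, hv, rfl⟩ := hB y hy
        have := hC s hs w hw v hv
        rw [show j + (N + 2 - j) = N + 2 by omega]
        convert this using 3
        push_cast; ring)
      (w := w) (h := h) (by simp [hρ.le]) (by simpa [mem_closedBall_iff_norm] using hh)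
    refine this.trans ?_
    have h0 : 0 ≤ ‖w‖ ^ (-(N + s.re)) := by positivity
    calc _ ≤ C * ‖w‖ ^ (-(N + s.re)) * ρ ^ (N + 2 - j) := by gcongr
      _ = _ := by ring
  have hT' : ∀ j, ∃ C : ℝ, j ≤ N + 2 → 0 ≤ C ∧ ∀ s : ℂ, ‖s‖ ≤ S → ∀ w ∈ sector c (4 * ρ),
      ∀ h : ℂ, ‖h‖ ≤ ρ → ‖pw c j s (w + h) - ∑ i ∈ Finset.range (N + 2 - j),
        pw c (j + i) s w * (h ^ i / (i.factorial : ℂ))‖ ≤ C * ‖w‖ ^ (-(N + s.re)) := by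
    intro j
    by_cases hj : j ≤ N + 2
    · obtain ⟨C, hC⟩ := hT j hj
      exact ⟨C, fun _ => hC⟩
    · exact ⟨0, fun h => absurd h hj⟩
  choose C hC using hT'
  refine ⟨C 2 + ∑ j ∈ Finset.range N, ‖β j‖ * (4 * C j), 4 * ρ, ?_, by positivity, ?_⟩
  · refine add_nonneg (hC 2 (by omega)).1 (Finset.sum_nonneg fun j hj => ?_)
    rw [Finset.mem_range] at hj
    have := (hC j (by omega)).1
    positivity
  intro s hs w hw
  set B := ‖w‖ ^ (-(N + s.re))
  set T : ℕ → ℂ → ℂ := fun j h => pw c j s (w + h) - ∑ i ∈ Finset.range (N + 2 - j),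
        pw c (j + i) s w * (h ^ i / (i.factorial : ℂ)) with hTdef
  have hTb : ∀ j ≤ N + 2, ∀ h : ℂ, ‖h‖ ≤ ρ → ‖T j h‖ ≤ C j * B := fun j hj h hh =>
    (hC j hj).2 s hs w hw h hh
  have na := norm_nonneg a
  have nb := norm_nonneg b
  have nx := norm_nonneg x
  have nab := norm_add_le a b
  have key : emR β N c a b x s w = T 2 x -
      ∑ j ∈ Finset.range N, β j * (T j (a + b) - T j a - T j b + T j 0) := by
    have h1 : ∀ j, T j (a + b) - T j a - T j b + T j 0 = dd a b (pw c j s) w -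
        ∑ i ∈ Finset.range (N + 2 - j), pw c (j + i) s w * diffCoeff a b i := by
      intro j
      have : ∑ i ∈ Finset.range (N + 2 - j), pw c (j + i) s w * diffCoeff a b i =
        ∑ i ∈ Finset.range (N + 2 - j), pw c (j + i) s w * ((a + b) ^ i / (i.factorial : ℂ)) -
        ∑ i ∈ Finset.range (N + 2 - j), pw c (j + i) s w * (a ^ i / (i.factorial : ℂ)) -
        ∑ i ∈ Finset.range (N + 2 - j), pw c (j + i) s w * (b ^ i / (i.factorial : ℂ)) +
        ∑ i ∈ Finset.range (N + 2 - j), pw c (j + i) s w * (0 ^ i / (i.factorial : ℂ)) := by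
        rw [← Finset.sum_sub_distrib, ← Finset.sum_sub_distrib, ← Finset.sum_add_distrib]
        apply Finset.sum_congr rfl
        intro i _
        rw [diffCoeff]; ring
      rw [this]
      simp only [hTdef, dd, add_zero]
      ring
    simp only [h1, mul_sub, Finset.sum_sub_distrib]
    rw [sum_taylor_eq hβ N fun i => pw c i s w]
    have h2 : ∑ j ∈ Finset.range N, β j * dd a b (pw c j s) w = dd a b (emF β N c s) w := by
      simp only [dd, emF, ← Finset.sum_sub_distrib, ← Finset.sum_add_distrib]
      exact Finset.sum_congr rfl fun j _ => by ring
    rw [h2, emR]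
    simp only [hTdef]
    rw [show N + 2 - 2 = N by omega]
    ring
  rw [key]
  calc _ ≤ ‖T 2 x‖ + ∑ j ∈ Finset.range N, ‖β j * (T j (a + b) - T j a - T j b + T j 0)‖ :=
        (norm_sub_le _ _).trans (by gcongr; exact norm_sum_le _ _)
    _ ≤ C 2 * B + ∑ j ∈ Finset.range N, ‖β j‖ * (4 * C j) * B := by
        gcongr with j hj
        · exact hTb 2 (by omega) x (by linarith)
        · rw [Finset.mem_range] at hj
          rw [norm_mul, mul_assoc]
          gcongr
          have e1 := hTb j (by omega) (a + b) (by linarith)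
          have e2 := hTb j (by omega) a (by linarith)
          have e3 := hTb j (by omega) b (by linarith)
          have e4 := hTb j (by omega) 0 (by simp [hρ.le])
          have e5 := norm_add_le (T j (a + b) - T j a - T j b) (T j 0)
          have e6 := norm_sub_le (T j (a + b) - T j a) (T j b)
          have e7 := norm_sub_le (T j (a + b)) (T j a)
          linarith
    _ = _ := by rw [← Finset.sum_mul]; ring

/-! ### Lattice points of the quadrant -/

/-- The point `k a + l b`. -/
def pt (a b : ℂ) (n : ℕ × ℕ) : ℂ := n.1 * a + n.2 * b

/-- Since (k + 1)(l + 1) ≤ (k + l + 1)², the double series is dominated by a product of two single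
series with exponent p/2 > 1. -/
lemma summable_quadrant {η p : ℝ} (hη : 0 < η) (hp : 2 < p) :
    Summable fun n : ℕ × ℕ => (η * ((n.1 : ℝ) + n.2 + 1)) ^ (-p) := by
  have h1 : Summable fun k : ℕ => ((k : ℝ) + 1) ^ (-(p / 2)) := by
    have : Summable fun k : ℕ => (k : ℝ) ^ (-(p / 2)) := Real.summable_nat_rpow.2 (by linarith)
    exact_mod_cast (summable_nat_add_iff 1).2 this
  have h2 := (h1.mul_of_nonneg h1 (fun k => by positivity) (fun k => by positivity)).mul_left (η ^ (-p))
  refine Summable.of_nonneg_of_le (fun n => by positivity) (fun n => ?_) h2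
  have h3 : (0 : ℝ) ≤ n.1 := Nat.cast_nonneg _
  have h4 : (0 : ℝ) ≤ n.2 := Nat.cast_nonneg _
  rw [Real.mul_rpow hη.le (by positivity),
    ← Real.mul_rpow (x := (n.1 : ℝ) + 1) (y := (n.2 : ℝ) + 1) (by positivity) (by positivity)]
  apply mul_le_mul_of_nonneg_left _ (by positivity)
  have h5 : ((n.1 : ℝ) + n.2 + 1) ^ (-p) = (((n.1 : ℝ) + n.2 + 1) ^ 2) ^ (-(p / 2)) := by
    rw [← Real.rpow_natCast, ← Real.rpow_mul (by positivity)]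
    congr 1; push_cast; ring
  rw [h5]
  exact Real.rpow_le_rpow_of_nonpos (by positivity) (by nlinarith [mul_nonneg h3 h4]) (by linarith)

lemma tendsto_add_cofinite :
    Tendsto (fun n : ℕ × ℕ => (n.1 : ℝ) + n.2) cofinite atTop := by
  rw [tendsto_atTop]
  intro M
  rw [eventually_cofinite]
  obtain ⟨K, hK⟩ := exists_nat_gt M
  refine ((Set.finite_Iic K).prod (Set.finite_Iic K)).subset ?_
  rintro ⟨k, l⟩ h
  simp only [Set.mem_ofPred_eq, not_le] at h
  have h3 : (0 : ℝ) ≤ k := Nat.cast_nonneg _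
  have h4 : (0 : ℝ) ≤ l := Nat.cast_nonneg _
  simp only [Set.mem_prod, Set.mem_Iic]
  constructor
  · have : (k : ℝ) < K := by linarith
    exact_mod_cast this.le
  · have : (l : ℝ) < K := by linarith
    exact_mod_cast this.le

lemma exists_re_pt_ge {c a b : ℂ} (ha : 0 < (c * a).re) (hb : 0 < (c * b).re) :
    ∃ δ : ℝ, 0 < δ ∧ ∀ n : ℕ × ℕ, δ * ((n.1 : ℝ) + n.2) ≤ (c * pt a b n).re := by
  refine ⟨min (c * a).re (c * b).re, lt_min ha hb, fun n => ?_⟩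
  have h3 : (0 : ℝ) ≤ n.1 := Nat.cast_nonneg _
  have h4 : (0 : ℝ) ≤ n.2 := Nat.cast_nonneg _
  have e : (c * pt a b n).re = n.1 * (c * a).re + n.2 * (c * b).re := by
    have : c * pt a b n = ((n.1 : ℝ) : ℂ) * (c * a) + ((n.2 : ℝ) : ℂ) * (c * b) := by
      rw [pt]; push_cast; ring
    rw [this, Complex.add_re, Complex.re_ofReal_mul, Complex.re_ofReal_mul]
  rw [e, mul_add, mul_comm, mul_comm _ (n.2 : ℝ)]
  gcongr
  · exact min_le_left _ _
  · exact min_le_right _ _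

/-- The real part of c(k a + l b) grows linearly in k + l and eventually outweighs the bounded
contribution of y. All estimates are therefore uniform on the ball. -/
lemma exists_far {c a b : ℂ} (hc : c ≠ 0) (ha : 0 < (c * a).re) (hb : 0 < (c * b).re)
    (z : ℂ) (r R : ℝ) : ∃ η : ℝ, 0 < η ∧ ∀ᶠ n : ℕ × ℕ in cofinite, ∀ y ∈ Metric.ball z r,
      η * ((n.1 : ℝ) + n.2 + 1) ≤ ‖y + pt a b n‖ ∧ 0 < (c * (y + pt a b n)).re ∧
      y + pt a b n ∈ sector c R ∧ 1 ≤ ‖y + pt a b n‖ := by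
  obtain ⟨δ, hδ, hδn⟩ := exists_re_pt_ge ha hb
  have hcp : 0 < ‖c‖ := norm_pos_iff.2 hc
  refine ⟨δ / (2 * ‖c‖), by positivity, ?_⟩
  filter_upwards [tendsto_add_cofinite.eventually_ge_atTop
    ((‖c‖ * (‖z‖ + r) + δ / 2 + ‖c‖ * (|R| + 1)) / (δ / 2))] with n hn y hy
  rw [mem_ball_iff_norm] at hy
  have h0 : ‖y‖ ≤ ‖z‖ + r := by
    have := norm_add_le (y - z) z
    rw [sub_add_cancel] at this; linarith
  rw [div_le_iff₀ (by positivity)] at hn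
  have h1 : (c * (y + pt a b n)).re = (c * y).re + (c * pt a b n).re := by
    rw [mul_add, Complex.add_re]
  have h2 : |(c * y).re| ≤ ‖c‖ * ‖y‖ := (Complex.abs_re_le_norm _).trans (norm_mul _ _).le
  have h3 := neg_abs_le (c * y).re
  have h4 : ‖c‖ * ‖y‖ ≤ ‖c‖ * (‖z‖ + r) := by gcongr
  have h5 := hδn n
  have h6 : (c * (y + pt a b n)).re ≤ ‖c‖ * ‖y + pt a b n‖ :=
    (Complex.re_le_norm _).trans (norm_mul _ _).le
  have hsum : (0 : ℝ) ≤ (n.1 : ℝ) + n.2 := by positivity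
  have hR : 0 ≤ |R| := abs_nonneg R
  have h7 : ‖c‖ * (|R| + 1) ≤ (c * (y + pt a b n)).re := by nlinarith
  have h8 : δ / 2 * ((n.1 : ℝ) + n.2 + 1) ≤ (c * (y + pt a b n)).re := by nlinarith
  have h9 : |R| + 1 ≤ ‖y + pt a b n‖ := le_of_mul_le_mul_left (h7.trans h6) hcp
  have h10 : 0 < (c * (y + pt a b n)).re := lt_of_lt_of_le (by positivity) h7
  refine ⟨?_, h10, ⟨by linarith [le_abs_self R], ?_⟩, by linarith⟩
  · rw [div_mul_eq_mul_div, div_le_iff₀ (by positivity)]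
    linarith
  · have := norm_nonneg (c * (y + pt a b n))
    linarith

/-! ### Continuation of the zeta function of the quadrant -/

/-- The analytic continuation of `(1 - s) (2 - s) ∑ (z + x + k a + l b)^(-s)` to
`Re s > 2 - N`. -/
def emY (β : ℕ → ℂ) (N : ℕ) (c a b x z s : ℂ) : ℂ :=
  emF β N c s z + ∑' n : ℕ × ℕ, emR β N c a b x s (z + pt a b n)

section continuation

variable {c a b : ℂ}

lemma differentiable_emF (β : ℕ → ℂ) (N : ℕ) (w : ℂ) : Differentiable ℂ fun s => emF β N c s w := by
  unfold emF
  exact Differentiable.fun_sum fun j _ => (differentiable_pw c j w).const_mul _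

lemma differentiable_emR (β : ℕ → ℂ) (N : ℕ) (x w : ℂ) :
    Differentiable ℂ fun s => emR β N c a b x s w := by
  unfold emR dd
  exact (differentiable_pw c 2 _).sub ((((differentiable_emF β N _).sub
    (differentiable_emF β N _)).sub (differentiable_emF β N _)).add (differentiable_emF β N _))

lemma exists_emR_dominated (hc : c ≠ 0) (ha : 0 < (c * a).re) (hb : 0 < (c * b).re) {x : ℂ}
    {β : ℕ → ℂ} (hβ : IsEM a b x β) (N : ℕ) (z : ℂ) {s₀ : ℂ} (hs₀ : 2 - N < s₀.re) :
    ∃ r : ℝ, 0 < r ∧ ∃ u : ℕ × ℕ → ℝ, Summable u ∧ ∀ᶠ n : ℕ × ℕ in cofinite,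
      ∀ s ∈ Metric.ball s₀ r, ‖emR β N c a b x s (z + pt a b n)‖ ≤ u n := by
  -- Half the distance to the line Re s = 2 - N: on the ball N + Re s stays above 2 + r, so the
  -- majorant is summable over the quadrant.
  set r : ℝ := (s₀.re - (2 - N)) / 2 with hr
  have hr0 : 0 < r := by rw [hr]; linarith
  obtain ⟨C, R, hC, hR, hbd⟩ := exists_emR_bound hc hβ N (‖s₀‖ + r)
  obtain ⟨η, hη, hfar⟩ := exists_far hc ha hb z 1 R
  refine ⟨r, hr0, fun n => C * (η * ((n.1 : ℝ) + n.2 + 1)) ^ (-(N + (s₀.re - r))),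
    (summable_quadrant hη (by rw [hr]; linarith)).mul_left C, ?_⟩
  filter_upwards [hfar] with n hn s hs
  obtain ⟨h1, -, h3, h4⟩ := hn z (Metric.mem_ball_self one_pos)
  rw [mem_ball_iff_norm] at hs
  have hs1 : ‖s‖ ≤ ‖s₀‖ + r := by
    have := norm_add_le (s - s₀) s₀
    rw [sub_add_cancel] at this; linarith
  have hs2 : s₀.re - r ≤ s.re := by
    have := (abs_le.1 (Complex.abs_re_le_norm (s - s₀))).1
    rw [Complex.sub_re] at this; linarith
  refine (hbd s hs1 _ h3).trans (mul_le_mul_of_nonneg_left ?_ hC)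
  calc ‖z + pt a b n‖ ^ (-(N + s.re)) ≤ ‖z + pt a b n‖ ^ (-(N + (s₀.re - r))) :=
        Real.rpow_le_rpow_of_exponent_le h4 (by linarith)
    _ ≤ _ := Real.rpow_le_rpow_of_nonpos (by positivity) h1 (by rw [hr]; linarith)

lemma differentiableOn_emY (hc : c ≠ 0) (ha : 0 < (c * a).re) (hb : 0 < (c * b).re) {x : ℂ}
    {β : ℕ → ℂ} (hβ : IsEM a b x β) (N : ℕ) (z : ℂ) :
    DifferentiableOn ℂ (emY β N c a b x z) {s | 2 - (N : ℝ) < s.re} := by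
  intro s₀ hs₀
  obtain ⟨r, hr, u, hu, hfu⟩ := exists_emR_dominated hc ha hb hβ N z hs₀
  obtain ⟨h1, -, -⟩ := tsum_differentiableAt hr
    (fun n => (differentiable_emR β N x (z + pt a b n)).differentiableOn) hu hfu
  have h2 := h1.differentiableAt (Metric.isOpen_ball.mem_nhds (Metric.mem_ball_self (half_pos hr)))
  exact ((differentiable_emF β N z).differentiableAt.add h2).differentiableWithinAt

lemma summable_emR (hc : c ≠ 0) (ha : 0 < (c * a).re) (hb : 0 < (c * b).re) {x : ℂ}
    {β : ℕ → ℂ} (hβ : IsEM a b x β) (N : ℕ) (z : ℂ) {s : ℂ} (hs : 2 - N < s.re) :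
    Summable fun n : ℕ × ℕ => emR β N c a b x s (z + pt a b n) := by
  obtain ⟨r, hr, u, hu, hfu⟩ := exists_emR_dominated hc ha hb hβ N z hs
  refine Summable.of_norm_bounded_eventually hu ?_
  filter_upwards [hfu] with n hn using hn s (Metric.mem_ball_self hr)

lemma exists_pw_dominated (hc : c ≠ 0) (ha : 0 < (c * a).re) (hb : 0 < (c * b).re) (j : ℕ)
    (z s : ℂ) : ∃ C η : ℝ, 0 < η ∧ ∀ᶠ n : ℕ × ℕ in cofinite,
      ‖pw c j s (z + pt a b n)‖ ≤ C * ‖z + pt a b n‖ ^ (2 - s.re - j) ∧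
      η * ((n.1 : ℝ) + n.2 + 1) ≤ ‖z + pt a b n‖ := by
  obtain ⟨C, hC, hbd⟩ := exists_pw_bound hc one_pos ‖s‖ j
  obtain ⟨η, hη, hfar⟩ := exists_far hc ha hb z 1 (4 * 1)
  refine ⟨C, η, hη, ?_⟩
  filter_upwards [hfar] with n hn
  obtain ⟨h1, -, h3, h4⟩ := hn z (Metric.mem_ball_self one_pos)
  have := hbd s le_rfl _ h3 0 (by simp)
  rw [add_zero] at this
  exact ⟨this, h1⟩

lemma summable_pw_two (hc : c ≠ 0) (ha : 0 < (c * a).re) (hb : 0 < (c * b).re)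
    (z : ℂ) {s : ℂ} (hs : 2 < s.re) : Summable fun n : ℕ × ℕ => pw c 2 s (z + pt a b n) := by
  obtain ⟨C, η, hη, h⟩ := exists_pw_dominated hc ha hb 2 z s
  refine Summable.of_norm_bounded_eventually ((summable_quadrant hη hs).mul_left |C|) ?_
  filter_upwards [h] with n hn
  refine hn.1.trans ?_
  have e : 2 - s.re - (2 : ℕ) = -s.re := by push_cast; ring
  rw [e]
  refine mul_le_mul (le_abs_self C) ?_ (by positivity) (abs_nonneg C)
  exact Real.rpow_le_rpow_of_nonpos (by positivity) hn.2 (by linarith)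

/-- For Re s > 2 even the undifferentiated power w^{2-s} decays, so the far corners of the
telescoping sum disappear. -/
lemma tendsto_pw (hc : c ≠ 0) (ha : 0 < (c * a).re) (hb : 0 < (c * b).re) (j : ℕ)
    (z : ℂ) {s : ℂ} (hs : 2 < s.re) :
    Tendsto (fun n : ℕ × ℕ => pw c j s (z + pt a b n)) cofinite (𝓝 0) := by
  obtain ⟨C, η, hη, h⟩ := exists_pw_dominated hc ha hb j z s
  have h1 : Tendsto (fun n : ℕ × ℕ => η * ((n.1 : ℝ) + n.2 + 1)) cofinite atTop :=
    (tendsto_add_cofinite.atTop_add tendsto_const_nhds).const_mul_atTop hη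
  have h2 : Tendsto (fun n : ℕ × ℕ => ‖z + pt a b n‖) cofinite atTop :=
    tendsto_atTop_mono' _ (h.mono fun n hn => hn.2) h1
  have h3 := ((tendsto_rpow_neg_atTop (y := s.re + j - 2)
    (by have : (0 : ℝ) ≤ j := j.cast_nonneg
        linarith)).comp h2).const_mul C
  rw [mul_zero] at h3
  refine squeeze_zero_norm' ?_ h3
  filter_upwards [h] with n hn
  refine hn.1.trans (le_of_eq ?_)
  simp only [Function.comp]
  congr 2; ring

lemma pt_succ (z : ℂ) (n : ℕ × ℕ) :
    z + pt a b (n.1 + 1, n.2 + 1) = z + pt a b n + (a + b) ∧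
    z + pt a b (n.1 + 1, n.2) = z + pt a b n + a ∧
    z + pt a b (n.1, n.2 + 1) = z + pt a b n + b := by
  simp only [pt]
  push_cast
  refine ⟨by ring, by ring, by ring⟩

lemma hasSum_dd {F : ℂ → ℂ} {z : ℂ}
    (hF : Tendsto (fun n : ℕ × ℕ => F (z + pt a b n)) cofinite (𝓝 0))
    (hs : Summable fun n : ℕ × ℕ => dd a b F (z + pt a b n)) :
    HasSum (fun n : ℕ × ℕ => dd a b F (z + pt a b n)) (F z) := by
  have e : (fun n : ℕ × ℕ => dd a b F (z + pt a b n)) = fun n : ℕ × ℕ =>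
      F (z + pt a b (n.1 + 1, n.2 + 1)) - F (z + pt a b (n.1 + 1, n.2)) -
      F (z + pt a b (n.1, n.2 + 1)) + F (z + pt a b n) := by
    funext n
    obtain ⟨h1, h2, h3⟩ := pt_succ (a := a) (b := b) z n
    rw [h1, h2, h3, dd]
  rw [e] at hs ⊢
  have := hasSum_telescope hF hs
  simpa [pt] using this

/-- By definition of `emR` each term is a mixed difference of the main term plus a remainder. The
mixed differences telescope to the value of the main term at z. -/
lemma hasSum_emY (hc : c ≠ 0) (ha : 0 < (c * a).re) (hb : 0 < (c * b).re) {x : ℂ}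
    {β : ℕ → ℂ} (hβ : IsEM a b x β) (N : ℕ) (z : ℂ) {s : ℂ} (hs : 2 < s.re) :
    HasSum (fun n : ℕ × ℕ => pw c 2 s (z + x + pt a b n)) (emY β N c a b x z s) := by
  have h1 := summable_emR hc ha hb hβ N z (s := s) (by
    have : (0 : ℝ) ≤ N := N.cast_nonneg
    linarith)
  have h2 := summable_pw_two hc ha hb (z + x) hs
  have e : ∀ n : ℕ × ℕ, z + x + pt a b n = z + pt a b n + x := fun n => by ring
  simp only [e] at h2 ⊢
  have h3 : Summable fun n : ℕ × ℕ => dd a b (emF β N c s) (z + pt a b n) := by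
    refine (h2.sub h1).congr fun n => ?_
    rw [emR]; ring
  have h4 := hasSum_dd (F := emF β N c s) (z := z) (by
    have : Tendsto (fun n : ℕ × ℕ => ∑ j ∈ Finset.range N, β j * pw c j s (z + pt a b n)) cofinite
        (𝓝 (∑ j ∈ Finset.range N, β j * 0)) :=
      tendsto_finsetSum _ fun j _ => (tendsto_pw hc ha hb j z hs).const_mul _
    simpa [emF] using this) h3
  have h5 := h4.add h1.hasSum
  rw [emY]
  convert h5 using 1
  funext n
  rw [emR]; ring

end continuation

/-! ### The continued quadrant zeta function and its derivative at 0. -/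

lemma isOpen_re_gt (σ : ℝ) : IsOpen {s : ℂ | σ < s.re} := isOpen_lt continuous_const Complex.continuous_re

lemma eqOn_re_gt {f g : ℂ → ℂ} {σ : ℝ} (hf : DifferentiableOn ℂ f {s | σ < s.re})
    (hg : DifferentiableOn ℂ g {s | σ < s.re}) (h : ∀ s : ℂ, 2 < s.re → f s = g s) :
    ∀ s : ℂ, σ < s.re → f s = g s := by
  have ho := isOpen_re_gt σ
  have hp : ((|σ| + 3 : ℝ) : ℂ) ∈ {s : ℂ | σ < s.re} := by
    have := le_abs_self σ
    simp only [Set.mem_ofPred_eq, Complex.ofReal_re]; linarith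
  refine (hf.analyticOnNhd ho).eqOn_of_preconnected_of_eventuallyEq (hg.analyticOnNhd ho)
    (convex_halfSpace_re_gt σ).isPreconnected hp ?_
  have : {s : ℂ | 2 < s.re} ∈ 𝓝 ((|σ| + 3 : ℝ) : ℂ) := (isOpen_re_gt 2).mem_nhds (by
    have := abs_nonneg σ
    simp only [Set.mem_ofPred_eq, Complex.ofReal_re]; linarith)
  filter_upwards [this] with s hs using h s hs

lemma eqOn_compl_one_two {f g : ℂ → ℂ} (hf : DifferentiableOn ℂ f ({1, 2} : Set ℂ)ᶜ)
    (hg : DifferentiableOn ℂ g ({1, 2} : Set ℂ)ᶜ) (h : ∀ s : ℂ, 2 < s.re → f s = g s) :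
    Set.EqOn f g ({1, 2} : Set ℂ)ᶜ := by
  have hfin : ({1, 2} : Set ℂ).Finite := by simp
  have ho : IsOpen (({1, 2} : Set ℂ)ᶜ) := hfin.isClosed.isOpen_compl
  have hconn : IsPreconnected (({1, 2} : Set ℂ)ᶜ) :=
    (hfin.countable.isConnected_compl_of_one_lt_rank (by
      rw [Complex.rank_real_complex]; norm_num)).isPreconnected
  refine (hf.analyticOnNhd ho).eqOn_of_preconnected_of_eventuallyEq (hg.analyticOnNhd ho)
    hconn (z₀ := 3) (by norm_num) ?_
  have : {s : ℂ | 2 < s.re} ∈ 𝓝 (3 : ℂ) := (isOpen_re_gt 2).mem_nhds (by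
    simp only [Set.mem_ofPred_eq]; norm_num)
  filter_upwards [this] with s hs using h s hs

/-- `Z` continues the zeta series `∑ (z + k a + l b)^(-s)` of the quadrant. -/
def IsQuadrantZeta (c a b z : ℂ) (Z : ℂ → ℂ) : Prop :=
  DifferentiableOn ℂ Z ({1, 2} : Set ℂ)ᶜ ∧
    ∀ s : ℂ, 2 < s.re → HasSum (fun n : ℕ × ℕ => negPow c (z + pt a b n) s) (Z s)

/-- Starting the chain of derivatives at w^{2-s} produces the factor that clears the possible poles
at s = 1 and s = 2. -/
lemma pw_two (c s w : ℂ) : pw c 2 s w = (2 - s) * (1 - s) * negPow c w s := by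
  rw [pw, negPow, ← br]
  simp only [Finset.prod_range_succ, Finset.range_zero, Finset.prod_empty]
  congr 1
  · push_cast; ring
  · congr 1; push_cast; ring

section

variable {c a b : ℂ}

/-- The continuations obtained for different N agree on common half-planes by the identity theorem,
and these half-planes exhaust ℂ. -/
lemma exists_entire (hc : c ≠ 0) (ha : 0 < (c * a).re) (hb : 0 < (c * b).re) (z : ℂ) :
    ∃ Y : ℂ → ℂ, Differentiable ℂ Y ∧
      ∀ s : ℂ, 2 < s.re → HasSum (fun n : ℕ × ℕ => pw c 2 s (z + pt a b n)) (Y s) := by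
  have ha0 : a ≠ 0 := by rintro rfl; simp at ha
  have hb0 : b ≠ 0 := by rintro rfl; simp at hb
  obtain ⟨β, hβ⟩ := exists_isEM ha0 hb0 0
  have hY : ∀ N s, 2 < s.re → HasSum (fun n : ℕ × ℕ => pw c 2 s (z + pt a b n))
      (emY β N c a b 0 z s) := fun N s hs => by
    simpa using hasSum_emY hc ha hb hβ N z hs
  have hcons : ∀ N M : ℕ, N ≤ M → ∀ s : ℂ, 2 - (N : ℝ) < s.re →
      emY β N c a b 0 z s = emY β M c a b 0 z s := by
    intro N M hNM
    have hNM' : (N : ℝ) ≤ M := by exact_mod_cast hNM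
    refine eqOn_re_gt (differentiableOn_emY hc ha hb hβ N z)
      ((differentiableOn_emY hc ha hb hβ M z).mono fun s hs => ?_)
      fun s hs => (hY N s hs).unique (hY M s hs)
    simp only [Set.mem_ofPred_eq] at hs ⊢
    linarith
  have hN : ∀ s : ℂ, 2 - ((⌈2 - s.re⌉₊ + 1 : ℕ) : ℝ) < s.re := fun s => by
    have := Nat.le_ceil (2 - s.re)
    push_cast; linarith
  -- The order depends on s and is just large enough to give 2 - N < Re s. Near s₀ it can be frozen
  -- by consistency.
  refine ⟨fun s => emY β (⌈2 - s.re⌉₊ + 1) c a b 0 z s, fun s₀ => ?_, fun s hs => hY _ s hs⟩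
  set M := ⌈2 - s₀.re⌉₊ + 1
  have hev : (fun s => emY β (⌈2 - s.re⌉₊ + 1) c a b 0 z s) =ᶠ[𝓝 s₀] emY β M c a b 0 z := by
    filter_upwards [(isOpen_re_gt (2 - (M : ℝ))).mem_nhds (hN s₀)] with s hs
    rcases le_total (⌈2 - s.re⌉₊ + 1) M with h | h
    · exact hcons _ _ h s (hN s)
    · exact (hcons _ _ h s hs).symm
  refine DifferentiableAt.congr_of_eventuallyEq ?_ hev
  exact (differentiableOn_emY hc ha hb hβ M z).differentiableAt
    ((isOpen_re_gt (2 - (M : ℝ))).mem_nhds (hN s₀))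

lemma two_sub_mul_ne_zero {s : ℂ} (hs : s ∉ ({1, 2} : Set ℂ)) : (2 - s) * (1 - s) ≠ 0 := by
  simp only [Set.mem_insert_iff, Set.mem_singleton_iff, not_or] at hs
  exact mul_ne_zero (sub_ne_zero.2 (Ne.symm hs.2)) (sub_ne_zero.2 (Ne.symm hs.1))

lemma not_mem_of_two_lt_re {s : ℂ} (hs : 2 < s.re) : s ∉ ({1, 2} : Set ℂ) := by
  simp only [Set.mem_insert_iff, Set.mem_singleton_iff, not_or]
  constructor <;> rintro rfl <;> norm_num at hs

lemma isQuadrantZeta_of_entire {z : ℂ} {Y : ℂ → ℂ} (hY : Differentiable ℂ Y)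
    (h : ∀ s : ℂ, 2 < s.re → HasSum (fun n : ℕ × ℕ => pw c 2 s (z + pt a b n)) (Y s)) :
    IsQuadrantZeta c a b z fun s => Y s / ((2 - s) * (1 - s)) := by
  refine ⟨?_, fun s hs => ?_⟩
  · intro s hs
    have := two_sub_mul_ne_zero hs
    exact (hY.differentiableAt.fun_div (d := fun s => (2 - s) * (1 - s)) (by fun_prop)
      this).differentiableWithinAt
  · have h1 := (h s hs).div_const ((2 - s) * (1 - s))
    have h2 : (fun n : ℕ × ℕ => negPow c (z + pt a b n) s) =
        fun n => pw c 2 s (z + pt a b n) / ((2 - s) * (1 - s)) := by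
      funext n
      rw [pw_two, mul_div_cancel_left₀ _ (two_sub_mul_ne_zero (not_mem_of_two_lt_re hs))]
    rw [h2]
    exact h1

lemma exists_isQuadrantZeta (hc : c ≠ 0) (ha : 0 < (c * a).re) (hb : 0 < (c * b).re) (z : ℂ) :
    ∃ Z, IsQuadrantZeta c a b z Z := by
  obtain ⟨Y, hY, h⟩ := exists_entire hc ha hb z
  exact ⟨_, isQuadrantZeta_of_entire hY h⟩

lemma IsQuadrantZeta.eqOn {z : ℂ} {Z Z' : ℂ → ℂ} (h : IsQuadrantZeta c a b z Z)
    (h' : IsQuadrantZeta c a b z Z') : Set.EqOn Z Z' ({1, 2} : Set ℂ)ᶜ :=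
  eqOn_compl_one_two h.1 h'.1 fun s hs => (h.2 s hs).unique (h'.2 s hs)

lemma IsQuadrantZeta.swap {z : ℂ} {Z : ℂ → ℂ} (h : IsQuadrantZeta c a b z Z) :
    IsQuadrantZeta c b a z Z := by
  refine ⟨h.1, fun s hs => ?_⟩
  have := (Equiv.prodComm ℕ ℕ).hasSum_iff.2 (h.2 s hs)
  convert this using 1
  funext n
  simp [pt, add_comm]

/-- The functional that computes `Z' (0)` from `Y s = (2 - s) (1 - s) Z s`. -/
def lam (φ : ℂ → ℂ) : ℂ := deriv φ 0 / 2 + 3 / 4 * φ 0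

/-- Differentiating Y / ((2 - s)(1 - s)) at 0 gives Y'(0)/2 + 3Y(0)/4. Order 3 suffices, since 0
lies in Re s > -1. The split of the argument into z + x is free, which later yields `lg_shift`. -/
lemma IsQuadrantZeta.deriv_eq (hc : c ≠ 0) (ha : 0 < (c * a).re) (hb : 0 < (c * b).re) {x : ℂ}
    {β : ℕ → ℂ} (hβ : IsEM a b x β) {z : ℂ} {Z : ℂ → ℂ} (h : IsQuadrantZeta c a b (z + x) Z) :
    deriv Z 0 = lam (emY β 3 c a b x z) := by
  obtain ⟨Y, hY, hsum⟩ := exists_entire hc ha hb (z + x)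
  have h1 := h.eqOn (isQuadrantZeta_of_entire hY hsum)
  have hd := differentiableOn_emY hc ha hb hβ 3 z
  have h2 := eqOn_re_gt hY.differentiableOn hd
    fun s hs => (hsum s hs).unique (hasSum_emY hc ha hb hβ 3 z hs)
  have h0 : (0 : ℂ) ∈ {s : ℂ | 2 - ((3 : ℕ) : ℝ) < s.re} := by
    simp only [Set.mem_ofPred_eq]; norm_num
  have hn := (isOpen_re_gt (2 - ((3 : ℕ) : ℝ))).mem_nhds h0
  have hfin : ({1, 2} : Set ℂ).Finite := by simp
  have hev : Z =ᶠ[𝓝 0] fun s => emY β 3 c a b x z s / ((2 - s) * (1 - s)) := by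
    filter_upwards [hn, hfin.isClosed.isOpen_compl.mem_nhds (x := 0) (by simp)] with s hs hs'
    rw [h1 hs']
    simp only [h2 s hs]
  rw [hev.deriv_eq, lam]
  have hE := (hd.differentiableAt hn).hasDerivAt
  have hP : HasDerivAt (fun s : ℂ => (2 - s) * (1 - s)) (-3) 0 := by
    have h1 : HasDerivAt (fun s : ℂ => 2 - s) (-1) 0 := (hasDerivAt_id 0).const_sub 2
    have h2 : HasDerivAt (fun s : ℂ => 1 - s) (-1) 0 := (hasDerivAt_id 0).const_sub 1
    refine (h1.mul h2).congr_deriv ?_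
    norm_num
  rw [(hE.fun_div hP (by norm_num)).deriv]
  norm_num
  ring

/-- The main term of the logarithm of the gamma function. -/
def phi (β : ℕ → ℂ) (c w : ℂ) : ℂ := lam fun s => emF β 3 c s w

/-- The remainder of the logarithm of the gamma function. -/
def rho (β : ℕ → ℂ) (c a b x w : ℂ) : ℂ := lam fun s => emR β 3 c a b x s w

lemma lam_sub {f g : ℂ → ℂ} (hf : DifferentiableAt ℂ f 0) (hg : DifferentiableAt ℂ g 0) :
    lam (fun s => f s - g s) = lam f - lam g := by
  simp only [lam, deriv_fun_sub hf hg]; ring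

lemma lam_add {f g : ℂ → ℂ} (hf : DifferentiableAt ℂ f 0) (hg : DifferentiableAt ℂ g 0) :
    lam (fun s => f s + g s) = lam f + lam g := by
  simp only [lam, deriv_fun_add hf hg]; ring

lemma lam_const_mul {f : ℂ → ℂ} (hf : DifferentiableAt ℂ f 0) (k : ℂ) :
    lam (fun s => k * f s) = k * lam f := by
  simp only [lam, deriv_const_mul k hf]; ring

/-- The remainder series is dominated uniformly for s near 0, so `lam` may be applied term by term.
-/
lemma lam_emY (hc : c ≠ 0) (ha : 0 < (c * a).re) (hb : 0 < (c * b).re) {x : ℂ}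
    {β : ℕ → ℂ} (hβ : IsEM a b x β) (z : ℂ) :
    Summable (fun n : ℕ × ℕ => rho β c a b x (z + pt a b n)) ∧
    lam (emY β 3 c a b x z) = phi β c z + ∑' n : ℕ × ℕ, rho β c a b x (z + pt a b n) := by
  obtain ⟨r, hr, u, hu, hfu⟩ := exists_emR_dominated hc ha hb hβ 3 z (s₀ := 0) (by norm_num)
  obtain ⟨h1, h2, -⟩ := tsum_differentiableAt hr
    (fun n => (differentiable_emR β 3 x (z + pt a b n)).differentiableOn) hu hfu
  have hm : (0 : ℂ) ∈ Metric.ball (0 : ℂ) (r / 2) := Metric.mem_ball_self (half_pos hr)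
  have h3 := h1.differentiableAt (Metric.isOpen_ball.mem_nhds hm)
  have h4 := summable_emR hc ha hb hβ 3 z (s := 0) (by norm_num)
  have h5 := ((h2 0 hm).div_const 2).add (h4.hasSum.mul_left (3 / 4))
  refine ⟨h5.summable, ?_⟩
  have e : emY β 3 c a b x z = fun s => emF β 3 c s z +
    ∑' n : ℕ × ℕ, emR β 3 c a b x s (z + pt a b n) := rfl
  rw [e, lam_add (differentiable_emF β 3 z).differentiableAt h3, phi]
  congr 1
  exact h5.tsum_eq.symm

lemma lam_pw (c w : ℂ) :
    lam (fun s => pw c 0 s w) = Complex.exp (2 * br c w) * (3 / 4 - br c w / 2) ∧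
    lam (fun s => pw c 1 s w) = Complex.exp (br c w) * (1 - br c w) ∧
    lam (fun s => pw c 2 s w) = -br c w := by
  have hE : ∀ k : ℂ, HasDerivAt (fun s : ℂ => Complex.exp ((2 - s - k) * br c w))
      (Complex.exp ((2 - k) * br c w) * -br c w) 0 := by
    intro k
    have h1 : HasDerivAt (fun s : ℂ => 2 - s - k) (-1) 0 :=
      ((hasDerivAt_id 0).const_sub 2).sub_const k
    refine ((h1.mul_const (br c w)).cexp).congr_deriv ?_
    rw [sub_zero]; ring
  have h2 : HasDerivAt (fun s : ℂ => 2 - s) (-1) 0 := (hasDerivAt_id 0).const_sub 2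
  have h1 : HasDerivAt (fun s : ℂ => 2 - s - 1) (-1) 0 := h2.sub_const 1
  refine ⟨?_, ?_, ?_⟩
  · have e : (fun s => pw c 0 s w) = fun s => Complex.exp ((2 - s - 0) * br c w) := by
      funext s; simp [pw]
    rw [e, lam, (hE 0).deriv]
    simp only [sub_zero]; ring
  · have e : (fun s => pw c 1 s w) = fun s => (2 - s) * Complex.exp ((2 - s - 1) * br c w) := by
      funext s; simp [pw]
    rw [e, lam, (h2.fun_mul (hE 1)).deriv]
    norm_num; ring
  · have e : (fun s => pw c 2 s w) =
        fun s => ((2 - s) * (2 - s - 1)) * Complex.exp ((2 - s - 2) * br c w) := by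
      funext s; simp [pw, Finset.prod_range_succ]
    rw [e, lam, ((h2.fun_mul h1).fun_mul (hE 2)).deriv]
    norm_num; ring

lemma phi_eq (β : ℕ → ℂ) (c w : ℂ) :
    phi β c w = β 0 * (Complex.exp (2 * br c w) * (3 / 4 - br c w / 2)) +
      β 1 * (Complex.exp (br c w) * (1 - br c w)) - β 2 * br c w := by
  obtain ⟨h0, h1, h2⟩ := lam_pw c w
  have hd := fun j => (differentiable_pw c j w).differentiableAt (x := 0)
  have e : (fun s => emF β 3 c s w) = fun s => β 0 * pw c 0 s w + β 1 * pw c 1 s w +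
      β 2 * pw c 2 s w := by
    funext s; simp [emF, Finset.sum_range_succ]
  rw [phi, e, lam_add (((hd 0).const_mul _).fun_add ((hd 1).const_mul _)) ((hd 2).const_mul _),
    lam_add ((hd 0).const_mul _) ((hd 1).const_mul _), lam_const_mul (hd 0), lam_const_mul (hd 1),
    lam_const_mul (hd 2), h0, h1, h2]
  ring

lemma rho_eq (β : ℕ → ℂ) (c a b x w : ℂ) :
    rho β c a b x w = -br c (w + x) - dd a b (phi β c) w := by
  have hd := fun w => (differentiable_emF (c := c) β 3 w).differentiableAt (x := 0)
  unfold rho emR dd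
  rw [lam_sub (differentiable_pw c 2 _).differentiableAt
      ((((hd _).fun_sub (hd _)).fun_sub (hd _)).fun_add (hd _)),
    lam_add (((hd _).fun_sub (hd _)).fun_sub (hd _)) (hd _), lam_sub ((hd _).fun_sub (hd _)) (hd _),
    lam_sub (hd _) (hd _), (lam_pw c _).2.2]
  rfl

/-- Cauchy's estimate on the circle |s| = 1/2 bounds the s-derivative. There 3 + Re s ≥ 5/2, an
exponent above the threshold 2 for summation over the quadrant. -/
lemma exists_rho_bound (hc : c ≠ 0) {x : ℂ} {β : ℕ → ℂ} (hβ : IsEM a b x β) :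
    ∃ C R : ℝ, 0 ≤ C ∧ 1 ≤ R ∧ ∀ w ∈ sector c R,
      ‖rho β c a b x w‖ ≤ C * ‖w‖ ^ (-(5 / 2 : ℝ)) := by
  obtain ⟨C, R, hC, hR, hbd⟩ := exists_emR_bound hc hβ 3 (1 / 2)
  refine ⟨2 * C, max R 1, by positivity, le_max_right _ _, fun w hw => ?_⟩
  have hw1 : 1 ≤ ‖w‖ := (le_max_right _ _).trans hw.1
  have hw' : w ∈ sector c R := ⟨(le_max_left _ _).trans hw.1, hw.2⟩
  have hb : ∀ s : ℂ, ‖s‖ ≤ 1 / 2 → ‖emR β 3 c a b x s w‖ ≤ C * ‖w‖ ^ (-(5 / 2 : ℝ)) := by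
    intro s hs
    refine (hbd s hs w hw').trans (mul_le_mul_of_nonneg_left ?_ hC)
    apply Real.rpow_le_rpow_of_exponent_le hw1
    have := (abs_le.1 ((Complex.abs_re_le_norm s).trans hs)).1
    push_cast; linarith
  have h1 := Complex.norm_deriv_le_of_forall_mem_sphere_norm_le (c := 0) (R := 1 / 2)
    (C := C * ‖w‖ ^ (-(5 / 2 : ℝ))) (f := fun s => emR β 3 c a b x s w) (by norm_num)
    (differentiable_emR β 3 x w).diffContOnCl
    (fun s hs => hb s (by simpa using hs.le))
  have h2 := hb 0 (by simp)
  rw [rho, lam]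
  calc _ ≤ ‖deriv (fun s => emR β 3 c a b x s w) 0 / 2‖ + ‖3 / 4 * emR β 3 c a b x 0 w‖ :=
        norm_add_le _ _
    _ ≤ (C * ‖w‖ ^ (-(5 / 2 : ℝ)) / (1 / 2)) / 2 + 3 / 4 * (C * ‖w‖ ^ (-(5 / 2 : ℝ))) := by
        rw [norm_div, norm_mul]
        norm_num at h1 h2 ⊢
        linarith
    _ ≤ _ := by
        have : 0 ≤ C * ‖w‖ ^ (-(5 / 2 : ℝ)) := by positivity
        linarith

end

/-! ### The logarithm of the gamma function of the quadrant as a function of the argument -/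

/-- The Euler–Maclaurin representation of the logarithm of the gamma function at `z + x`. -/
def lg (β : ℕ → ℂ) (c a b x z : ℂ) : ℂ := phi β c z + ∑' n : ℕ × ℕ, rho β c a b x (z + pt a b n)

/-- A chain of successive derivatives starting from `w ^ 2 (3 / 4 - log w / 2)`. -/
def logChain (c : ℂ) : ℕ → ℂ → ℂ
  | 0, w => w ^ 2 * (3 / 4 - br c w / 2)
  | 1, w => w * (1 - br c w)
  | 2, w => -br c w
  | 3, w => -w⁻¹
  | 4, w => (w ^ 2)⁻¹
  | 5, w => -2 * (w ^ 3)⁻¹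
  | _, _ => 0

lemma hasDerivAt_logChain {c w : ℂ} (hc : c ≠ 0) (hw : c * w ∈ Complex.slitPlane) :
    ∀ j ≤ 4, HasDerivAt (logChain c j) (logChain c (j + 1) w) w := by
  have hw0 : w ≠ 0 := by rintro rfl; simp at hw
  have hb := hasDerivAt_br hc hw
  have hp := fun k : ℕ => hasDerivAt_pow k w
  intro j hj
  interval_cases j
  · refine ((hp 2).mul ((hb.div_const 2).const_sub (3 / 4))).congr_deriv ?_
    simp only [logChain]; field_simp; push_cast; ring
  · refine ((hasDerivAt_id w).mul (hb.const_sub 1)).congr_deriv ?_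
    simp only [logChain, id]; field_simp; ring
  · exact hb.neg.congr_deriv rfl
  · refine ((hasDerivAt_id w).inv hw0).neg.congr_deriv ?_
    simp only [logChain, id]; field_simp
  · refine ((hp 2).inv (pow_ne_zero 2 hw0)).congr_deriv ?_
    simp only [logChain]; field_simp; push_cast; ring

/-- The successive derivatives of `phi`. -/
def phiD (β : ℕ → ℂ) (c : ℂ) (k : ℕ) (w : ℂ) : ℂ :=
  β 0 * logChain c k w + β 1 * logChain c (k + 1) w + β 2 * logChain c (k + 2) w

lemma phi_eq_phiD {c w : ℂ} (hc : c ≠ 0) (hw : w ≠ 0) (β : ℕ → ℂ) : phi β c w = phiD β c 0 w := by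
  rw [phi_eq, phiD, two_mul, Complex.exp_add, exp_br hc hw]
  simp only [logChain]; ring

lemma hasDerivAt_phiD {c w : ℂ} (hc : c ≠ 0) (hw : c * w ∈ Complex.slitPlane) (β : ℕ → ℂ)
    (k : ℕ) (hk : k ≤ 2) : HasDerivAt (phiD β c k) (phiD β c (k + 1) w) w := by
  have h := hasDerivAt_logChain hc hw
  exact (((h k (by omega)).const_mul _).add ((h (k + 1) (by omega)).const_mul _)).add
    ((h (k + 2) (by omega)).const_mul _)

/-- The successive derivatives of `rho` (for `x = 0`). -/
def rhoD (β : ℕ → ℂ) (c a b : ℂ) (k : ℕ) (w : ℂ) : ℂ :=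
  logChain c (k + 2) w - dd a b (phiD β c k) w

section

variable {c a b : ℂ}

lemma mem_slitPlane_of_re {c w : ℂ} (h : 0 < (c * w).re) : c * w ∈ Complex.slitPlane := Or.inl h

lemma ne_zero_of_re {c w : ℂ} (h : 0 < (c * w).re) : w ≠ 0 := by rintro rfl; simp at h

lemma re_mul_add {c w h : ℂ} (hw : 0 < (c * w).re) (hh : 0 ≤ (c * h).re) :
    0 < (c * (w + h)).re := by
  rw [mul_add, Complex.add_re]; linarith

lemma isOpen_halfPlane (c : ℂ) : IsOpen {w : ℂ | 0 < (c * w).re} :=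
  isOpen_lt continuous_const (by fun_prop)

lemma re_pt_nonneg (ha : 0 < (c * a).re) (hb : 0 < (c * b).re) (n : ℕ × ℕ) :
    0 ≤ (c * pt a b n).re := by
  obtain ⟨δ, hδ, h⟩ := exists_re_pt_ge ha hb
  exact le_trans (by positivity) (h n)

lemma rho_eq_rhoD (hc : c ≠ 0) (ha : 0 < (c * a).re) (hb : 0 < (c * b).re) (β : ℕ → ℂ) {w : ℂ}
    (hw : 0 < (c * w).re) : rho β c a b 0 w = rhoD β c a b 0 w := by
  have hab : 0 < (c * (a + b)).re := re_mul_add ha hb.le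
  rw [rho_eq, rhoD, dd, dd, phi_eq_phiD hc (ne_zero_of_re hw),
    phi_eq_phiD hc (ne_zero_of_re (re_mul_add hw hab.le)),
    phi_eq_phiD hc (ne_zero_of_re (re_mul_add hw ha.le)),
    phi_eq_phiD hc (ne_zero_of_re (re_mul_add hw hb.le)), add_zero]
  rfl

lemma hasDerivAt_rhoD (hc : c ≠ 0) (ha : 0 < (c * a).re) (hb : 0 < (c * b).re) (β : ℕ → ℂ) {w : ℂ}
    (hw : 0 < (c * w).re) (k : ℕ) (hk : k ≤ 2) :
    HasDerivAt (rhoD β c a b k) (rhoD β c a b (k + 1) w) w := by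
  have hab : 0 < (c * (a + b)).re := re_mul_add ha hb.le
  have h := fun y (hy : 0 < (c * y).re) => hasDerivAt_phiD hc (mem_slitPlane_of_re hy) β k hk
  have h1 := hasDerivAt_logChain hc (mem_slitPlane_of_re hw) (k + 2) (by omega)
  have e : rhoD β c a b k = fun w => logChain c (k + 2) w - (phiD β c k (w + (a + b)) -
      phiD β c k (w + a) - phiD β c k (w + b) + phiD β c k w) := rfl
  rw [e]
  exact h1.fun_sub (((((h _ (re_mul_add hw hab.le)).comp_add_const w (a + b)).fun_sub
    ((h _ (re_mul_add hw ha.le)).comp_add_const w a)).fun_sub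
    ((h _ (re_mul_add hw hb.le)).comp_add_const w b)).fun_add (h w hw))

lemma iterate_deriv_eq_chain {U : Set ℂ} (hU : IsOpen U) {f : ℂ → ℂ} {F : ℕ → ℂ → ℂ} {m : ℕ}
    (h0 : Set.EqOn f (F 0) U) (hF : ∀ k < m, ∀ w ∈ U, HasDerivAt (F k) (F (k + 1) w) w) :
    ∀ k ≤ m, Set.EqOn (deriv^[k] f) (F k) U := by
  intro k
  induction k with
  | zero => intro _; exact h0
  | succ k ih =>
    intro hk w hw
    rw [Function.iterate_succ_apply']
    have : deriv^[k] f =ᶠ[𝓝 w] F k := by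
      filter_upwards [hU.mem_nhds hw] with y hy using ih (by omega) hy
    rw [this.deriv_eq, (hF k (by omega) w hw).deriv]

lemma differentiableAt_comp_add_const {f : ℂ → ℂ} (y h : ℂ) (hf : DifferentiableAt ℂ f (y + h)) :
    DifferentiableAt ℂ (fun y => f (y + h)) y :=
  (hf.hasDerivAt.comp_add_const y h).differentiableAt

lemma differentiableAt_rho (hc : c ≠ 0) (ha : 0 < (c * a).re) (hb : 0 < (c * b).re) (β : ℕ → ℂ)
    {w : ℂ} (hw : 0 < (c * w).re) : DifferentiableAt ℂ (rho β c a b 0) w := by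
  refine (hasDerivAt_rhoD hc ha hb β hw 0 (by omega)).differentiableAt.congr_of_eventuallyEq ?_
  filter_upwards [(isOpen_halfPlane c).mem_nhds hw] with y hy using rho_eq_rhoD hc ha hb β hy

lemma differentiableAt_phi (hc : c ≠ 0) (β : ℕ → ℂ)
    {w : ℂ} (hw : 0 < (c * w).re) : DifferentiableAt ℂ (phi β c) w := by
  refine (hasDerivAt_phiD hc (mem_slitPlane_of_re hw) β 0
    (by omega)).differentiableAt.congr_of_eventuallyEq ?_
  filter_upwards [(isOpen_halfPlane c).mem_nhds hw] with y hy using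
    phi_eq_phiD hc (ne_zero_of_re hy) β

lemma exists_rho_dominated (hc : c ≠ 0) (ha : 0 < (c * a).re) (hb : 0 < (c * b).re)
    {x : ℂ} {β : ℕ → ℂ} (hβ : IsEM a b x β) (z : ℂ) (r : ℝ) :
    ∃ u : ℕ × ℕ → ℝ, Summable u ∧ ∀ᶠ n : ℕ × ℕ in cofinite,
      ∀ y ∈ Metric.ball z r, ‖rho β c a b x (y + pt a b n)‖ ≤ u n := by
  obtain ⟨C, R, hC, hR, hbd⟩ := exists_rho_bound hc hβ
  obtain ⟨η, hη, hfar⟩ := exists_far hc ha hb z r R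
  refine ⟨fun n => C * (η * ((n.1 : ℝ) + n.2 + 1)) ^ (-(5 / 2 : ℝ)),
    (summable_quadrant hη (by norm_num)).mul_left C, ?_⟩
  filter_upwards [hfar] with n hn y hy
  obtain ⟨h1, -, h3, -⟩ := hn y hy
  refine (hbd _ h3).trans (mul_le_mul_of_nonneg_left ?_ hC)
  exact Real.rpow_le_rpow_of_nonpos (by positivity) h1 (by norm_num)

lemma exists_ball_halfPlane {z : ℂ} (hz : 0 < (c * z).re) :
    ∃ r : ℝ, 0 < r ∧ ∀ y ∈ Metric.ball z r, 0 < (c * y).re :=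
  Metric.isOpen_iff.1 (isOpen_halfPlane c) z hz

lemma summable_inv_cube (hc : c ≠ 0) (ha : 0 < (c * a).re) (hb : 0 < (c * b).re) (z : ℂ) :
    Summable fun n : ℕ × ℕ => ((z + pt a b n) ^ 3)⁻¹ := by
  obtain ⟨η, hη, hfar⟩ := exists_far hc ha hb z 1 1
  refine Summable.of_norm_bounded_eventually (summable_quadrant (p := 3) hη (by norm_num)) ?_
  filter_upwards [hfar] with n hn
  obtain ⟨h1, -, -, -⟩ := hn z (Metric.mem_ball_self one_pos)
  have h0 : 0 < η * ((n.1 : ℝ) + n.2 + 1) := by positivity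
  rw [norm_inv, norm_pow, Real.rpow_neg h0.le]
  rw [show (3 : ℝ) = ((3 : ℕ) : ℝ) by norm_num, Real.rpow_natCast]
  gcongr

lemma tendsto_inv_pt (hc : c ≠ 0) (ha : 0 < (c * a).re) (hb : 0 < (c * b).re) (z : ℂ) :
    Tendsto (fun n : ℕ × ℕ => (z + pt a b n)⁻¹) cofinite (𝓝 0) := by
  obtain ⟨η, hη, hfar⟩ := exists_far hc ha hb z 1 1
  have h1 : Tendsto (fun n : ℕ × ℕ => η * ((n.1 : ℝ) + n.2 + 1)) cofinite atTop :=
    (tendsto_add_cofinite.atTop_add tendsto_const_nhds).const_mul_atTop hη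
  have h2 : Tendsto (fun n : ℕ × ℕ => ‖z + pt a b n‖) cofinite atTop :=
    tendsto_atTop_mono' _ (hfar.mono fun n hn => (hn z (Metric.mem_ball_self one_pos)).1) h1
  exact tendsto_inv₀_cobounded.comp (tendsto_norm_atTop_iff_cobounded.1 h2)

/-- The third derivative of the logarithm of the gamma function. -/
lemma iterate_deriv_lg (hc : c ≠ 0) (ha : 0 < (c * a).re) (hb : 0 < (c * b).re)
    {β : ℕ → ℂ} (hβ : IsEM a b 0 β) {z : ℂ} (hz : 0 < (c * z).re) :
    AnalyticAt ℂ (lg β c a b 0) z ∧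
    deriv^[3] (lg β c a b 0) z = -2 * ∑' n : ℕ × ℕ, ((z + pt a b n) ^ 3)⁻¹ := by
  obtain ⟨r, hr, hball⟩ := exists_ball_halfPlane hz
  obtain ⟨u, hu, hfu⟩ := exists_rho_dominated hc ha hb hβ z r
  have hH : ∀ n : ℕ × ℕ, ∀ y, 0 < (c * y).re → 0 < (c * (y + pt a b n)).re := fun n y hy =>
    re_mul_add hy (re_pt_nonneg ha hb n)
  have hd : ∀ n : ℕ × ℕ, DifferentiableOn ℂ (fun y => rho β c a b 0 (y + pt a b n))
      (Metric.ball z r) := fun n y hy =>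
    (differentiableAt_comp_add_const y _
      (differentiableAt_rho hc ha hb β (hH n y (hball y hy)))).differentiableWithinAt
  obtain ⟨h1, -, v, hv, hfv⟩ := tsum_differentiableAt hr hd hu hfu
  have h2 := hasSum_iterate_deriv (half_pos hr)
    (fun n => (hd n).mono (Metric.ball_subset_ball (by linarith))) hv hfv 3
  have hm : Metric.ball z (r / 2) ∈ 𝓝 z := Metric.ball_mem_nhds z (half_pos hr)
  have hA1 : AnalyticAt ℂ (fun y => ∑' n : ℕ × ℕ, rho β c a b 0 (y + pt a b n)) z :=
    h1.analyticAt hm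
  have hA2 : AnalyticAt ℂ (phi β c) z := by
    have : DifferentiableOn ℂ (phi β c) {w | 0 < (c * w).re} := fun w hw =>
      (differentiableAt_phi hc β hw).differentiableWithinAt
    exact this.analyticAt ((isOpen_halfPlane c).mem_nhds hz)
  refine ⟨hA2.fun_add hA1, ?_⟩
  have e : lg β c a b 0 = phi β c + fun y => ∑' n : ℕ × ℕ, rho β c a b 0 (y + pt a b n) := rfl
  rw [e, ← iteratedDeriv_eq_iterate, iteratedDeriv_add hA2.contDiffAt hA1.contDiffAt,
    iteratedDeriv_eq_iterate, iteratedDeriv_eq_iterate, ← h2.tsum_eq]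
  have h3 : deriv^[3] (phi β c) z = phiD β c 3 z :=
    iterate_deriv_eq_chain (isOpen_halfPlane c) (F := phiD β c) (m := 3)
      (fun w hw => phi_eq_phiD hc (ne_zero_of_re hw) β)
      (fun k hk w hw => hasDerivAt_phiD hc (mem_slitPlane_of_re hw) β k (by omega)) 3 le_rfl hz
  have h4 : ∀ n : ℕ × ℕ, deriv^[3] (fun y => rho β c a b 0 (y + pt a b n)) z =
      rhoD β c a b 3 (z + pt a b n) := fun n =>
    iterate_deriv_eq_chain (isOpen_halfPlane c) (F := fun k y => rhoD β c a b k (y + pt a b n))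
      (m := 3) (fun w hw => rho_eq_rhoD hc ha hb β (hH n w hw))
      (fun k hk w hw => (hasDerivAt_rhoD hc ha hb β (hH n w hw) k (by omega)).comp_add_const w _)
      3 le_rfl hz
  rw [h3]
  simp only [h4] at h2 ⊢
  have h5 : Summable fun n : ℕ × ℕ => logChain c 5 (z + pt a b n) :=
    (summable_inv_cube hc ha hb z).mul_left (-2)
  have h6 : Summable fun n : ℕ × ℕ => dd a b (phiD β c 3) (z + pt a b n) := by
    refine (h5.sub h2.summable).congr fun n => ?_
    rw [rhoD]; ring
  -- The third derivative of `phi` is a combination of w⁻¹, w⁻² and w⁻³, hence decays. Its mixed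
  -- differences telescope to its value at z, so it cancels against the remainders and only -2 ∑ w⁻³
  -- is left.
  have h7 := hasSum_dd (F := phiD β c 3) (z := z) (by
    have t := tendsto_inv_pt hc ha hb z
    have := ((t.neg.const_mul (β 0)).add ((t.pow 2).const_mul (β 1))).add
      (((t.pow 3).const_mul (-2)).const_mul (β 2))
    simpa [phiD, logChain] using this) h6
  rw [← tsum_mul_left, ← h7.tsum_eq, ← h6.tsum_add h2.summable]
  apply tsum_congr
  intro n
  rw [rhoD]
  simp only [logChain]; ring

/-- The gamma function of the quadrant is holomorphic away from its poles. -/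
lemma analyticAt_exp_lg (hc : c ≠ 0) (ha : 0 < (c * a).re) (hb : 0 < (c * b).re)
    {β : ℕ → ℂ} (hβ : IsEM a b 0 β) {z₀ : ℂ} (hz : ∀ n, z₀ + pt a b n ≠ 0) :
    AnalyticAt ℂ (fun z => Complex.exp (lg β c a b 0 z)) z₀ := by
  obtain ⟨δ, hδ, hδn⟩ := exists_re_pt_ge ha hb
  -- Outside the box of side K every translate of a neighbourhood of z₀ lies in the half-plane where
  -- the branch is holomorphic.
  obtain ⟨K, hK⟩ := exists_nat_gt (-(c * z₀).re / δ)
  rw [div_lt_iff₀ hδ] at hK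
  have hfar : ∀ n : ℕ × ℕ, K ≤ n.1 ∨ K ≤ n.2 → ((K : ℝ)) * δ ≤ (c * pt a b n).re := by
    intro n hn
    refine le_trans ?_ (hδn n)
    have h1 : (0 : ℝ) ≤ n.1 := Nat.cast_nonneg _
    have h2 : (0 : ℝ) ≤ n.2 := Nat.cast_nonneg _
    rw [mul_comm]
    apply mul_le_mul_of_nonneg_left _ hδ.le
    rcases hn with hn | hn
    · have : (K : ℝ) ≤ n.1 := by exact_mod_cast hn
      linarith
    · have : (K : ℝ) ≤ n.2 := by exact_mod_cast hn
      linarith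
  have hopen : IsOpen {y : ℂ | 0 < (c * y).re + K * δ} := isOpen_lt continuous_const (by fun_prop)
  obtain ⟨r, hr, hball⟩ := Metric.isOpen_iff.1 hopen z₀ (by
    simp only [Set.mem_ofPred_eq]; linarith)
  have hpos : ∀ n : ℕ × ℕ, K ≤ n.1 ∨ K ≤ n.2 → ∀ y ∈ Metric.ball z₀ r,
      0 < (c * (y + pt a b n)).re := by
    intro n hn y hy
    have h1 := hball hy
    have h2 := hfar n hn
    simp only [Set.mem_ofPred_eq] at h1
    rw [mul_add, Complex.add_re]; linarith
  set box : Finset (ℕ × ℕ) := Finset.range K ×ˢ Finset.range K with hbox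
  have hnbox : ∀ n : ℕ × ℕ, n ∉ box → K ≤ n.1 ∨ K ≤ n.2 := by
    intro n hn
    simp only [hbox, Finset.mem_product, Finset.mem_range] at hn
    omega
  let f : ℕ × ℕ → ℂ → ℂ := fun n y => if n ∈ box then 0 else rho β c a b 0 (y + pt a b n)
  have hd : ∀ n, DifferentiableOn ℂ (f n) (Metric.ball z₀ r) := by
    intro n
    by_cases hn : n ∈ box
    · simp only [f, if_pos hn]; exact differentiableOn_const 0
    · simp only [f, if_neg hn]
      exact fun y hy => (differentiableAt_comp_add_const y _ (differentiableAt_rho hc ha hb β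
        (hpos n (hnbox n hn) y hy))).differentiableWithinAt
  obtain ⟨u, hu, hfu⟩ := exists_rho_dominated hc ha hb hβ z₀ r
  obtain ⟨h1, -, -⟩ := tsum_differentiableAt hr hd hu.norm (by
    filter_upwards [hfu] with n hn y hy
    by_cases h : n ∈ box
    · simp [f, if_pos h]
    · simp only [f, if_neg h]
      exact (hn y hy).trans (le_abs_self _))
  have hm : Metric.ball z₀ (r / 2) ∈ 𝓝 z₀ := Metric.ball_mem_nhds z₀ (half_pos hr)
  have hA : AnalyticAt ℂ (fun y => ∑' n, f n y) z₀ := h1.analyticAt hm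
  have hphi : ∀ n : ℕ × ℕ, K ≤ n.1 ∨ K ≤ n.2 →
      AnalyticAt ℂ (fun y => phi β c (y + pt a b n)) z₀ := by
    intro n hn
    have : DifferentiableOn ℂ (fun y => phi β c (y + pt a b n)) (Metric.ball z₀ r) := fun y hy =>
      (differentiableAt_comp_add_const y _
        (differentiableAt_phi hc β (hpos n hn y hy))).differentiableWithinAt
    exact this.analyticAt (Metric.ball_mem_nhds z₀ hr)
  -- Inside the box the logarithms exponentiate to inverse linear factors, and `phi` telescopes to
  -- three far corners. The term `phi β c y` cancels, so no cut passing near z₀ matters.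
  have hB : AnalyticAt ℂ (fun y => (∏ n ∈ box, (y + pt a b n)⁻¹) *
      Complex.exp (phi β c (y + pt a b (K, 0)) + phi β c (y + pt a b (0, K)) -
        phi β c (y + pt a b (K, K)) + ∑' n, f n y)) z₀ := by
    refine AnalyticAt.fun_mul (Finset.analyticAt_fun_prod _ fun n _ =>
      (analyticAt_id.fun_add analyticAt_const).fun_inv (hz n)) ?_
    exact ((((hphi (K, 0) (Or.inl le_rfl)).fun_add (hphi (0, K) (Or.inr le_rfl))).fun_sub
      (hphi (K, K) (Or.inl le_rfl))).fun_add hA).cexp'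
  refine hB.congr ?_
  have hne : ∀ᶠ y in 𝓝 z₀, ∀ n ∈ box, y + pt a b n ≠ 0 := by
    rw [Filter.eventually_all_finset]
    intro n _
    exact (continuous_id.add continuous_const).continuousAt.eventually_ne (hz n)
  filter_upwards [hne] with y hy
  have hs := (lam_emY hc ha hb hβ y).1
  have hsplit : ∑' n : ℕ × ℕ, rho β c a b 0 (y + pt a b n) =
      ∑ n ∈ box, rho β c a b 0 (y + pt a b n) + ∑' n, f n y := by
    have h2 : HasSum (fun n => if n ∈ box then rho β c a b 0 (y + pt a b n) else 0)
        (∑ n ∈ box, rho β c a b 0 (y + pt a b n)) := by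
      have : HasSum (fun n => if n ∈ box then rho β c a b 0 (y + pt a b n) else 0) _ :=
        hasSum_sum_of_ne_finset_zero (s := box) (fun n hn => if_neg hn)
      rwa [Finset.sum_congr rfl fun n hn => if_pos hn] at this
    have h3 := hs.hasSum.sub h2
    have h4 : (fun n => f n y) = fun n => rho β c a b 0 (y + pt a b n) -
        (if n ∈ box then rho β c a b 0 (y + pt a b n) else 0) := by
      funext n
      by_cases h : n ∈ box <;> simp [f, h]
    rw [h4, h3.tsum_eq]; ring
  have hbt : ∑ n ∈ box, dd a b (phi β c) (y + pt a b n) = phi β c (y + pt a b (K, K)) -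
      phi β c (y + pt a b (K, 0)) - phi β c (y + pt a b (0, K)) + phi β c y := by
    have := sum_box_telescope (fun n => phi β c (y + pt a b n)) K
    rw [show y + pt a b (0, 0) = y by simp [pt]] at this
    rw [← this]
    apply Finset.sum_congr rfl
    intro n _
    obtain ⟨h1, h2, h3⟩ := pt_succ (a := a) (b := b) y n
    rw [h1, h2, h3, dd]
  have hrho : ∑ n ∈ box, rho β c a b 0 (y + pt a b n) = -∑ n ∈ box, br c (y + pt a b n) -
      ∑ n ∈ box, dd a b (phi β c) (y + pt a b n) := by
    rw [← Finset.sum_neg_distrib, ← Finset.sum_sub_distrib]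
    exact Finset.sum_congr rfl fun n _ => by rw [rho_eq, add_zero]
  have hprod : ∏ n ∈ box, (y + pt a b n)⁻¹ = Complex.exp (-∑ n ∈ box, br c (y + pt a b n)) := by
    rw [← Finset.sum_neg_distrib, Complex.exp_sum]
    exact Finset.prod_congr rfl fun n hn => by rw [Complex.exp_neg, exp_br hc (hy n hn)]
  simp only [lg]
  rw [hprod, ← Complex.exp_add, hsplit, hrho, hbt]
  congr 1
  ring

end

/-! ### Logarithms of the infinite products -/

/-- The nome `e^{2 π i z / a}`. -/
def nome (a z : ℂ) : ℂ := Complex.exp (2 * Real.pi * Complex.I * (z / a))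

lemma norm_nome (a z : ℂ) : ‖nome a z‖ = Real.exp (-(2 * Real.pi * (z / a).im)) := by
  rw [nome, Complex.norm_exp]
  congr 1
  have : 2 * (Real.pi : ℂ) * Complex.I * (z / a) = ((2 * Real.pi : ℝ) : ℂ) * (Complex.I * (z / a)) := by
    push_cast; ring
  rw [this, Complex.re_ofReal_mul, Complex.I_mul_re]; ring

lemma nome_add (a z w : ℂ) : nome a (z + w) = nome a z * nome a w := by
  rw [nome, nome, nome, ← Complex.exp_add]; congr 1; ring

lemma nome_nat_mul (a b : ℂ) (k : ℕ) : nome a (k * b) = nome a b ^ k := by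
  rw [nome, nome, ← Complex.exp_nat_mul]; congr 1; ring

lemma nome_neg (a z : ℂ) : nome a (-z) = (nome a z)⁻¹ := by
  rw [nome, nome, ← Complex.exp_neg]; congr 1; ring

lemma nome_self {a : ℂ} (ha : a ≠ 0) : nome a a = 1 := by
  rw [nome, div_self ha, mul_one, Complex.exp_two_pi_mul_I]

lemma norm_nome_lt_one {a z : ℂ} (h : 0 < (z / a).im) : ‖nome a z‖ < 1 := by
  rw [norm_nome, Real.exp_lt_one_iff]
  have := Real.pi_pos
  have : 0 < 2 * Real.pi * (z / a).im := by positivity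
  linarith

/-- The threshold Im(z/a) > 1 brings the nome into the range where |log(1 - x)| ≤ (3/2)|x|. -/
lemma norm_nome_le_half {a z : ℂ} (h : 1 < (z / a).im) : ‖nome a z‖ ≤ 1 / 2 := by
  rw [norm_nome, Real.exp_neg, one_div]
  apply inv_anti₀ two_pos
  have h1 := Real.add_one_le_exp (2 * Real.pi * (z / a).im)
  have h2 := Real.pi_gt_three
  nlinarith

lemma hasDerivAt_nome (a z : ℂ) :
    HasDerivAt (nome a) (2 * Real.pi * Complex.I / a * nome a z) z := by
  have h := (((hasDerivAt_id z).div_const a).const_mul (2 * Real.pi * Complex.I)).cexp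
  refine h.congr_deriv ?_
  simp only [nome, id]; ring

/-- The successive derivatives of `log (1 - e^{2 π i z / a})`. -/
def logNome (a : ℂ) : ℕ → ℂ → ℂ
  | 0, z => Complex.log (1 - nome a z)
  | 1, z => -(2 * Real.pi * Complex.I / a) * (nome a z / (1 - nome a z))
  | 2, z => -(2 * Real.pi * Complex.I / a) ^ 2 * (nome a z / (1 - nome a z) ^ 2)
  | 3, z => -(2 * Real.pi * Complex.I / a) ^ 3 *
      (nome a z * (1 + nome a z) / (1 - nome a z) ^ 3)
  | _, _ => 0

lemma one_sub_ne_zero_of_norm {x : ℂ} (h : ‖x‖ < 1) : 1 - x ≠ 0 := by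
  intro h0
  rw [sub_eq_zero] at h0
  rw [← h0] at h; simp at h

lemma one_sub_mem_slitPlane {x : ℂ} (h : ‖x‖ < 1) : 1 - x ∈ Complex.slitPlane := by
  left
  have := (abs_le.1 (Complex.abs_re_le_norm x)).2
  simp only [Complex.sub_re, Complex.one_re]; linarith

lemma hasDerivAt_logNome {a z : ℂ} (h : 0 < (z / a).im) (k : ℕ) (hk : k < 3) :
    HasDerivAt (logNome a k) (logNome a (k + 1) z) z := by
  have h1 := norm_nome_lt_one h
  have hne := one_sub_ne_zero_of_norm h1
  have hE := hasDerivAt_nome a z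
  have hE1 := hE.const_sub 1
  interval_cases k
  · refine (hE1.clog (one_sub_mem_slitPlane h1)).congr_deriv ?_
    simp only [logNome]; ring
  · refine ((hE.div hE1 hne).const_mul _).congr_deriv ?_
    simp only [logNome]; field_simp; ring
  · refine ((hE.div (hE1.pow 2) (pow_ne_zero 2 hne)).const_mul _).congr_deriv ?_
    simp only [logNome, Pi.pow_apply]; field_simp; ring

/-- Write n² = 2·C(n+2, 2) - 3·C(n+1, 1) + 1 and use the binomial geometric series. -/
lemma hasSum_sq_mul_geometric {r : ℂ} (h : ‖r‖ < 1) :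
    HasSum (fun n : ℕ => (n : ℂ) ^ 2 * r ^ n) (r * (1 + r) / (1 - r) ^ 3) := by
  have hne := one_sub_ne_zero_of_norm h
  have h0 := hasSum_choose_mul_geometric_of_norm_lt_one 0 h
  have h1 := hasSum_choose_mul_geometric_of_norm_lt_one 1 h
  have h2 := hasSum_choose_mul_geometric_of_norm_lt_one 2 h
  have h3 := ((h2.mul_left 2).sub (h1.mul_left 3)).add h0
  have e : r * (1 + r) / (1 - r) ^ 3 = 2 * (1 / (1 - r) ^ (2 + 1)) - 3 * (1 / (1 - r) ^ (1 + 1)) +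
      1 / (1 - r) ^ (0 + 1) := by
    field_simp; ring
  rw [e]
  convert! h3 using 2 with n
  have e2 : (((n + 2).choose 2 : ℕ) : ℂ) = (n + 2) * (n + 1) / 2 := by
    rw [Nat.cast_choose_two]; push_cast; ring
  rw [e2, Nat.choose_one_right, Nat.choose_zero_right]
  push_cast; ring

/-- Lipschitz's formula. -/
lemma logNome_three {a z : ℂ} (h : 0 < (z / a).im) :
    logNome a 3 z = 2 * ∑' l : ℤ, ((z + l * a) ^ 3)⁻¹ := by
  have ha : a ≠ 0 := by rintro rfl; simp at h
  -- This identity turns ∑ (z/a + l)⁻³ into a multiple of ∑ n² e^{2πi n z/a}, which the previous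
  -- lemma sums in closed form.
  have h1 := EisensteinSeries.qExpansion_identity (k := 2) (by norm_num) ⟨z / a, h⟩
  have h2 := (hasSum_sq_mul_geometric (norm_nome_lt_one h)).tsum_eq
  rw [nome] at h2
  rw [h2] at h1
  have h3 : ∀ l : ℤ, ((z + l * a) ^ 3)⁻¹ = (a ^ 3)⁻¹ * (1 / (z / a + l) ^ (2 + 1)) := by
    intro l
    rw [one_div, ← mul_inv, ← mul_pow]
    congr 2; field_simp
  simp only [h3]
  rw [tsum_mul_left, h1]
  simp only [logNome, nome]
  simp only [Nat.factorial]
  field_simp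
  push_cast; ring

/-- The logarithm of `∏_{k ≥ 0} (1 - e^{2 π i (z + k b) / a})`. -/
def qlog (a b z : ℂ) : ℂ := ∑' k : ℕ, logNome a 0 (z + k * b)

lemma im_add_div {a b z : ℂ} (hb : 0 < (b / a).im) (hz : 1 < (z / a).im) (k : ℕ) :
    1 < ((z + k * b) / a).im := by
  have : ((z + k * b) / a).im = (z / a).im + k * (b / a).im := by
    rw [add_div, Complex.add_im, mul_div_assoc, ← Complex.ofReal_natCast, Complex.im_ofReal_mul]
  rw [this]
  have : 0 ≤ (k : ℝ) * (b / a).im := by positivity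
  linarith

lemma norm_logNome_le {a b z : ℂ} (hb : 0 < (b / a).im) (hz : 1 < (z / a).im) (k : ℕ) :
    ‖logNome a 0 (z + k * b)‖ ≤ 3 / 2 * ‖nome a z‖ * ‖nome a b‖ ^ k := by
  have h := Complex.norm_log_one_add_half_le_self (z := -nome a (z + k * b)) (by
    rw [norm_neg]; exact norm_nome_le_half (im_add_div hb hz k))
  rw [← sub_eq_add_neg, norm_neg, nome_add, nome_nat_mul, norm_mul, norm_pow] at h
  simp only [logNome]
  rw [nome_add, nome_nat_mul, mul_assoc]
  exact h

lemma norm_qlog_le {a b z : ℂ} (hb : 0 < (b / a).im) (hz : 1 < (z / a).im) :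
    ‖qlog a b z‖ ≤ 3 / 2 * ‖nome a z‖ * (1 - ‖nome a b‖)⁻¹ :=
  tsum_of_norm_bounded ((hasSum_geometric_of_lt_one (norm_nonneg _)
    (norm_nome_lt_one hb)).mul_left _) (norm_logNome_le hb hz)

lemma exp_qlog {a b z : ℂ} (hb : 0 < (b / a).im) (hz : 1 < (z / a).im) :
    Complex.exp (qlog a b z) = ∏' k : ℕ, (1 - nome a z * nome a b ^ k) := by
  have e : ∀ k : ℕ, 1 - nome a z * nome a b ^ k = 1 - nome a (z + k * b) := fun k => by
    rw [nome_add, nome_nat_mul]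
  simp only [e]
  refine Complex.cexp_tsum_eq_tprod (fun k => ?_) ?_
  · exact one_sub_ne_zero_of_norm (norm_nome_lt_one (by linarith [im_add_div hb hz k]))
  · exact Summable.of_norm_bounded ((summable_geometric_of_lt_one (norm_nonneg _)
      (norm_nome_lt_one hb)).mul_left _) (norm_logNome_le hb hz)

lemma isOpen_im_div_gt (a : ℂ) (t : ℝ) : IsOpen {z : ℂ | t < (z / a).im} :=
  isOpen_lt continuous_const (by fun_prop)

/-- Differentiate the logarithmic series termwise, and apply Lipschitz's formula to each row z + k
b. -/
lemma iterate_deriv_qlog {a b z : ℂ} (hb : 0 < (b / a).im) (hz : 1 < (z / a).im) :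
    AnalyticAt ℂ (qlog a b) z ∧
    HasSum (fun k : ℕ => 2 * ∑' l : ℤ, ((z + k * b + l * a) ^ 3)⁻¹) (deriv^[3] (qlog a b) z) := by
  obtain ⟨r, hr, hball⟩ := Metric.isOpen_iff.1 (isOpen_im_div_gt a 1) z hz
  have hpos : ∀ k : ℕ, ∀ y : ℂ, 1 < (y / a).im → 0 < ((y + k * b) / a).im := fun k y hy => by
    linarith [im_add_div hb hy k]
  have hD : ∀ k : ℕ, ∀ j < 3, ∀ y ∈ {z : ℂ | 1 < (z / a).im},
      HasDerivAt (fun y => logNome a j (y + k * b)) (logNome a (j + 1) (y + k * b)) y :=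
    fun k j hj y hy => (hasDerivAt_logNome (hpos k y hy) j hj).comp_add_const y _
  have hd : ∀ k : ℕ, DifferentiableOn ℂ (fun y => logNome a 0 (y + k * b)) (Metric.ball z r) :=
    fun k y hy => (hD k 0 (by norm_num) y (hball hy)).differentiableAt.differentiableWithinAt
  have hu : Summable fun k : ℕ => 3 / 2 * 1 * ‖nome a b‖ ^ k :=
    (summable_geometric_of_lt_one (norm_nonneg _) (norm_nome_lt_one hb)).mul_left _
  have hbd : ∀ k : ℕ, ∀ y ∈ Metric.ball z r,
      ‖logNome a 0 (y + k * b)‖ ≤ 3 / 2 * 1 * ‖nome a b‖ ^ k := by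
    intro k y hy
    have h1 : 1 < (y / a).im := hball hy
    refine (norm_logNome_le hb h1 k).trans ?_
    have := norm_nome_le_half h1
    gcongr
    linarith
  refine ⟨(Complex.differentiableOn_tsum_of_summable_norm hu hd Metric.isOpen_ball hbd).analyticAt
    (Metric.ball_mem_nhds z hr), ?_⟩
  have h := hasSum_iterate_deriv hr hd hu hbd 3
  have e : (fun k : ℕ => 2 * ∑' l : ℤ, ((z + k * b + l * a) ^ 3)⁻¹) =
      fun k : ℕ => deriv^[3] (fun y => logNome a 0 (y + k * b)) z := by
    funext k
    rw [← logNome_three (hpos k z hz)]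
    exact (iterate_deriv_eq_chain (isOpen_im_div_gt a 1) (F := fun j y => logNome a j (y + k * b))
      (m := 3) (fun _ _ => rfl) (hD k) 3 le_rfl hz).symm
  rw [e]
  exact h

/-- The lattice sum over a quadrant. -/
def cubeSum (a b z : ℂ) : ℂ := ∑' n : ℕ × ℕ, ((z + pt a b n) ^ 3)⁻¹

lemma cubeSum_swap (a b z : ℂ) : cubeSum a b z = cubeSum b a z := by
  rw [cubeSum, ← (Equiv.prodComm ℕ ℕ).tsum_eq]
  exact tsum_congr fun n => by simp [pt, add_comm]

lemma cubeSum_neg (a b z : ℂ) : cubeSum (-a) (-b) (-z) = -cubeSum a b z := by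
  rw [cubeSum, cubeSum, ← tsum_neg]
  refine tsum_congr fun n => ?_
  have : -z + pt (-a) (-b) n = -(z + pt a b n) := by simp only [pt]; ring
  rw [this, Odd.neg_pow (by decide), inv_neg]

lemma exists_halfPlane {a b : ℂ} (h : (b / a).im ≠ 0) :
    ∃ c : ℂ, c ≠ 0 ∧ 0 < (c * a).re ∧ 0 < (c * b).re := by
  have ha : a ≠ 0 := by rintro rfl; simp at h
  set t := b / a with ht
  have hb : b = t * a := by rw [ht]; field_simp
  -- This c is the solution of Re(c a) = Re(c b) = 1 with t = b/a. It makes the cube sums available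
  -- for every sign choice of the two periods.
  refine ⟨(1 + (1 - t.re) / t.im * -Complex.I) / a, ?_, ?_, ?_⟩
  all_goals
    have e : (1 + ((1 - t.re : ℝ) : ℂ) / (t.im : ℂ) * -Complex.I) =
      ⟨1, -((1 - t.re) / t.im)⟩ := by
      apply Complex.ext <;> simp [← Complex.ofReal_div, -Complex.ofReal_sub]
  · push_cast at e
    rw [e]
    refine div_ne_zero (fun h0 => ?_) ha
    have := congrArg Complex.re h0
    simp at this
  · push_cast at e
    rw [e, div_mul_cancel₀ _ ha]; norm_num
  · push_cast at e
    rw [e, hb, mul_comm t a, ← mul_assoc, div_mul_cancel₀ _ ha, Complex.mul_re]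
    field_simp
    norm_num

lemma summable_cube {a b : ℂ} (h : (b / a).im ≠ 0) (z : ℂ) :
    Summable fun n : ℕ × ℕ => ((z + pt a b n) ^ 3)⁻¹ := by
  obtain ⟨c, hc, h1, h2⟩ := exists_halfPlane h
  exact summable_inv_cube hc h1 h2 z

lemma im_div_ne_zero_swap {a b : ℂ} (h : (b / a).im ≠ 0) : (a / b).im ≠ 0 := by
  intro h0
  apply h
  rw [← inv_div, Complex.inv_im, h0]; simp

/-- The half-plane ℤ a + ℕ b is the disjoint union of the quadrant of (a, b) and the quadrant of
(-a, b) translated by -a. -/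
lemma iterate_deriv_qlog_eq {a b z : ℂ} (hb : 0 < (b / a).im) (hz : 1 < (z / a).im) :
    deriv^[3] (qlog a b) z = 2 * (cubeSum a b z + cubeSum (-a) b (z - a)) := by
  have s1 : Summable fun n : ℕ × ℕ => ((z + pt b a n) ^ 3)⁻¹ :=
    summable_cube (im_div_ne_zero_swap hb.ne') z
  have s2 : Summable fun n : ℕ × ℕ => ((z - a + pt b (-a) n) ^ 3)⁻¹ := by
    refine summable_cube ?_ _
    rw [neg_div, Complex.neg_im]
    exact neg_ne_zero.2 (im_div_ne_zero_swap hb.ne')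
  have e1 := s1.tsum_prod
  have e2 := s2.tsum_prod
  rw [← (iterate_deriv_qlog hb hz).2.tsum_eq, tsum_mul_left, cubeSum_swap a b,
    cubeSum_swap (-a) b, cubeSum, cubeSum, e1, e2, ← (s1.prod).tsum_add s2.prod]
  congr 1
  apply tsum_congr
  intro k
  have t1 : Summable fun l : ℕ => ((z + k * b + ((l : ℤ) : ℂ) * a) ^ 3)⁻¹ := by
    refine (s1.prod_factor k).congr fun l => ?_
    simp only [pt]; push_cast; congr 2; ring
  have t2 : Summable fun l : ℕ => ((z + k * b + ((-(l + 1 : ℤ) : ℤ) : ℂ) * a) ^ 3)⁻¹ := by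
    refine (s2.prod_factor k).congr fun l => ?_
    simp only [pt]; push_cast; congr 2; ring
  rw [tsum_of_nat_of_neg_add_one (f := fun l : ℤ => ((z + k * b + (l : ℂ) * a) ^ 3)⁻¹) t1 t2]
  congr 1
  · apply tsum_congr; intro l
    simp only [pt]; push_cast; congr 2; ring
  · apply tsum_congr; intro l
    simp only [pt]; push_cast; congr 2; ring

/-! ### The double sine function of the quadrant near infinity -/

/-- The relations for M = 2, 3, 4 form a triangular system for β 0, β 1, β 2. -/
lemma IsEM.coeffs {a b x : ℂ} {β : ℕ → ℂ} (ha : a ≠ 0) (hb : b ≠ 0) (h : IsEM a b x β) :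
    β 0 = 1 / (a * b) ∧ β 1 = (x - (a + b) / 2) / (a * b) ∧
    β 2 = (6 * x ^ 2 - 6 * (a + b) * x + a ^ 2 + 3 * a * b + b ^ 2) / (12 * (a * b)) := by
  have h2 := h 2
  have h3 := h 3
  have h4 := h 4
  simp only [Finset.sum_range_succ, Finset.range_zero, Finset.sum_empty, diffCoeff_zero,
    diffCoeff_one, diffCoeff_two, diffCoeff_three, diffCoeff_four, Nat.sub_self, Nat.sub_zero,
    Nat.factorial, Nat.reduceSub, le_refl, if_true, Nat.reduceLeDiff, zero_add, mul_zero, add_zero]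
    at h2 h3 h4
  norm_num at h2 h3 h4
  have e0 : β 0 = 1 / (a * b) := by
    rw [eq_div_iff (mul_ne_zero ha hb)]; exact h2
  rw [e0] at h3 h4
  have e1 : β 1 = (x - (a + b) / 2) / (a * b) := by
    field_simp at h3 ⊢
    linear_combination h3
  refine ⟨e0, e1, ?_⟩
  rw [e1] at h4
  field_simp at h4 ⊢
  linear_combination h4 / 4

/-- Half the second double Bernoulli polynomial. -/
def halfB (a b z : ℂ) : ℂ :=
  (6 * z ^ 2 - 6 * (a + b) * z + a ^ 2 + 3 * a * b + b ^ 2) / (12 * (a * b))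

section

variable {c a b : ℂ}

/-- Both sides are the derivative at 0 of one continued zeta function. With x = a + b this moves the
main term of log Γ(a + b - z) to the point -z, where it can be compared with the main term at z. -/
lemma lg_shift (hc : c ≠ 0) (ha : 0 < (c * a).re) (hb : 0 < (c * b).re) {x : ℂ} {β β' : ℕ → ℂ}
    (hβ : IsEM a b 0 β) (hβ' : IsEM a b x β') (z : ℂ) :
    lg β c a b 0 (z + x) = lg β' c a b x z := by
  obtain ⟨Z, hZ⟩ := exists_isQuadrantZeta hc ha hb (z + x)
  have h1 := hZ.deriv_eq hc ha hb hβ'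
  have h2 := IsQuadrantZeta.deriv_eq hc ha hb hβ (z := z + x) (by rwa [add_zero])
  rw [h1, (lam_emY hc ha hb hβ' z).2, (lam_emY hc ha hb hβ (z + x)).2] at h2
  exact h2.symm

lemma br_sub_br_neg {w : ℂ} (h : 0 < (c * w).im) : br c w - br c (-w) = Real.pi * Complex.I := by
  rw [br, br, mul_neg, sub_sub_sub_cancel_right, Complex.log, Complex.log, Complex.arg_neg_eq_arg_sub_pi_of_im_pos h, norm_neg]
  push_cast; ring

/-- Replacing x = 0 by x = a + b keeps β 0 and β 2 and changes the sign of β 1. Hence the parts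
without logarithms cancel, and the rest is log z - log(-z) = πi times a quadratic polynomial. This
is where the Bernoulli polynomial comes from. -/
lemma phi_reflection (hc : c ≠ 0) (ha : a ≠ 0) (hb : b ≠ 0) {β β' : ℕ → ℂ}
    (hβ : IsEM a b 0 β) (hβ' : IsEM a b (a + b) β') {z : ℂ} (h : 0 < (c * z).im) :
    -phi β c z + phi β' c (-z) = Real.pi * Complex.I * halfB a b z := by
  have hz : z ≠ 0 := by rintro rfl; simp at h
  obtain ⟨h0, h1, h2⟩ := hβ.coeffs ha hb
  obtain ⟨k0, k1, k2⟩ := hβ'.coeffs ha hb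
  rw [phi_eq_phiD hc hz, phi_eq_phiD hc (neg_ne_zero.2 hz), phiD, phiD]
  simp only [logChain]
  rw [← br_sub_br_neg h, h0, h1, h2, k0, k1, k2, halfB]
  field_simp
  ring

/-- Along d the real part of c w does not grow, so one bound is not enough. With S = k + l and W =
|c(z + y d + k a + l b)| one has W ≥ δ S - A and W ≥ m y - A - M S. Weighting these by M and δ
eliminates S and produces κ = δ m / (δ + M). -/
lemma exists_far_line (hc : c ≠ 0) (ha : 0 < (c * a).re) (hb : 0 < (c * b).re) (z : ℂ) {d : ℂ}
    (hd : d ≠ 0) (hd' : (c * d).re = 0) (R : ℝ) : ∃ η κ A : ℝ, 0 < η ∧ 0 < κ ∧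
      ∀ᶠ y : ℝ in atTop, ∀ n : ℕ × ℕ, η * ((n.1 : ℝ) + n.2 + 1) ≤ ‖z + y * d + pt a b n‖ ∧
        κ * y - A ≤ ‖z + y * d + pt a b n‖ ∧ z + y * d + pt a b n ∈ sector c R := by
  obtain ⟨δ, hδ, hδn⟩ := exists_re_pt_ge ha hb
  have hcp : 0 < ‖c‖ := norm_pos_iff.2 hc
  set m := ‖c * d‖ with hm
  have hm0 : 0 < m := norm_pos_iff.2 (mul_ne_zero hc hd)
  set M := ‖c‖ * (‖a‖ + ‖b‖) with hM
  have hM0 : 0 ≤ M := by positivity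
  set A := ‖c * z‖ with hA
  have hA0 : 0 ≤ A := norm_nonneg _
  set κ := δ * m / (δ + M) with hκ
  have hκ0 : 0 < κ := by positivity
  refine ⟨δ / (2 * ‖c‖), κ / ‖c‖, A / ‖c‖, by positivity, by positivity, ?_⟩
  -- With this threshold W > 2A while the real part is at least -A, which is exactly the sector
  -- condition. The other summands serve the remaining lower bounds.
  filter_upwards [eventually_ge_atTop 0, eventually_ge_atTop ((3 * A + δ + 1 + |R| * ‖c‖) / κ)]
    with y hy0 hy n
  rw [div_le_iff₀ hκ0] at hy
  have hR : 0 ≤ |R| * ‖c‖ := by positivity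
  have hS : (0 : ℝ) ≤ (n.1 : ℝ) + n.2 := by positivity
  set S : ℝ := (n.1 : ℝ) + n.2 with hSdef
  have e : c * (z + y * d + pt a b n) = c * z + (y : ℂ) * (c * d) + c * pt a b n := by ring
  have hre : δ * S - A ≤ (c * (z + y * d + pt a b n)).re := by
    rw [e, Complex.add_re, Complex.add_re, Complex.re_ofReal_mul, hd', mul_zero, add_zero]
    have h1 := hδn n
    have h2 := (abs_le.1 (Complex.abs_re_le_norm (c * z))).1
    linarith
  have hN1 := Complex.re_le_norm (c * (z + y * d + pt a b n))
  have hpt : ‖c * pt a b n‖ ≤ M * S := by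
    rw [norm_mul, hM, mul_assoc]
    apply mul_le_mul_of_nonneg_left _ hcp.le
    have h1 : ‖pt a b n‖ ≤ n.1 * ‖a‖ + n.2 * ‖b‖ := by
      refine (norm_add_le _ _).trans ?_
      simp
    have h2 : (0 : ℝ) ≤ n.1 := Nat.cast_nonneg _
    have h3 : (0 : ℝ) ≤ n.2 := Nat.cast_nonneg _
    nlinarith [norm_nonneg a, norm_nonneg b]
  have hN2 : y * m - A - M * S ≤ ‖c * (z + y * d + pt a b n)‖ := by
    have h1 : ‖(y : ℂ) * (c * d)‖ = y * m := by
      rw [norm_mul, Complex.norm_real, Real.norm_of_nonneg hy0]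
    have h2 : (y : ℂ) * (c * d) = c * (z + y * d + pt a b n) - c * z - c * pt a b n := by ring
    have h3 : ‖(y : ℂ) * (c * d)‖ ≤ ‖c * (z + y * d + pt a b n)‖ + ‖c * z‖ + ‖c * pt a b n‖ := by
      rw [h2]
      exact (norm_sub_le _ _).trans (by gcongr; exact norm_sub_le _ _)
    linarith
  set W := ‖c * (z + y * d + pt a b n)‖ with hW
  have hN3 : κ * y - A ≤ W := by
    have h1 : κ * (δ + M) = δ * m := by rw [hκ]; field_simp
    have h2 : (δ + M) * (κ * y - A) ≤ (δ + M) * W := by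
      have e1 := mul_le_mul_of_nonneg_left hN2 hδ.le
      have e2 := mul_le_mul_of_nonneg_left (hre.trans hN1) hM0
      calc (δ + M) * (κ * y - A) = δ * (y * m - A - M * S) + M * (δ * S - A) := by
            linear_combination y * h1
        _ ≤ δ * W + M * W := add_le_add e1 e2
        _ = _ := by ring
    exact le_of_mul_le_mul_left h2 (by positivity)
  have hWw : W = ‖c‖ * ‖z + y * d + pt a b n‖ := norm_mul _ _
  refine ⟨?_, ?_, ?_, ?_⟩
  · rw [div_mul_eq_mul_div, div_le_iff₀ (by positivity)]
    have : δ * (S + 1) ≤ 2 * W := by linarith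
    linarith
  · rw [div_mul_eq_mul_div, ← sub_div, div_le_iff₀ hcp]
    linarith
  · have h1 : |R| * ‖c‖ ≤ ‖c‖ * ‖z + y * d + pt a b n‖ := by linarith
    rw [mul_comm] at h1
    exact (le_abs_self R).trans (le_of_mul_le_mul_left h1 hcp)
  · have : 0 ≤ δ * S := by positivity
    linarith

/-- Dominated convergence: the bound by η is independent of y, and the bound by κ makes each term
tend to 0. -/
lemma tendsto_rho_line (hc : c ≠ 0) (ha : 0 < (c * a).re) (hb : 0 < (c * b).re)
    {x : ℂ} {β : ℕ → ℂ} (hβ : IsEM a b x β) (z : ℂ) {d : ℂ} (hd : d ≠ 0) (hd' : (c * d).re = 0) :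
    Tendsto (fun y : ℝ => ∑' n : ℕ × ℕ, rho β c a b x (z + y * d + pt a b n)) atTop (𝓝 0) := by
  obtain ⟨C, R, hC, -, hbd⟩ := exists_rho_bound hc hβ
  obtain ⟨η, κ, A, hη, hκ, hfar⟩ := exists_far_line hc ha hb z hd hd' R
  have hs : Summable fun n : ℕ × ℕ => C * (η * ((n.1 : ℝ) + n.2 + 1)) ^ (-(5 / 2 : ℝ)) :=
    (summable_quadrant hη (by norm_num)).mul_left C
  have h0 : (0 : ℂ) = ∑' _ : ℕ × ℕ, (0 : ℂ) := tsum_zero.symm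
  rw [h0]
  refine tendsto_tsum_of_dominated_convergence hs (fun n => ?_) ?_
  · have h1 : Tendsto (fun y : ℝ => κ * y - A) atTop atTop :=
      tendsto_atTop_add_const_right _ _ (tendsto_id.const_mul_atTop hκ)
    have h2 : Tendsto (fun y : ℝ => ‖z + y * d + pt a b n‖) atTop atTop :=
      tendsto_atTop_mono' _ (hfar.mono fun y hy => (hy n).2.1) h1
    have h3 := ((tendsto_rpow_neg_atTop (y := 5 / 2) (by norm_num)).comp h2).const_mul C
    rw [mul_zero] at h3
    refine squeeze_zero_norm' ?_ h3
    filter_upwards [hfar] with y hy using hbd _ (hy n).2.2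
  · filter_upwards [hfar] with y hy n
    obtain ⟨h1, -, h3⟩ := hy n
    refine (hbd _ h3).trans (mul_le_mul_of_nonneg_left ?_ hC)
    exact Real.rpow_le_rpow_of_nonpos (by positivity) h1 (by norm_num)

/-- A function with vanishing third derivative is a quadratic polynomial. -/
lemma exists_quadratic {V : Set ℂ} (hV : IsOpen V) (hV' : Convex ℝ V) {D : ℂ → ℂ}
    (hD : DifferentiableOn ℂ D V) (h3 : ∀ z ∈ V, deriv^[3] D z = 0) :
    ∃ p q r : ℂ, ∀ z ∈ V, D z = p * z ^ 2 + q * z + r := by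
  have hconn := hV'.isPreconnected
  have d1 : DifferentiableOn ℂ (deriv D) V := hD.deriv hV
  have d2 : DifferentiableOn ℂ (deriv (deriv D)) V := d1.deriv hV
  have at' : ∀ {f : ℂ → ℂ}, DifferentiableOn ℂ f V → ∀ z ∈ V, HasDerivAt f (deriv f z) z :=
    fun hf z hz => (hf.differentiableAt (hV.mem_nhds hz)).hasDerivAt
  obtain ⟨p, hp⟩ := hV.exists_is_const_of_deriv_eq_zero hconn d2 (fun z hz => h3 z hz)
  have g1 : ∀ z ∈ V, HasDerivAt (fun z => deriv D z - p * z) 0 z := fun z hz => by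
    have := (at' d1 z hz).sub ((hasDerivAt_id z).const_mul p)
    rw [hp z hz] at this
    exact this.congr_deriv (by simp)
  obtain ⟨q, hq⟩ := hV.exists_is_const_of_deriv_eq_zero hconn
    (fun z hz => (g1 z hz).differentiableAt.differentiableWithinAt) (fun z hz => (g1 z hz).deriv)
  have g2 : ∀ z ∈ V, HasDerivAt (fun z => D z - (p / 2 * z ^ 2 + q * z)) 0 z := fun z hz => by
    have := (at' hD z hz).sub ((((hasDerivAt_id z).pow 2).const_mul (p / 2)).add
      ((hasDerivAt_id z).const_mul q))
    refine this.congr_deriv ?_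
    have := hq z hz
    simp
    linear_combination this
  obtain ⟨r, hr⟩ := hV.exists_is_const_of_deriv_eq_zero hconn
    (fun z hz => (g2 z hz).differentiableAt.differentiableWithinAt) (fun z hz => (g2 z hz).deriv)
  refine ⟨p / 2, q, r, fun z hz => ?_⟩
  have := hr z hz
  linear_combination this

/-- A quadratic polynomial that tends to zero along a line vanishes. -/
lemma quadratic_eq_zero {p q r : ℂ} (h : Tendsto (fun y : ℝ => p * (y : ℂ) ^ 2 + q * y + r) atTop
    (𝓝 0)) : p = 0 ∧ q = 0 ∧ r = 0 := by
  have hs : ∀ k : ℝ, Tendsto (fun y : ℝ => y + k) atTop atTop := fun k =>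
    tendsto_atTop_add_const_right _ _ tendsto_id
  have hp : p = 0 := by
    -- The second difference isolates 2p. The first difference then isolates q.
    have h1 := ((h.comp (hs 2)).sub ((h.comp (hs 1)).const_mul 2)).add h
    have h2 : Tendsto (fun _ : ℝ => 2 * p) atTop (𝓝 (0 - 2 * 0 + 0)) := by
      refine h1.congr fun y => ?_
      simp only [Function.comp]; push_cast; ring
    have := tendsto_nhds_unique h2 tendsto_const_nhds
    simpa using this.symm
  subst hp
  have hq : q = 0 := by
    have h1 := (h.comp (hs 1)).sub h
    have h2 : Tendsto (fun _ : ℝ => q) atTop (𝓝 (0 - 0)) := by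
      refine h1.congr fun y => ?_
      simp only [Function.comp]; push_cast; ring
    have := tendsto_nhds_unique h2 tendsto_const_nhds
    simpa using this.symm
  subst hq
  refine ⟨rfl, rfl, ?_⟩
  have h2 : Tendsto (fun _ : ℝ => r) atTop (𝓝 0) := by
    refine h.congr fun y => ?_
    ring
  exact (tendsto_nhds_unique h2 tendsto_const_nhds).symm

lemma tendsto_qlog_line {a b z d : ℂ} (hb : 0 < (b / a).im) (hd : 0 < (d / a).im) :
    (∀ᶠ y : ℝ in atTop, 1 < ((z + y * d) / a).im) ∧
      Tendsto (fun y : ℝ => qlog a b (z + y * d)) atTop (𝓝 0) := by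
  have e : ∀ y : ℝ, ((z + y * d) / a).im = (z / a).im + y * (d / a).im := fun y => by
    rw [add_div, Complex.add_im, mul_div_assoc, Complex.im_ofReal_mul]
  have h1 : Tendsto (fun y : ℝ => ((z + y * d) / a).im) atTop atTop := by
    simp only [e]
    exact tendsto_atTop_add_const_left _ _ (tendsto_id.atTop_mul_const hd)
  refine ⟨h1.eventually_gt_atTop 1, ?_⟩
  have h2 : Tendsto (fun y : ℝ => ‖nome a (z + y * d)‖) atTop (𝓝 0) := by
    simp only [norm_nome]
    exact Real.tendsto_exp_neg_atTop_nhds_zero.comp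
      (h1.const_mul_atTop (by positivity : (0 : ℝ) < 2 * Real.pi))
  have h3 := (h2.const_mul (3 / 2)).mul_const (1 - ‖nome a b‖)⁻¹
  rw [mul_zero, zero_mul] at h3
  refine squeeze_zero_norm' ?_ h3
  filter_upwards [h1.eventually_gt_atTop 1] with y hy using norm_qlog_le hb hy

/-- A half strip on which all logarithms are holomorphic. -/
def halfStrip (c a b : ℂ) : Set ℂ :=
  {z | 0 < (c * z).re ∧ 0 < (c * (a + b - z)).re ∧ 1 < (z / a).im ∧ 1 < ((z - a) / b).im}

lemma isOpen_halfStrip (c a b : ℂ) : IsOpen (halfStrip c a b) :=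
  (isOpen_halfPlane c).inter (((isOpen_halfPlane c).preimage
    (by fun_prop : Continuous fun z : ℂ => a + b - z)).inter ((isOpen_im_div_gt a 1).inter
    ((isOpen_im_div_gt b 1).preimage (by fun_prop : Continuous fun z : ℂ => z - a))))

lemma convex_halfStrip (c a b : ℂ) : Convex ℝ (halfStrip c a b) := by
  intro z hz w hw s t hs ht hst
  obtain ⟨h1, h2, h3, h4⟩ := hz
  obtain ⟨k1, k2, k3, k4⟩ := hw
  have hst' : (s : ℂ) + t = 1 := by exact_mod_cast hst
  have pos : ∀ {p q : ℝ}, 0 < p → 0 < q → 0 < s * p + t * q := fun {p q} hp hq => by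
    rcases hs.eq_or_lt with rfl | hs'
    · rw [zero_add] at hst; subst hst; simpa using hq
    · have := mul_pos hs' hp
      have := mul_nonneg ht hq.le
      linarith
  simp only [Complex.real_smul]
  refine ⟨?_, ?_, ?_, ?_⟩
  · have : c * (s * z + t * w) = s * (c * z) + t * (c * w) := by ring
    rw [this, Complex.add_re, Complex.re_ofReal_mul, Complex.re_ofReal_mul]
    exact pos h1 k1
  · have : c * (a + b - (s * z + t * w)) = s * (c * (a + b - z)) + t * (c * (a + b - w)) := by
      linear_combination (-(c * (a + b))) * hst'
    rw [this, Complex.add_re, Complex.re_ofReal_mul, Complex.re_ofReal_mul]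
    exact pos h2 k2
  · have : (s * z + t * w) / a = s * (z / a) + t * (w / a) := by ring
    rw [this, Complex.add_im, Complex.im_ofReal_mul, Complex.im_ofReal_mul]
    have := pos (sub_pos.2 h3) (sub_pos.2 k3)
    nlinarith
  · have : (s * z + t * w - a) / b = s * ((z - a) / b) + t * ((w - a) / b) := by
      linear_combination (-(a / b)) * (-hst')
    rw [this, Complex.add_im, Complex.im_ofReal_mul, Complex.im_ofReal_mul]
    have := pos (sub_pos.2 h4) (sub_pos.2 k4)
    nlinarith

lemma im_neg_div_pos {a b : ℂ} (h : 0 < (b / a).im) : 0 < (-a / b).im := by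
  have ha : a ≠ 0 := by rintro rfl; simp at h
  have hb : b ≠ 0 := by rintro rfl; simp at h
  rw [neg_div, ← inv_div, Complex.neg_im, Complex.inv_im, neg_div, neg_neg]
  exact div_pos h (Complex.normSq_pos.2 (div_ne_zero hb ha))

lemma im_I_div_pos {w : ℂ} (h : 0 < (c * w).re) : 0 < (Complex.I / c / w).im := by
  rw [div_div, div_eq_mul_inv, Complex.I_mul_im, Complex.inv_re]
  exact div_pos h (Complex.normSq_pos.2 (by rintro h0; simp [h0] at h))

lemma iteratedDeriv_three_quadratic (p q r z : ℂ) :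
    deriv^[3] (fun z : ℂ => p * z ^ 2 + q * z + r) z = 0 := by
  have h1 : deriv (fun z : ℂ => p * z ^ 2 + q * z + r) = fun z => 2 * p * z + q := by
    funext z
    have := (((hasDerivAt_pow 2 z).const_mul p).add ((hasDerivAt_id z).const_mul q)).add_const r
    refine (HasDerivAt.deriv this).trans ?_
    simp; ring
  have h2 : deriv (fun z : ℂ => 2 * p * z + q) = fun _ => 2 * p := by
    funext z
    have := ((hasDerivAt_id z).const_mul (2 * p)).add_const q
    exact (HasDerivAt.deriv this).trans (by simp)
  simp [Function.iterate_succ_apply', h1, h2]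

/-- The product formula on the half strip. -/
lemma lg_reflection_halfStrip (hc : c ≠ 0) (ha : 0 < (c * a).re) (hb : 0 < (c * b).re)
    (him : 0 < (b / a).im) {β : ℕ → ℂ} (hβ : IsEM a b 0 β) :
    (halfStrip c a b).Nonempty ∧ ∀ z ∈ halfStrip c a b,
      -lg β c a b 0 z + lg β c a b 0 (a + b - z) =
        Real.pi * Complex.I * halfB a b z + qlog a b z - qlog b (-a) (z - a) := by
  have ha0 := ne_zero_of_re ha
  have hb0 := ne_zero_of_re hb
  have him' := im_neg_div_pos him
  obtain ⟨β', hβ'⟩ := exists_isEM ha0 hb0 (a + b)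
  set V := halfStrip c a b
  obtain ⟨p₀, q₀, r₀, hquad⟩ : ∃ p q r : ℂ, ∀ z, Real.pi * Complex.I * halfB a b z =
      p * z ^ 2 + q * z + r :=
    ⟨Real.pi * Complex.I * (6 / (12 * (a * b))),
      Real.pi * Complex.I * (-6 * (a + b) / (12 * (a * b))),
      Real.pi * Complex.I * ((a ^ 2 + 3 * a * b + b ^ 2) / (12 * (a * b))), fun z => by
        rw [halfB]; ring⟩
  let D1 : ℂ → ℂ := lg β c a b 0
  let D2 : ℂ → ℂ := fun z => lg β c a b 0 (a + b - z)
  let D3 : ℂ → ℂ := qlog a b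
  let D4 : ℂ → ℂ := fun z => qlog b (-a) (z - a)
  let D5 : ℂ → ℂ := fun z => p₀ * z ^ 2 + q₀ * z + r₀
  let D : ℂ → ℂ := fun z => D2 z - D1 z - D3 z + D4 z - D5 z
  have hA : ∀ z ∈ V, AnalyticAt ℂ D1 z ∧ AnalyticAt ℂ D2 z ∧ AnalyticAt ℂ D3 z ∧
      AnalyticAt ℂ D4 z ∧ AnalyticAt ℂ D5 z := by
    intro z hz
    obtain ⟨h1, h2, h3, h4⟩ := hz
    refine ⟨(iterate_deriv_lg hc ha hb hβ h1).1, ?_, (iterate_deriv_qlog him h3).1, ?_, ?_⟩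
    · exact (iterate_deriv_lg hc ha hb hβ h2).1.fun_comp (f := fun z => a + b - z) (by fun_prop)
    · exact (iterate_deriv_qlog him' h4).1.fun_comp (f := fun z => z - a) (by fun_prop)
    · simp only [D5]; fun_prop
  have hDA : ∀ z ∈ V, AnalyticAt ℂ D z := fun z hz => by
    obtain ⟨h1, h2, h3, h4, h5⟩ := hA z hz
    exact (((h2.fun_sub h1).fun_sub h3).fun_add h4).fun_sub h5
  -- The two gamma terms give the quadrant of (a, b) and its opposite. The product in a gives those
  -- of (a, b) and (-a, b), the product in b those of (-a, b) and (-a, -b). With the signs of `D`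
  -- all four cancel.
  have hD3 : ∀ z ∈ V, deriv^[3] D z = 0 := by
    intro z hz
    obtain ⟨h1, h2, h3, h4, h5⟩ := hA z hz
    obtain ⟨k1, k2, k3, k4⟩ := hz
    have e : D = D2 - D1 - D3 + D4 - D5 := rfl
    have t1 : iteratedDeriv 3 D1 z = -2 * cubeSum a b z := by
      rw [iteratedDeriv_eq_iterate]; exact (iterate_deriv_lg hc ha hb hβ k1).2
    have t2 : iteratedDeriv 3 D2 z = 2 * cubeSum a b (a + b - z) := by
      have := congrFun (iteratedDeriv_comp_const_sub (n := 3) (f := lg β c a b 0) (s := a + b)) z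
      refine this.trans ?_
      rw [iteratedDeriv_eq_iterate, (iterate_deriv_lg hc ha hb hβ k2).2, cubeSum, smul_eq_mul]
      ring
    have t3 : iteratedDeriv 3 D3 z = 2 * (cubeSum a b z + cubeSum (-a) b (z - a)) := by
      rw [iteratedDeriv_eq_iterate]; exact iterate_deriv_qlog_eq him k3
    have t4 : iteratedDeriv 3 D4 z = 2 * (cubeSum (-a) b (z - a) - cubeSum a b (a + b - z)) := by
      have := congrFun (iteratedDeriv_comp_sub_const (n := 3) (f := qlog b (-a)) (s := a)) z
      refine this.trans ?_
      simp only [iteratedDeriv_eq_iterate]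
      rw [iterate_deriv_qlog_eq him' k4, cubeSum_swap b (-a), cubeSum_swap (-b) (-a)]
      have : z - a - b = -(a + b - z) := by ring
      rw [this, cubeSum_neg]
      ring
    have t5 : iteratedDeriv 3 D5 z = 0 := by
      rw [iteratedDeriv_eq_iterate]; exact iteratedDeriv_three_quadratic p₀ q₀ r₀ z
    rw [← iteratedDeriv_eq_iterate, e,
      iteratedDeriv_sub (((h2.sub h1).sub h3).add h4).contDiffAt h5.contDiffAt,
      iteratedDeriv_add ((h2.sub h1).sub h3).contDiffAt h4.contDiffAt,
      iteratedDeriv_sub (h2.sub h1).contDiffAt h3.contDiffAt,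
      iteratedDeriv_sub h2.contDiffAt h1.contDiffAt, t1, t2, t3, t4, t5]
    ring
  obtain ⟨p, q, r, hpqr⟩ := exists_quadratic (isOpen_halfStrip c a b) (convex_halfStrip c a b)
    (fun z hz => (hDA z hz).differentiableAt.differentiableWithinAt) hD3
  set d : ℂ := Complex.I / c with hd
  have hd0 : d ≠ 0 := div_ne_zero Complex.I_ne_zero hc
  have hcd : c * d = Complex.I := by rw [hd]; field_simp
  have hcd' : (c * d).re = 0 := by rw [hcd]; simp
  -- The centre of the reflection z ↦ a + b - z. On the line z₀ + y d with c d = i both z and a + b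
  -- - z keep a positive real part after multiplication by c, while both q-products tend to 1.
  set z₀ : ℂ := (a + b) / 2 with hz₀
  obtain ⟨u1, u2⟩ := tendsto_qlog_line (z := z₀) him (im_I_div_pos ha)
  obtain ⟨v1, v2⟩ := tendsto_qlog_line (z := z₀ - a) him' (im_I_div_pos hb)
  have ez : ∀ y : ℝ, z₀ - a + y * d = z₀ + y * d - a := fun y => by ring
  simp only [← hd, ez] at u1 u2 v1 v2
  have hmem : ∀ᶠ y : ℝ in atTop, z₀ + y * d ∈ V := by
    filter_upwards [u1, v1] with y h1 h2
    have hre : ∀ w : ℂ, (c * (w + y * d)).re = (c * w).re := fun w => by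
      have : c * (w + y * d) = c * w + y * (c * d) := by ring
      rw [this, Complex.add_re, Complex.re_ofReal_mul, hcd', mul_zero, add_zero]
    have h0 : 0 < (c * z₀).re := by
      have : c * z₀ = ((1 / 2 : ℝ) : ℂ) * (c * a + c * b) := by rw [hz₀]; push_cast; ring
      rw [this, Complex.re_ofReal_mul, Complex.add_re]; linarith
    refine ⟨by rw [hre]; exact h0, ?_, h1, h2⟩
    have : c * (a + b - (z₀ + y * d)) = c * z₀ + ((-y : ℝ) : ℂ) * (c * d) := by
      rw [hz₀]; push_cast; ring
    rw [this, Complex.add_re, Complex.re_ofReal_mul, hcd', mul_zero, add_zero]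
    exact h0
  have hlim : Tendsto (fun y : ℝ => D (z₀ + y * d)) atTop (𝓝 0) := by
    have r1 := tendsto_rho_line hc ha hb hβ z₀ hd0 hcd'
    have r2 := tendsto_rho_line hc ha hb hβ' (-z₀) (d := -d) (neg_ne_zero.2 hd0)
      (by rw [mul_neg, Complex.neg_re, hcd', neg_zero])
    have := ((r2.sub r1).sub u2).add v2
    simp only [sub_zero, add_zero] at this
    refine this.congr' ?_
    filter_upwards [eventually_gt_atTop (-(c * z₀).im)] with y hy
    have him3 : 0 < (c * (z₀ + y * d)).im := by
      have : c * (z₀ + y * d) = c * z₀ + y * (c * d) := by ring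
      rw [this, hcd, Complex.add_im, Complex.im_ofReal_mul, Complex.I_im]
      linarith
    have e1 : a + b - (z₀ + y * d) = -(z₀ + y * d) + (a + b) := by ring
    have e2 : -z₀ + y * -d = -(z₀ + y * d) := by ring
    simp only [D, D1, D2, D3, D4, D5]
    rw [e1, lg_shift hc ha hb hβ hβ', ← hquad, ← phi_reflection hc ha0 hb0 hβ hβ' him3, lg, lg, e2]
    ring
  have hlim2 : Tendsto (fun y : ℝ => p * d ^ 2 * (y : ℂ) ^ 2 + (2 * p * z₀ * d + q * d) * y +
      (p * z₀ ^ 2 + q * z₀ + r)) atTop (𝓝 0) := by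
    refine hlim.congr' ?_
    filter_upwards [hmem] with y hy
    rw [hpqr _ hy]; ring
  obtain ⟨w1, w2, w3⟩ := quadratic_eq_zero hlim2
  have p0 : p = 0 := by simpa [hd0] using w1
  subst p0
  have q0 : q = 0 := by simpa [hd0] using w2
  subst q0
  have r0 : r = 0 := by simpa using w3
  subst r0
  refine ⟨⟨_, hmem.exists.choose_spec⟩, fun z hz => ?_⟩
  have := hpqr z hz
  simp only [D, D1, D2, D3, D4, D5] at this
  rw [hquad]
  linear_combination this

end

/-! ### The product formula for the quadrant -/

/-- The product `∏_{k ≥ 0} (1 - x q ^ k)`. -/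
def qprod (x q : ℂ) : ℂ := ∏' k : ℕ, (1 - x * q ^ k)

lemma differentiable_qprod {q : ℂ} (hq : ‖q‖ < 1) : Differentiable ℂ fun x => qprod x q := by
  intro x₀
  have hu : Summable fun k : ℕ => (‖x₀‖ + 1) * ‖q‖ ^ k :=
    (summable_geometric_of_lt_one (norm_nonneg _) hq).mul_left _
  have h := Summable.hasProdLocallyUniformlyOn_nat_one_add (f := fun (k : ℕ) x => -(x * q ^ k))
    (Metric.isOpen_ball (x := x₀) (ε := 1)) hu
    (Eventually.of_forall fun k x hx => by
      rw [norm_neg, norm_mul, norm_pow]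
      rw [mem_ball_iff_norm] at hx
      have := norm_add_le (x - x₀) x₀
      rw [sub_add_cancel] at this
      gcongr
      linarith)
    (fun k => by fun_prop)
  have h2 := h.differentiableOn (Eventually.of_forall fun s => by
    simpa [Finset.prod_fn] using DifferentiableOn.finsetProd (fun _ _ => by fun_prop))
    Metric.isOpen_ball
  simp only [← sub_eq_add_neg] at h2
  exact h2.differentiableAt (Metric.ball_mem_nhds x₀ one_pos)

lemma qprod_ne_zero {x q : ℂ} (hq : ‖q‖ < 1) (h : ∀ k : ℕ, 1 - x * q ^ k ≠ 0) : qprod x q ≠ 0 := by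
  simp only [qprod, sub_eq_add_neg]
  refine tprod_one_add_ne_zero_of_summable (fun k => by rw [← sub_eq_add_neg]; exact h k) ?_
  simp only [norm_neg, norm_mul, norm_pow]
  exact (summable_geometric_of_lt_one (norm_nonneg _) hq).mul_left _

lemma qFactorial_of_norm_lt_one (x : ℂ) {q : ℂ} (hq : ‖q‖ < 1) : qFactorial x q = qprod x q := by
  rw [qFactorial, if_pos hq]; rfl

lemma qFactorial_inv_of_norm_lt_one (x : ℂ) {q : ℂ} (hq : ‖q‖ < 1) (hq0 : q ≠ 0) :
    qFactorial x q⁻¹ = (qprod (x * q) q)⁻¹ := by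
  have h1 : ¬ ‖q⁻¹‖ < 1 := by
    rw [norm_inv, not_lt]
    exact (one_le_inv₀ (norm_pos_iff.2 hq0)).2 hq.le
  rw [qFactorial, if_neg h1, inv_inv, qprod]
  congr 1
  exact tprod_congr fun k => by ring

lemma nome_ne_zero (a z : ℂ) : nome a z ≠ 0 := Complex.exp_ne_zero _

lemma differentiable_nome (a : ℂ) : Differentiable ℂ (nome a) := fun z =>
  (hasDerivAt_nome a z).differentiableAt

lemma nome_eq_one {a z : ℂ} (ha : a ≠ 0) (h : nome a z = 1) : ∃ k : ℤ, z = k * a := by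
  obtain ⟨k, hk⟩ := Complex.exp_eq_one_iff.1 h
  refine ⟨k, ?_⟩
  rw [mul_comm (2 * (Real.pi : ℂ) * Complex.I)] at hk
  have := mul_right_cancel₀ Complex.two_pi_I_ne_zero hk
  rwa [div_eq_iff ha] at this

section

variable {c a b : ℂ}

/-- The half strip formula extends by the identity theorem: the complement of the period lattice is
connected because the lattice is countable, and both sides are holomorphic there. -/
lemma exp_lg_reflection (hc : c ≠ 0) (ha : 0 < (c * a).re) (hb : 0 < (c * b).re)
    (him : 0 < (b / a).im) {β : ℕ → ℂ} (hβ : IsEM a b 0 β) {z : ℂ}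
    (hz : ∀ k l : ℤ, z ≠ k * a + l * b) :
    Complex.exp (-lg β c a b 0 z + lg β c a b 0 (a + b - z)) =
      Complex.exp (Real.pi * Complex.I * halfB a b z) * qprod (nome a z) (nome a b) *
        (qprod (nome b (z - a)) (nome b (-a)))⁻¹ := by
  have him' := im_neg_div_pos him
  have hb0 := ne_zero_of_re hb
  set U : Set ℂ := (Set.range fun n : ℤ × ℤ => (n.1 : ℂ) * a + n.2 * b)ᶜ with hU
  have hcount : (Set.range fun n : ℤ × ℤ => (n.1 : ℂ) * a + n.2 * b).Countable :=
    Set.countable_range _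
  have hmemU : ∀ w, w ∈ U ↔ ∀ k l : ℤ, w ≠ k * a + l * b := by
    intro w
    simp only [hU, Set.mem_compl_iff, Set.mem_range, Prod.exists, not_exists]
    exact forall₂_congr fun k l => ⟨fun h h' => h h'.symm, fun h h' => h h'.symm⟩
  have hconn : IsPreconnected U :=
    (hcount.isConnected_compl_of_one_lt_rank (by rw [Complex.rank_real_complex]; norm_num)
      ).isPreconnected
  have hneg : ∀ w ∈ U, a + b - w ∈ U := by
    intro w hw
    rw [hmemU] at hw ⊢
    intro k l h
    refine hw (1 - k) (1 - l) ?_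
    push_cast
    linear_combination -h
  have hpt : ∀ w ∈ U, ∀ n : ℕ × ℕ, w + pt a b n ≠ 0 := by
    intro w hw n h
    refine (hmemU w).1 hw (-n.1) (-n.2) ?_
    simp only [pt] at h
    push_cast
    linear_combination h
  have hE : ∀ w ∈ U, AnalyticAt ℂ (fun z => Complex.exp (lg β c a b 0 z)) w := fun w hw =>
    analyticAt_exp_lg hc ha hb hβ (hpt w hw)
  have hQ : ∀ {x y : ℂ}, ‖nome x y‖ < 1 → ∀ (h : ℂ) (w : ℂ),
      AnalyticAt ℂ (fun z => qprod (nome x (z - h)) (nome x y)) w := by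
    intro x y hxy h w
    have : Differentiable ℂ (fun z => qprod (nome x (z - h)) (nome x y)) :=
      (differentiable_qprod hxy).comp ((differentiable_nome x).comp (by fun_prop))
    exact this.analyticAt w
  -- The identity is continued with denominators cleared, so analyticity of f and g needs no
  -- nonvanishing of the products.
  set f : ℂ → ℂ := fun z => Complex.exp (lg β c a b 0 (a + b - z)) *
    qprod (nome b (z - a)) (nome b (-a)) with hf
  set g : ℂ → ℂ := fun z => Complex.exp (Real.pi * Complex.I * halfB a b z) *
    qprod (nome a (z - 0)) (nome a b) * Complex.exp (lg β c a b 0 z) with hg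
  have hfA : AnalyticOnNhd ℂ f U := fun w hw =>
    ((hE _ (hneg w hw)).fun_comp (f := fun z => a + b - z) (by fun_prop)).fun_mul
      (hQ (norm_nome_lt_one him') a w)
  have hgA : AnalyticOnNhd ℂ g U := fun w hw => by
    refine AnalyticAt.fun_mul (AnalyticAt.fun_mul ?_ (hQ (norm_nome_lt_one him) 0 w)) (hE w hw)
    have : Differentiable ℂ fun z => Complex.exp (Real.pi * Complex.I * halfB a b z) := by
      unfold halfB; fun_prop
    exact this.analyticAt w
  obtain ⟨⟨w₀, hw₀⟩, hstrip⟩ := lg_reflection_halfStrip hc ha hb him hβ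
  obtain ⟨w₁, hw₁, hw₁U⟩ := (hcount.dense_compl ℝ).exists_mem_open (isOpen_halfStrip c a b) ⟨w₀, hw₀⟩
  have hev : f =ᶠ[𝓝 w₁] g := by
    filter_upwards [(isOpen_halfStrip c a b).mem_nhds hw₁U] with w hw
    have h1 := hstrip w hw
    obtain ⟨-, -, h3, h4⟩ := hw
    simp only [hf, hg, sub_zero]
    rw [qprod, qprod, ← exp_qlog him h3, ← exp_qlog him' h4, ← Complex.exp_add, ← Complex.exp_add,
      ← Complex.exp_add]
    congr 1
    linear_combination h1
  have hfg := hfA.eqOn_of_preconnected_of_eventuallyEq hgA hconn hw₁ hev ((hmemU z).2 hz)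
  simp only [hf, hg, sub_zero] at hfg
  have hne : qprod (nome b (z - a)) (nome b (-a)) ≠ 0 := by
    refine qprod_ne_zero (norm_nome_lt_one him') fun k hk => ?_
    rw [sub_eq_zero, ← nome_nat_mul, ← nome_add] at hk
    obtain ⟨l, hl⟩ := nome_eq_one hb0 hk.symm
    refine hz (k + 1) l ?_
    push_cast
    linear_combination hl
  rw [Complex.exp_add, Complex.exp_neg, eq_mul_inv_iff_mul_eq₀ hne, mul_assoc, hfg]
  field_simp

/-- The infinite product formula for the quadrant. -/
lemma IsQuadrantZeta.reflection (hc : c ≠ 0) (ha : 0 < (c * a).re) (hb : 0 < (c * b).re)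
    (him : (b / a).im ≠ 0) {z : ℂ} (hz : ∀ k l : ℤ, z ≠ k * a + l * b) {Z₁ Z₂ : ℂ → ℂ}
    (h₁ : IsQuadrantZeta c a b z Z₁) (h₂ : IsQuadrantZeta c a b (a + b - z) Z₂) :
    Complex.exp (-deriv Z₁ 0 + deriv Z₂ 0) =
      Complex.exp (Real.pi * Complex.I * halfB a b z) * (qFactorial (nome a z) (nome a b) *
        qFactorial (nome b z) (nome b a)) := by
  -- Zeta function, Bernoulli polynomial and the pair of q-factorials are all symmetric in a and b.
  wlog hpos : 0 < (b / a).im generalizing a b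
  · have hneg : 0 < (a / b).im := by
      have h1 := im_neg_div_pos (a := a) (b := -b) (by
        rw [neg_div, Complex.neg_im]
        have := lt_of_le_of_ne (not_lt.1 hpos) him
        linarith)
      rwa [neg_div_neg_eq] at h1
    have := this hb ha hneg.ne' (fun k l h => hz l k (by rw [h, add_comm])) h₁.swap
      (by rw [add_comm b a]; exact h₂.swap) hneg
    rw [this, mul_comm (qFactorial (nome b z) _)]
    congr 3
    rw [halfB, halfB]
    ring
  obtain ⟨β, hβ⟩ := exists_isEM (ne_zero_of_re ha) (ne_zero_of_re hb) 0
  have e₁ := IsQuadrantZeta.deriv_eq hc ha hb hβ (z := z) (by rwa [add_zero])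
  have e₂ := IsQuadrantZeta.deriv_eq hc ha hb hβ (z := a + b - z) (by rwa [add_zero])
  rw [(lam_emY hc ha hb hβ _).2] at e₁ e₂
  have := exp_lg_reflection hc ha hb hpos hβ hz
  rw [lg, lg, ← e₁, ← e₂] at this
  have hlt := norm_nome_lt_one (im_neg_div_pos hpos)
  rw [this, qFactorial_of_norm_lt_one _ (norm_nome_lt_one hpos)]
  -- Here |nome b a| > 1, so the second q-factorial is the reciprocal of a convergent product, with
  -- argument shifted by -a.
  have : nome b a = (nome b (-a))⁻¹ := by rw [nome_neg, inv_inv]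
  rw [this, qFactorial_inv_of_norm_lt_one _ hlt (nome_ne_zero _ _), ← nome_add, ← sub_eq_add_neg,
    mul_assoc]

/-- The gamma function of the quadrant is holomorphic where it is regular. -/
lemma exists_continuousAt_gamma (hc : c ≠ 0) (ha : 0 < (c * a).re) (hb : 0 < (c * b).re) :
    ∃ g : ℂ → ℂ, (∀ z Z, IsQuadrantZeta c a b z Z → Complex.exp (deriv Z 0) = g z) ∧
      ∀ z, (∀ n, z + pt a b n ≠ 0) → ContinuousAt g z := by
  obtain ⟨β, hβ⟩ := exists_isEM (ne_zero_of_re ha) (ne_zero_of_re hb) 0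
  refine ⟨fun z => Complex.exp (lg β c a b 0 z), fun z Z hZ => ?_, fun z hz =>
    (analyticAt_exp_lg hc ha hb hβ hz).continuousAt⟩
  have e₁ := IsQuadrantZeta.deriv_eq hc ha hb hβ (z := z) (by rwa [add_zero])
  rw [e₁, (lam_emY hc ha hb hβ _).2]
  rfl

end

/-! ### Expansions and double Bernoulli polynomials -/

/-- D need only accumulate at 0. Convergence at one nonzero point gives a positive radius, and an
analytic function whose zeros accumulate at 0 vanishes near 0. -/
lemma coeff_eq_zero_of_hasSum_zero {d : ℕ → ℂ} {D : Set ℂ} (hD : ∀ ε > 0, ∃ t ∈ D, t ≠ 0 ∧ ‖t‖ < ε)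
    {ε : ℝ} (hε : 0 < ε) (h : ∀ t ∈ D, ‖t‖ < ε → HasSum (fun k => d k * t ^ k) 0) (k : ℕ) :
    d k = 0 := by
  obtain ⟨t₁, ht₁, ht₁0, ht₁ε⟩ := hD ε hε
  set p := FormalMultilinearSeries.ofScalars ℂ d with hp
  have hr : (‖t₁‖₊ : ENNReal) ≤ p.radius := by
    apply FormalMultilinearSeries.le_radius_of_tendsto (l := 0)
    have := (h t₁ ht₁ ht₁ε).summable.tendsto_atTop_zero.norm
    rw [norm_zero] at this
    refine this.congr fun n => ?_
    rw [norm_mul, norm_pow, hp, FormalMultilinearSeries.ofScalars_norm]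
    simp
  have hr0 : 0 < p.radius := lt_of_lt_of_le (by simpa using ht₁0) hr
  have hball := p.hasFPowerSeriesOnBall hr0
  have hat := hball.hasFPowerSeriesAt
  have hfreq : ∃ᶠ t in 𝓝[≠] (0 : ℂ), p.sum t = 0 := by
    rw [Metric.nhdsWithin_basis_ball.frequently_iff]
    intro δ hδ
    obtain ⟨t, ht, ht0, htδ⟩ := hD (min δ ε) (lt_min hδ hε)
    refine ⟨t, ⟨by simpa using htδ.trans_le (min_le_left _ _), ht0⟩, ?_⟩
    have := (h t ht (htδ.trans_le (min_le_right _ _))).tsum_eq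
    rw [← this, hp]
    simp [FormalMultilinearSeries.sum, mul_comm]
  have hev := hball.analyticAt.frequently_zero_iff_eventually_zero.1 hfreq
  have hp0 : p = 0 := (hat.congr hev).eq_zero
  have := congrArg (fun q : FormalMultilinearSeries ℂ ℂ ℂ => q.coeff k) hp0
  simp only [hp, FormalMultilinearSeries.coeff_ofScalars] at this
  exact this.trans rfl

lemma IsExpansion.unique {F : ℂ → ℂ} {D : Set ℂ} (hD : ∀ ε > 0, ∃ t ∈ D, t ≠ 0 ∧ ‖t‖ < ε)
    {b b' : ℕ → ℂ} (h : IsExpansion F D b) (h' : IsExpansion F D b') : b = b' := by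
  obtain ⟨ε, hε, h⟩ := h
  obtain ⟨ε', hε', h'⟩ := h'
  funext k
  have := coeff_eq_zero_of_hasSum_zero (d := fun k => (b k - b' k) / (k.factorial : ℂ)) hD
    (lt_min hε hε') (fun t ht hlt => by
      have := (h t ht (hlt.trans_le (min_le_left _ _))).sub
        (h' t ht (hlt.trans_le (min_le_right _ _)))
      rw [sub_self] at this
      have e : (fun k => (b k - b' k) / (k.factorial : ℂ) * t ^ k) = fun k =>
          b k * t ^ k / (k.factorial : ℂ) - b' k * t ^ k / (k.factorial : ℂ) := by
        funext k; ring
      rw [e]; exact this) k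
  have hk : (k.factorial : ℂ) ≠ 0 := by exact_mod_cast k.factorial_ne_zero
  simpa [hk, sub_eq_zero] using this

lemma IsExpansion.expansionCoeff_eq {F : ℂ → ℂ} {D : Set ℂ}
    (hD : ∀ ε > 0, ∃ t ∈ D, t ≠ 0 ∧ ‖t‖ < ε) {b : ℕ → ℂ} (h : IsExpansion F D b) (k : ℕ) :
    expansionCoeff F D k = b k := by
  have hex : ∃ b, IsExpansion F D b := ⟨b, h⟩
  rw [expansionCoeff, dif_pos hex, hex.choose_spec.unique hD h]

lemma exists_small_ne_zero : ∀ ε > (0 : ℝ), ∃ t ∈ ({0}ᶜ : Set ℂ), t ≠ 0 ∧ ‖t‖ < ε := by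
  intro ε hε
  have h : ((ε / 2 : ℝ) : ℂ) ≠ 0 := by exact_mod_cast (half_pos hε).ne'
  refine ⟨((ε / 2 : ℝ) : ℂ), h, h, ?_⟩
  rw [Complex.norm_real, Real.norm_of_nonneg (by linarith)]
  linarith

lemma hasSum_exp (z t : ℂ) :
    HasSum (fun k : ℕ => z ^ k / (k.factorial : ℂ) * t ^ k) (Complex.exp (z * t)) := by
  have := NormedSpace.expSeries_div_hasSum_exp (z * t)
  rw [← Complex.exp_eq_exp_ℂ] at this
  have e : (fun k : ℕ => z ^ k / (k.factorial : ℂ) * t ^ k) =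
      fun k => (z * t) ^ k / (k.factorial : ℂ) := by
    funext k; rw [mul_pow]; ring
  rw [e]; exact this

lemma hasSum_diffCoeff (a b t : ℂ) : HasSum (fun k : ℕ => diffCoeff a b k * t ^ k)
    ((Complex.exp (a * t) - 1) * (Complex.exp (b * t) - 1)) := by
  have h := (((hasSum_exp (a + b) t).sub (hasSum_exp a t)).sub (hasSum_exp b t)).add (hasSum_exp 0 t)
  have e1 : (Complex.exp (a * t) - 1) * (Complex.exp (b * t) - 1) = Complex.exp ((a + b) * t) -
      Complex.exp (a * t) - Complex.exp (b * t) + Complex.exp (0 * t) := by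
    rw [add_mul, Complex.exp_add, zero_mul, Complex.exp_zero]; ring
  have e2 : (fun k : ℕ => diffCoeff a b k * t ^ k) = fun k : ℕ =>
      (a + b) ^ k / (k.factorial : ℂ) * t ^ k - a ^ k / (k.factorial : ℂ) * t ^ k -
      b ^ k / (k.factorial : ℂ) * t ^ k + 0 ^ k / (k.factorial : ℂ) * t ^ k := by
    funext k; rw [diffCoeff]; ring
  rw [e1, e2]; exact h

lemma hasSum_sq_mul_exp (z t : ℂ) : HasSum (fun k : ℕ =>
    (if 2 ≤ k then z ^ (k - 2) / ((k - 2).factorial : ℂ) else 0) * t ^ k)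
    (t ^ 2 * Complex.exp (z * t)) := by
  rw [← hasSum_nat_add_iff' 2]
  simp only [Finset.sum_range_succ, Finset.range_zero, Finset.sum_empty]
  norm_num
  have := (hasSum_exp z t).mul_left (t ^ 2)
  have e : (fun k : ℕ => z ^ k / (k.factorial : ℂ) * t ^ (k + 2)) =
      fun k : ℕ => t ^ 2 * (z ^ k / (k.factorial : ℂ) * t ^ k) := by
    funext k; ring
  rw [e]; exact this

/-- Write e^{kt} - 1 = t g(t) with g(0) = k ≠ 0. The generating function equals e^{zt}/(g_a g_b) for
t ≠ 0 small, and this is analytic at 0. -/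
lemma exists_power_series (z : ℂ) {a b : ℂ} (ha : a ≠ 0) (hb : b ≠ 0) :
    ∃ e : ℕ → ℂ, ∃ ε : ℝ, 0 < ε ∧ ∀ t : ℂ, t ≠ 0 → ‖t‖ < ε →
      HasSum (fun k => e k * t ^ k) (bernoulliGen z a b t) ∧
      (Complex.exp (a * t) - 1) * (Complex.exp (b * t) - 1) ≠ 0 := by
  have hg : ∀ k : ℂ, k ≠ 0 → ∃ g : ℂ → ℂ, AnalyticAt ℂ g 0 ∧ g 0 ≠ 0 ∧
      ∀ t, t ≠ 0 → g t * t = Complex.exp (k * t) - 1 := by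
    intro k hk
    refine ⟨dslope (fun t => Complex.exp (k * t)) 0, ?_, ?_, ?_⟩
    · have : DifferentiableOn ℂ (dslope (fun t => Complex.exp (k * t)) 0) Set.univ :=
        (Complex.differentiableOn_dslope Filter.univ_mem).2 (by fun_prop)
      exact this.analyticAt Filter.univ_mem
    · rw [dslope_same]
      have : HasDerivAt (fun t => Complex.exp (k * t)) k 0 := by
        have := ((hasDerivAt_id (0 : ℂ)).const_mul k).cexp
        simpa using this
      rw [this.deriv]; exact hk
    · intro t ht
      rw [dslope_of_ne _ ht, slope_def_field]
      field_simp
      simp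
  obtain ⟨ga, ha1, ha2, ha3⟩ := hg a ha
  obtain ⟨gb, hb1, hb2, hb3⟩ := hg b hb
  have hA : AnalyticAt ℂ (fun t => Complex.exp (z * t) / (ga t * gb t)) 0 :=
    AnalyticAt.fun_div (by fun_prop) (ha1.fun_mul hb1) (mul_ne_zero ha2 hb2)
  obtain ⟨p, r, hp⟩ := hA
  have hne : ∀ᶠ t in 𝓝 (0 : ℂ), ga t ≠ 0 ∧ gb t ≠ 0 :=
    (ha1.continuousAt.eventually_ne ha2).and (hb1.continuousAt.eventually_ne hb2)
  have hin : ∀ᶠ t in 𝓝 (0 : ℂ), t ∈ Metric.eball (0 : ℂ) r := Metric.eball_mem_nhds 0 hp.r_pos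
  obtain ⟨ε, hε, hball⟩ := Metric.eventually_nhds_iff.1 (hne.and hin)
  refine ⟨fun k => p.coeff k, ε, hε, fun t ht htε => ?_⟩
  obtain ⟨⟨h1, h2⟩, h3⟩ := hball (y := t) (by simpa using htε)
  have ea := ha3 t ht
  have eb := hb3 t ht
  refine ⟨?_, ?_⟩
  · have h4 := hp.hasSum h3
    rw [zero_add] at h4
    have e1 : Complex.exp (z * t) / (ga t * gb t) = bernoulliGen z a b t := by
      rw [bernoulliGen, ← ea, ← eb]
      field_simp
    rw [e1] at h4
    have e2 : (fun k => p.coeff k * t ^ k) = fun n => (p n) fun _ => t := by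
      funext k
      rw [FormalMultilinearSeries.apply_eq_pow_smul_coeff, smul_eq_mul, mul_comm]
    rw [e2]; exact h4
  · rw [← ea, ← eb]
    exact mul_ne_zero (mul_ne_zero h1 ht) (mul_ne_zero h2 ht)

lemma sum_mul_eq_of_hasSum {e f g : ℕ → ℂ} {ε : ℝ} (hε : 0 < ε)
    {A B : ℂ → ℂ} (h : ∀ t : ℂ, t ≠ 0 → ‖t‖ < ε → HasSum (fun k => e k * t ^ k) (A t))
    (hf : ∀ t, HasSum (fun k => f k * t ^ k) (B t))
    (hg : ∀ t : ℂ, t ≠ 0 → ‖t‖ < ε → HasSum (fun k => g k * t ^ k) (A t * B t)) (M : ℕ) :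
    ∑ j ∈ Finset.range (M + 1), e j * f (M - j) = g M := by
  have key : ∀ t ∈ ({0}ᶜ : Set ℂ), ‖t‖ < ε →
      HasSum (fun M => (∑ j ∈ Finset.range (M + 1), e j * f (M - j) - g M) * t ^ M) 0 := by
    intro t ht htε
    have h1 := h t ht htε
    have h5 := hasSum_sum_range_mul_of_summable_norm h1.summable.norm (hf t).summable.norm
    rw [h1.tsum_eq, (hf t).tsum_eq] at h5
    have h6 := h5.sub (hg t ht htε)
    rw [sub_self] at h6
    have e2 : (fun M => (∑ j ∈ Finset.range (M + 1), e j * f (M - j) - g M) * t ^ M) = fun M =>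
        ∑ j ∈ Finset.range (M + 1), e j * t ^ j * (f (M - j) * t ^ (M - j)) - g M * t ^ M := by
      funext M
      rw [sub_mul, Finset.sum_mul]
      congr 1
      apply Finset.sum_congr rfl
      intro j hj
      rw [Finset.mem_range] at hj
      have : t ^ M = t ^ j * t ^ (M - j) := by rw [← pow_add]; congr 1; omega
      rw [this]; ring
    rw [e2]; exact h6
  exact sub_eq_zero.1 (coeff_eq_zero_of_hasSum_zero exists_small_ne_zero hε key M)

/-- Multiplying by the denominator shows that the Taylor coefficients satisfy the Euler–Maclaurin
relations with x = z, so `IsEM.coeffs` evaluates the second one. The factor 2 is 2!. -/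
lemma exists_bernoulli (z : ℂ) {a b : ℂ} (ha : a ≠ 0) (hb : b ≠ 0) :
    ∃ e : ℕ → ℂ, IsExpansion (bernoulliGen z a b) {0}ᶜ e ∧ e 2 = 2 * halfB a b z := by
  obtain ⟨e, ε, hε, h⟩ := exists_power_series z ha hb
  have hEM : IsEM a b z e := by
    refine sum_mul_eq_of_hasSum hε (fun t ht htε => (h t ht htε).1)
      (hasSum_diffCoeff a b) fun t ht htε => ?_
    rw [bernoulliGen, div_mul_cancel₀ _ (h t ht htε).2]
    exact hasSum_sq_mul_exp z t
  refine ⟨fun k => k.factorial * e k, ⟨ε, hε, fun t ht htε => ?_⟩, ?_⟩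
  · have e1 : (fun k : ℕ => (k.factorial * e k) * t ^ k / (k.factorial : ℂ)) =
        fun k => e k * t ^ k := by
      funext k
      have hk : (k.factorial : ℂ) ≠ 0 := by exact_mod_cast k.factorial_ne_zero
      field_simp
    rw [e1]; exact (h t ht htε).1
  · simp only
    rw [(hEM.coeffs ha hb).2.2, halfB]
    simp [Nat.factorial]

lemma bernoulli2_two (z : ℂ) {a b : ℂ} (ha : a ≠ 0) (hb : b ≠ 0) :
    bernoulli2 2 z a b = 2 * halfB a b z := by
  obtain ⟨e, h1, h2⟩ := exists_bernoulli z ha hb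
  rw [bernoulli2, h1.expansionCoeff_eq exists_small_ne_zero, h2]

/-! ### Unimodular fans -/

/-- The Plücker relation; it replaces all arguments about angles in the combinatorics of fans. -/
lemma cross_pluecker (a b x y : Fin 2 → ℤ) :
    cross a b * cross x y - cross a x * cross b y + cross a y * cross b x = 0 := by
  simp only [cross]; ring

lemma eq_smul_add_smul {p q : Fin 2 → ℤ} (h : cross p q = 1) (n : Fin 2 → ℤ) :
    n = -cross q n • p + cross p n • q := by
  simp only [cross] at *
  funext i
  fin_cases i <;> simp
  · linear_combination (-n 0) * h
  · linear_combination (-n 1) * h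

/-- In the basis p, q the coordinates of n are -(q × n) and p × n, so a translated quadrant is cut
out by two inequalities. -/
lemma hasSum_indicator_quadrant {p q : Fin 2 → ℤ} (h : cross p q = 1) (k l : ℤ)
    {F : (Fin 2 → ℤ) → ℂ} {S : ℂ}
    (hS : HasSum (fun n : ℕ × ℕ => F (((n.1 : ℤ) + k) • p + ((n.2 : ℤ) + l) • q)) S) :
    HasSum (Set.indicator {n | l ≤ cross p n ∧ cross q n ≤ -k} F) S := by
  have h1 : ∀ x y : ℤ, cross p (x • p + y • q) = y := by
    intro x y
    simp only [cross, Pi.add_apply, Pi.smul_apply, smul_eq_mul] at *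
    linear_combination y * h
  have h2 : ∀ x y : ℤ, cross q (x • p + y • q) = -x := by
    intro x y
    simp only [cross, Pi.add_apply, Pi.smul_apply, smul_eq_mul] at *
    linear_combination (-x) * h
  set g : ℕ × ℕ → Fin 2 → ℤ := fun n => ((n.1 : ℤ) + k) • p + ((n.2 : ℤ) + l) • q with hg
  have hinj : Function.Injective g := by
    intro n n' e
    have e1 := congrArg (cross p) e
    have e2 := congrArg (cross q) e
    simp only [hg, h1, h2] at e1 e2
    ext <;> omega
  have hrange : Set.range g = {n | l ≤ cross p n ∧ cross q n ≤ -k} := by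
    ext n
    constructor
    · rintro ⟨x, rfl⟩
      simp only [Set.mem_ofPred_eq, hg, h1, h2]
      omega
    · rintro ⟨hl, hk⟩
      refine ⟨((-cross q n - k).toNat, (cross p n - l).toNat), ?_⟩
      simp only [hg]
      rw [Int.toNat_of_nonneg (by omega), Int.toNat_of_nonneg (by omega), sub_add_cancel,
        sub_add_cancel]
      exact (eq_smul_add_smul h n).symm
  rw [← hrange, ← hasSum_subtype_iff_indicator]
  exact hinj.hasSum_range_iff.2 hS

/-! ### Fans of a cone and the partition of its lattice points. -/

/-- The vectors `w 0, …, w (m + 1)` run counterclockwise through the cone `C`, from the ray with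
normal `i` to the ray with normal `k`, and subdivide it into unimodular cones. -/
structure IsFan (C : Cone2) (i k : Fin 2) (m : ℕ) (w : ℕ → Fin 2 → ℤ) : Prop where
  ne : i ≠ k
  first : w 0 = ![C.normal i 1, -C.normal i 0]
  last : w (m + 1) = ![-C.normal k 1, C.normal k 0]
  unimodular : ∀ j ≤ m, cross (w j) (w (j + 1)) = 1
  mem : ∀ j ≤ m + 1, w j ∈ C.points
  pos : ∀ j ≤ m, 0 < cross (w 0) (w (j + 1))

lemma forall_fin_two_of_ne {i k : Fin 2} (h : i ≠ k) {P : Fin 2 → Prop} :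
    (∀ f, P f) ↔ P i ∧ P k := by
  refine ⟨fun H => ⟨H i, H k⟩, fun H f => ?_⟩
  have : f = i ∨ f = k := by omega
  rcases this with rfl | rfl
  exacts [H.1, H.2]

lemma prod_fin_two_of_ne {i k : Fin 2} (h : i ≠ k) (g : Fin 2 → ℂ) : ∏ f, g f = g i * g k := by
  rw [Fin.prod_univ_two]
  have : (i = 0 ∧ k = 1) ∨ (i = 1 ∧ k = 0) := by omega
  rcases this with ⟨rfl, rfl⟩ | ⟨rfl, rfl⟩
  exacts [rfl, mul_comm _ _]

lemma rdot_toReal (n v : Fin 2 → ℤ) :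
    rdot (toReal n) (toReal v) = ((n 0 * v 0 + n 1 * v 1 : ℤ) : ℝ) := by
  simp [rdot, toReal]

lemma rdot_self_pos {x : Fin 2 → ℝ} (hx : x ≠ 0) : 0 < rdot x x := by
  have h : x 0 ≠ 0 ∨ x 1 ≠ 0 := by
    by_contra! h
    exact hx (funext fun i => by fin_cases i; exacts [h.1, h.2])
  simp only [rdot]
  rcases h with h | h
  · have := mul_self_pos.2 h; nlinarith [mul_self_nonneg (x 1)]
  · have := mul_self_pos.2 h; nlinarith [mul_self_nonneg (x 0)]

/-- An interior point can be moved a little in direction -x, which lowers the pairing by a positive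
multiple of x · x. This serves both the cone and its dual. -/
lemma rdot_pos_of_mem_interior {s : Set (Fin 2 → ℝ)} {x y : Fin 2 → ℝ} (hx : x ≠ 0)
    (hs : ∀ y ∈ s, 0 ≤ rdot y x) (hy : y ∈ interior s) : 0 < rdot y x := by
  have hcont : Tendsto (fun ε : ℝ => y - ε • x) (𝓝[>] 0) (𝓝 y) := by
    have : ContinuousAt (fun ε : ℝ => y - ε • x) 0 := by fun_prop
    have := this.tendsto
    simp only [zero_smul, sub_zero] at this
    exact this.mono_left nhdsWithin_le_nhds
  have hev : ∀ᶠ ε : ℝ in 𝓝[>] 0, y - ε • x ∈ s := hcont (mem_interior_iff_mem_nhds.1 hy)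
  obtain ⟨ε, h1, h2⟩ := (hev.and self_mem_nhdsWithin).exists
  have h3 := hs _ h1
  have h4 : rdot (y - ε • x) x = rdot y x - ε * rdot x x := by
    simp [rdot]; ring
  have h5 := mul_pos (show 0 < ε from h2) (rdot_self_pos hx)
  linarith

lemma Cone2.normal_ne_zero (C : Cone2) (i : Fin 2) : C.normal i ≠ 0 := by
  intro h
  have := C.primitive i
  simp [h] at this

lemma toReal_ne_zero {n : Fin 2 → ℤ} (h : n ≠ 0) : toReal n ≠ 0 := by
  intro e
  apply h
  funext i
  have := congrFun e i
  simpa [toReal] using this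

lemma Cone2.interior_carrier (C : Cone2) :
    interior C.carrier = {x | ∀ i, 0 < rdot x (toReal (C.normal i))} := by
  apply subset_antisymm
  · intro x hx i
    exact rdot_pos_of_mem_interior (toReal_ne_zero (C.normal_ne_zero i)) (s := C.carrier)
      (fun y hy => hy i) hx
  · apply interior_maximal
    · intro x hx i
      exact (hx i).le
    · simp only [Set.ofPred_forall]
      refine isOpen_iInter_of_finite fun i => isOpen_lt continuous_const ?_
      unfold rdot
      fun_prop

lemma Cone2.mem_points (C : Cone2) (n : Fin 2 → ℤ) :
    n ∈ C.points ↔ ∀ i, 0 ≤ n 0 * C.normal i 0 + n 1 * C.normal i 1 := by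
  refine forall_congr' fun i => ?_
  rw [rdot_toReal]
  exact Int.cast_nonneg_iff

lemma Cone2.mem_interiorPoints (C : Cone2) (n : Fin 2 → ℤ) :
    n ∈ C.interiorPoints ↔ ∀ i, 0 < n 0 * C.normal i 0 + n 1 * C.normal i 1 := by
  rw [interiorPoints, Set.mem_ofPred_eq, C.interior_carrier]
  refine forall_congr' fun i => ?_
  rw [rdot_toReal]
  exact Int.cast_pos

lemma Cone2.eq_zero_of_mem_points (C : Cone2) {n : Fin 2 → ℤ} (h : n ∈ C.points)
    (h' : -n ∈ C.points) : n = 0 := by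
  by_contra hn
  apply toReal_ne_zero hn
  apply C.strictlyConvex _ h
  have : toReal (-n) = -toReal n := by funext i; simp [toReal]
  rw [← this]
  exact h'

/-- If the normals were parallel, the line orthogonal to both would lie in the cone. -/
lemma Cone2.cross_normal_ne_zero (C : Cone2) : cross (C.normal 0) (C.normal 1) ≠ 0 := by
  intro h
  have hz : (![C.normal 0 1, -C.normal 0 0] : Fin 2 → ℤ) = 0 := by
    apply C.eq_zero_of_mem_points <;> rw [C.mem_points, Fin.forall_fin_two] <;>
      simp only [cross] at h <;> constructor <;> simp <;> linarith
  apply C.normal_ne_zero 0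
  have h0 := congrFun hz 0
  have h1 := congrFun hz 1
  funext i
  fin_cases i
  · simpa using h1
  · simpa using h0

section

variable {C : Cone2} {i k : Fin 2} {m : ℕ} {w : ℕ → Fin 2 → ℤ}

lemma mem_points_iff_cross (hne : i ≠ k) (h0 : w 0 = ![C.normal i 1, -C.normal i 0])
    (h1 : w (m + 1) = ![-C.normal k 1, C.normal k 0]) (n : Fin 2 → ℤ) :
    n ∈ C.points ↔ 0 ≤ cross (w 0) n ∧ cross (w (m + 1)) n ≤ 0 := by
  rw [C.mem_points, forall_fin_two_of_ne hne, h0, h1]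
  simp only [cross, Matrix.cons_val_zero, Matrix.cons_val_one]
  constructor <;> rintro ⟨h, h'⟩ <;> constructor <;> linarith

lemma IsFan.mem_points_iff (h : IsFan C i k m w) (n : Fin 2 → ℤ) :
    n ∈ C.points ↔ 0 ≤ cross (w 0) n ∧ cross (w (m + 1)) n ≤ 0 :=
  mem_points_iff_cross h.ne h.first h.last n

lemma IsFan.mem_interiorPoints_iff (h : IsFan C i k m w) (n : Fin 2 → ℤ) :
    n ∈ C.interiorPoints ↔ 0 < cross (w 0) n ∧ cross (w (m + 1)) n < 0 := by
  rw [C.mem_interiorPoints, forall_fin_two_of_ne h.ne, h.first, h.last]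
  simp only [cross, Matrix.cons_val_zero, Matrix.cons_val_one]
  constructor <;> rintro ⟨h, h'⟩ <;> constructor <;> linarith

/-- Positivity comes from strict convexity. If w 0 × w (j + 1) = 0, unimodularity makes -w 0 a
nonnegative multiple of w (j + 1), so w 0 and -w 0 both lie in the cone. -/
lemma IsFan.of_mem (hne : i ≠ k) (h0 : w 0 = ![C.normal i 1, -C.normal i 0])
    (h1 : w (m + 1) = ![-C.normal k 1, C.normal k 0])
    (hu : ∀ j ≤ m, cross (w j) (w (j + 1)) = 1) (hmem : ∀ j ≤ m + 1, w j ∈ C.points) :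
    IsFan C i k m w := by
  refine ⟨hne, h0, h1, hu, hmem, fun j hj => ?_⟩
  have hiff := mem_points_iff_cross hne h0 h1
  have h2 := ((hiff _).1 (hmem (j + 1) (by omega))).1
  refine lt_of_le_of_ne h2 fun h3 => ?_
  have h4 := ((hiff _).1 (hmem j (by omega))).1
  have h5 := eq_smul_add_smul (hu j hj) (w 0)
  have h6 : cross (w (j + 1)) (w 0) = 0 := by simp only [cross] at h3 ⊢; linarith
  have h7 : cross (w j) (w 0) = -cross (w 0) (w j) := by simp only [cross]; ring
  rw [h6, h7, neg_zero, zero_smul, zero_add, neg_smul] at h5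
  have h8 : -w 0 ∈ C.points := by
    have h9 := (C.mem_points _).1 (hmem (j + 1) (by omega))
    rw [h5, neg_neg, C.mem_points]
    intro f
    have := mul_nonneg h4 (h9 f)
    simp only [Pi.smul_apply, smul_eq_mul]
    nlinarith
  have h10 := C.eq_zero_of_mem_points (hmem 0 (by omega)) h8
  have h11 := hu 0 (by omega)
  rw [h10] at h11
  simp [cross] at h11

/-- With p = w 0 × w l ≥ 0 and q = w 0 × w (l + 1) > 0, the Plücker relation reads q (w l × n) = p
(w (l + 1) × n) + w 0 × n. The sign rules say that the successive half-open cones are disjoint and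
fill up growing sectors. -/
lemma IsFan.sign (h : IsFan C i k m w) {l : ℕ} (hl : l ≤ m) (n : Fin 2 → ℤ) :
    (0 ≤ cross (w 0) n → cross (w l) n < 0 → cross (w (l + 1)) n < 0) ∧
    (0 < cross (w 0) n → cross (w l) n ≤ 0 → cross (w (l + 1)) n < 0) ∧
    (0 ≤ cross (w l) n → cross (w (l + 1)) n ≤ 0 → 0 ≤ cross (w 0) n) ∧
    (0 < cross (w l) n → cross (w (l + 1)) n ≤ 0 → 0 < cross (w 0) n) := by
  have hp : 0 ≤ cross (w 0) (w l) := by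
    cases l with
    | zero => simp [cross, mul_comm]
    | succ l => exact (h.pos l (by omega)).le
  have hq := h.pos l hl
  have hrel := cross_pluecker (w 0) (w l) (w (l + 1)) n
  rw [h.unimodular l hl] at hrel
  generalize cross (w 0) (w l) = p at *
  generalize cross (w 0) (w (l + 1)) = q at *
  generalize cross (w 0) n = s at *
  generalize cross (w l) n = x at *
  generalize cross (w (l + 1)) n = y at *
  refine ⟨fun h1 h2 => ?_, fun h1 h2 => ?_, fun h1 h2 => ?_, fun h1 h2 => ?_⟩
  · by_contra! h3
    nlinarith [mul_nonneg hp h3, mul_pos hq (neg_pos.2 h2)]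
  · by_contra! h3
    nlinarith [mul_nonneg hp h3, mul_nonneg hq.le (neg_nonneg.2 h2)]
  · nlinarith [mul_nonneg hq.le h1, mul_nonneg hp (neg_nonneg.2 h2)]
  · nlinarith [mul_pos hq h1, mul_nonneg hp (neg_nonneg.2 h2)]

lemma hasSum_indicator_union {A B T : Set (Fin 2 → ℤ)} {F : (Fin 2 → ℤ) → ℂ} {a b : ℂ}
    (hA : HasSum (A.indicator F) a) (hB : HasSum (B.indicator F) b)
    (hT : ∀ n, n ∈ T ↔ n ∈ A ∨ n ∈ B) (hd : ∀ n ∈ A, n ∉ B) :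
    HasSum (T.indicator F) (a + b) := by
  have e : T = A ∪ B := Set.ext hT
  rw [e, Set.indicator_union_of_disjoint (Set.disjoint_left.2 hd)]
  exact hA.add hB

/-- Every quadrant but the last contains its first ray and omits its second; the last is closed. The
induction accumulates the sector strictly before w l. -/
lemma IsFan.hasSum_points (h : IsFan C i k m w) {F : (Fin 2 → ℤ) → ℂ} {S : ℕ → ℂ}
    (hS : ∀ j < m, HasSum (fun n : ℕ × ℕ =>
      F (((n.1 : ℤ) + 1) • w j + ((n.2 : ℤ) + 0) • w (j + 1))) (S j))
    (hm : HasSum (fun n : ℕ × ℕ =>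
      F (((n.1 : ℤ) + 0) • w m + ((n.2 : ℤ) + 0) • w (m + 1))) (S m)) :
    HasSum (fun n : C.points => F n) (∑ j ∈ Finset.range m, S j + S m) := by
  have key : ∀ l ≤ m, HasSum (Set.indicator {n | 0 ≤ cross (w 0) n ∧ cross (w l) n < 0} F)
      (∑ j ∈ Finset.range l, S j) := by
    intro l
    induction l with
    | zero =>
      intro _
      have : {n | 0 ≤ cross (w 0) n ∧ cross (w 0) n < 0} = (∅ : Set (Fin 2 → ℤ)) := by
        ext n; simp
      rw [this, Set.indicator_empty, Finset.range_zero, Finset.sum_empty]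
      exact hasSum_zero
    | succ l ih =>
      intro hl
      rw [Finset.sum_range_succ]
      refine hasSum_indicator_union (ih (by omega))
        (hasSum_indicator_quadrant (h.unimodular l (by omega)) 1 0 (hS l (by omega))) ?_ ?_ <;>
        intro n <;> have hn := h.sign (l := l) (by omega) n <;>
        simp only [Set.mem_ofPred_eq] <;> omega
  have e : C.points = {n | 0 ≤ cross (w 0) n ∧ cross (w (m + 1)) n ≤ 0} :=
    Set.ext h.mem_points_iff
  change HasSum (F ∘ ((↑) : C.points → Fin 2 → ℤ)) _
  rw [hasSum_subtype_iff_indicator, e]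
  refine hasSum_indicator_union (key m le_rfl)
    (hasSum_indicator_quadrant (h.unimodular m le_rfl) 0 0 hm) ?_ ?_ <;>
    intro n <;> have hn := h.sign (l := m) le_rfl n <;>
    simp only [Set.mem_ofPred_eq] <;> omega

/-- The boundary convention is opposite to that of `IsFan.hasSum_points`: each quadrant omits its
first ray and contains its second, and the last is open. Thus the pieces match under z ↦ a + b - z.
-/
lemma IsFan.hasSum_interiorPoints (h : IsFan C i k m w) {F : (Fin 2 → ℤ) → ℂ} {S : ℕ → ℂ}
    (hS : ∀ j < m, HasSum (fun n : ℕ × ℕ =>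
      F (((n.1 : ℤ) + 0) • w j + ((n.2 : ℤ) + 1) • w (j + 1))) (S j))
    (hm : HasSum (fun n : ℕ × ℕ =>
      F (((n.1 : ℤ) + 1) • w m + ((n.2 : ℤ) + 1) • w (m + 1))) (S m)) :
    HasSum (fun n : C.interiorPoints => F n) (∑ j ∈ Finset.range m, S j + S m) := by
  have key : ∀ l ≤ m, HasSum (Set.indicator {n | 0 < cross (w 0) n ∧ cross (w l) n ≤ 0} F)
      (∑ j ∈ Finset.range l, S j) := by
    intro l
    induction l with
    | zero =>
      intro _
      have : {n | 0 < cross (w 0) n ∧ cross (w 0) n ≤ 0} = (∅ : Set (Fin 2 → ℤ)) := by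
        ext n; simp
      rw [this, Set.indicator_empty, Finset.range_zero, Finset.sum_empty]
      exact hasSum_zero
    | succ l ih =>
      intro hl
      rw [Finset.sum_range_succ]
      refine hasSum_indicator_union (ih (by omega))
        (hasSum_indicator_quadrant (h.unimodular l (by omega)) 0 1 (hS l (by omega))) ?_ ?_ <;>
        intro n <;> have hn := h.sign (l := l) (by omega) n <;>
        simp only [Set.mem_ofPred_eq] <;> omega
  have e : C.interiorPoints = {n | 0 < cross (w 0) n ∧ cross (w (m + 1)) n < 0} :=
    Set.ext h.mem_interiorPoints_iff
  change HasSum (F ∘ ((↑) : C.interiorPoints → Fin 2 → ℤ)) _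
  rw [hasSum_subtype_iff_indicator, e]
  refine hasSum_indicator_union (key m le_rfl)
    (hasSum_indicator_quadrant (h.unimodular m le_rfl) 1 1 hm) ?_ ?_ <;>
    intro n <;> have hn := h.sign (l := m) le_rfl n <;>
    simp only [Set.mem_ofPred_eq] <;> omega

lemma IsFan.of_isSubdivision {u : ℕ → Fin 2 → ℤ} (h : C.IsSubdivision m u) :
    IsFan C 0 1 m fun j => ![u j 1, -u j 0] := by
  obtain ⟨h0, h1, h2, h3⟩ := h
  refine IsFan.of_mem (by decide) (by simp [h0]) (by simp [h1]) (fun j hj => ?_) h3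
  have := h2 j hj
  simp only [cross, Matrix.cons_val_zero, Matrix.cons_val_one] at *
  linarith

lemma IsFan.isSubdivision (h : IsFan C 0 1 m w) :
    C.IsSubdivision m fun j => ![-w j 1, w j 0] := by
  refine ⟨?_, ?_, fun j hj => ?_, fun j hj => ?_⟩
  · simp only [h.first]
    funext f; fin_cases f <;> simp
  · simp only [h.last]
    funext f; fin_cases f <;> simp
  · have := h.unimodular j hj
    simp only [cross, Matrix.cons_val_zero, Matrix.cons_val_one] at *
    linarith
  · have e : (![(![-w j 1, w j 0] : Fin 2 → ℤ) 1, -(![-w j 1, w j 0] : Fin 2 → ℤ) 0] : Fin 2 → ℤ) =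
        w j := by
      funext f; fin_cases f <;> simp
    simp only [e]
    exact h.mem j hj

end

/-! ### Existence of unimodular fans. -/

/-- A Euclidean algorithm on the determinant: complete p to a basis by some r whose determinant with
q is reduced modulo D, and recurse on (r, q). -/
lemma exists_unimodular_chain (D : ℕ) : ∀ p q : Fin 2 → ℤ, IsCoprime (p 0) (p 1) →
    IsCoprime (q 0) (q 1) → cross p q = D → 0 < D →
      ∃ (m : ℕ) (w : ℕ → Fin 2 → ℤ), w 0 = p ∧ w (m + 1) = q ∧
      (∀ j ≤ m, cross (w j) (w (j + 1)) = 1) ∧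
      ∀ j ≤ m + 1, 0 ≤ cross p (w j) ∧ 0 ≤ cross (w j) q := by
  induction D using Nat.strong_induction_on with
  | _ D ih =>
  intro p q hp hq hD hD0
  have hself : ∀ x : Fin 2 → ℤ, cross x x = 0 := fun x => by simp [cross, mul_comm]
  rcases Nat.lt_or_ge 1 D with h1 | h1
  swap
  · have hD1 : D = 1 := by omega
    refine ⟨0, fun j => if j = 0 then p else q, rfl, rfl, fun j hj => ?_, fun j hj => ?_⟩
    · obtain rfl : j = 0 := by omega
      simp [hD, hD1]
    · by_cases hj0 : j = 0
      · simp [hj0, hself, hD]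
      · simp [hj0, hself, hD]
  obtain ⟨r, hr1, hr2, hr3⟩ : ∃ r : Fin 2 → ℤ, cross p r = 1 ∧ 0 ≤ cross r q ∧ cross r q < D := by
    obtain ⟨x, y, hxy⟩ := hp
    set e := cross ![-y, x] q with he
    -- A Bézout vector completes p to a basis. Subtracting a multiple of p keeps this and replaces
    -- the determinant e with q by e mod D.
    refine ⟨![-y, x] + (-(e / D)) • p, ?_, ?_⟩
    · simp only [cross, Pi.add_apply, Pi.smul_apply, smul_eq_mul, Matrix.cons_val_zero,
        Matrix.cons_val_one]
      linear_combination hxy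
    · have h2 : cross (![-y, x] + (-(e / D)) • p) q = e % D := by
        have h3 : cross (![-y, x] + (-(e / D)) • p) q = e - e / D * cross p q := by
          rw [he]
          simp only [cross, Pi.add_apply, Pi.smul_apply, smul_eq_mul]
          ring
        rw [h3, hD]
        have := Int.emod_add_mul_ediv e D
        linarith
      rw [h2]
      exact ⟨Int.emod_nonneg _ (by omega), Int.emod_lt_of_pos _ (by omega)⟩
  have hq' := eq_smul_add_smul hr1 q
  -- Otherwise q = D r with D > 1, contradicting that q is primitive.
  have hr0 : cross r q ≠ 0 := by
    intro h0
    rw [h0, hD] at hq'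
    obtain ⟨x, y, hxy⟩ := hq
    have e0 := congrFun hq' 0
    have e1 := congrFun hq' 1
    simp at e0 e1
    rw [e0, e1] at hxy
    have : (D : ℤ) ∣ 1 := ⟨x * r 0 + y * r 1, by linarith⟩
    have := Int.le_of_dvd one_pos this
    omega
  have hr : IsCoprime (r 0) (r 1) := by
    refine ⟨-p 1, p 0, ?_⟩
    simp only [cross] at hr1
    linarith
  obtain ⟨m, w, hw0, hw1, hw2, hw3⟩ := ih (cross r q).toNat (by omega) r q hr hq
    (by omega) (by omega)
  refine ⟨m + 1, fun j => if j = 0 then p else w (j - 1), rfl, by simpa using hw1, fun j hj => ?_,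
    fun j hj => ?_⟩
  · cases j with
    | zero => simp [hw0, hr1]
    | succ j => simpa using hw2 j (by omega)
  · cases j with
    | zero => simp [hself, hD]
    | succ j =>
      obtain ⟨h2, h3⟩ := hw3 j (by omega)
      simp only [Nat.add_eq_zero_iff, one_ne_zero, and_false, if_false, Nat.add_sub_cancel]
      refine ⟨?_, h3⟩
      have hrel := cross_pluecker p r (w j) q
      rw [hr1, hD] at hrel
      have h4 : 0 < cross r q := lt_of_le_of_ne hr2 (Ne.symm hr0)
      have h5 : 0 ≤ cross p (w j) * cross r q := by
        have := mul_nonneg (Int.natCast_nonneg D) h2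
        linarith
      exact nonneg_of_mul_nonneg_left h5 h4

lemma Cone2.exists_isFan_of_cross_neg (C : Cone2) {i k : Fin 2} (hne : i ≠ k)
    (h : cross (C.normal i) (C.normal k) < 0) : ∃ m w, IsFan C i k m w := by
  have hcop : ∀ f, IsCoprime (C.normal f 0) (C.normal f 1) := fun f =>
    Int.isCoprime_iff_gcd_eq_one.2 (C.primitive f)
  set p : Fin 2 → ℤ := ![C.normal i 1, -C.normal i 0] with hp
  set q : Fin 2 → ℤ := ![-C.normal k 1, C.normal k 0] with hq
  have hpq : cross p q = -cross (C.normal i) (C.normal k) := by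
    simp only [cross, hp, hq, Matrix.cons_val_zero, Matrix.cons_val_one]; ring
  obtain ⟨m, w, h0, h1, h2, h3⟩ := exists_unimodular_chain (cross p q).toNat p q
    (by simpa [hp] using (hcop i).symm.neg_right) (by simpa [hq] using (hcop k).symm.neg_left)
    (by omega) (by omega)
  refine ⟨m, w, IsFan.of_mem hne h0 h1 h2 fun j hj => ?_⟩
  rw [mem_points_iff_cross hne h0 h1, h0, h1]
  refine ⟨(h3 j hj).1, ?_⟩
  have : cross q (w j) = -cross (w j) q := by simp only [cross]; ring
  have := (h3 j hj).2
  omega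

lemma Cone2.exists_isFan (C : Cone2) : ∃ i k m w, IsFan C i k m w := by
  rcases lt_or_gt_of_ne C.cross_normal_ne_zero with h | h
  · exact ⟨0, 1, C.exists_isFan_of_cross_neg (by decide) h⟩
  · refine ⟨1, 0, C.exists_isFan_of_cross_neg (by decide) ?_⟩
    have : cross (C.normal 1) (C.normal 0) = -cross (C.normal 0) (C.normal 1) := by
      simp only [cross]; ring
    omega

/-! ### Periods of the cone -/

lemma cdot_smul_add_smul (k l : ℤ) (p q : Fin 2 → ℤ) (ω : Fin 2 → ℂ) :
    cdot (k • p + l • q) ω = k * cdot p ω + l * cdot q ω := by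
  simp [cdot]; ring

lemma linearIndependent_of_cross_ne_zero {p q : Fin 2 → ℤ} (h : cross p q ≠ 0) :
    LinearIndependent ℤ ![p, q] := by
  rw [LinearIndependent.pair_iff]
  intro s t hst
  have h0 := congrFun hst 0
  have h1 := congrFun hst 1
  simp at h0 h1
  have hs : s * cross p q = 0 := by
    simp only [cross]; linear_combination q 1 * h0 - q 0 * h1
  have ht : t * cross p q = 0 := by
    simp only [cross]; linear_combination p 0 * h1 - p 1 * h0
  exact ⟨(mul_eq_zero.1 hs).resolve_right h, (mul_eq_zero.1 ht).resolve_right h⟩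

lemma Cone2.re_cdot_pos (C : Cone2) {c : ℂ} {ω : Fin 2 → ℂ}
    (hc : (fun i => (c * ω i).re) ∈ interior C.dual) {n : Fin 2 → ℤ} (hn : n ∈ C.points)
    (hn0 : n ≠ 0) : 0 < (c * cdot n ω).re := by
  have := rdot_pos_of_mem_interior (s := C.dual) (toReal_ne_zero hn0)
    (fun y hy => hy _ hn) hc
  have e : (c * cdot n ω).re = rdot (fun i => (c * ω i).re) (toReal n) := by
    simp [rdot, toReal, cdot]
    ring
  rwa [e]

/-! ### Zeta functions of a fan -/

section

variable {C : Cone2} {i k : Fin 2} {m : ℕ} {w : ℕ → Fin 2 → ℤ} {c : ℂ} {ω : Fin 2 → ℂ}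

lemma IsFan.ne_zero (h : IsFan C i k m w) {j : ℕ} (hj : j ≤ m + 1) : w j ≠ 0 := by
  intro h0
  rcases Nat.lt_or_ge m j with h1 | h1
  · obtain rfl : j = m + 1 := by omega
    have := h.unimodular m le_rfl
    simp [h0, cross] at this
  · have := h.unimodular j h1
    simp [h0, cross] at this

lemma IsFan.re_pos (h : IsFan C i k m w) (hc : (fun i => (c * ω i).re) ∈ interior C.dual) {j : ℕ}
    (hj : j ≤ m + 1) : 0 < (c * cdot (w j) ω).re :=
  C.re_cdot_pos hc (h.mem j hj) (h.ne_zero hj)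

lemma IsFan.isZetaContinuation_points (h : IsFan C i k m w) {z : ℂ} {Z : ℕ → ℂ → ℂ}
    (hZ : ∀ j < m, IsQuadrantZeta c (cdot (w j) ω) (cdot (w (j + 1)) ω) (z + cdot (w j) ω) (Z j))
    (hm : IsQuadrantZeta c (cdot (w m) ω) (cdot (w (m + 1)) ω) z (Z m)) :
    IsZetaContinuation C.points c ω z (fun s => ∑ j ∈ Finset.range m, Z j s + Z m s) := by
  refine ⟨DifferentiableOn.fun_add (DifferentiableOn.fun_sum fun j hj =>
    (hZ j (Finset.mem_range.1 hj)).1) hm.1, fun s hs => ?_⟩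
  refine h.hasSum_points (F := fun n => negPow c (z + cdot n ω) s) (S := fun j => Z j s)
    (fun j hj => ?_) ?_
  · have e : (fun n : ℕ × ℕ => negPow c
        (z + cdot (((n.1 : ℤ) + 1) • w j + ((n.2 : ℤ) + 0) • w (j + 1)) ω) s) = fun n =>
        negPow c (z + cdot (w j) ω + pt (cdot (w j) ω) (cdot (w (j + 1)) ω) n) s := by
      funext n
      rw [cdot_smul_add_smul, pt]
      congr 1
      push_cast
      ring
    rw [e]
    exact (hZ j hj).2 s hs
  · have e : (fun n : ℕ × ℕ => negPow c
        (z + cdot (((n.1 : ℤ) + 0) • w m + ((n.2 : ℤ) + 0) • w (m + 1)) ω) s) = fun n =>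
        negPow c (z + pt (cdot (w m) ω) (cdot (w (m + 1)) ω) n) s := by
      funext n
      rw [cdot_smul_add_smul, pt]
      congr 1
    rw [e]
    exact hm.2 s hs

lemma IsFan.isZetaContinuation_interiorPoints (h : IsFan C i k m w) {z : ℂ} {Z : ℕ → ℂ → ℂ}
    (hZ : ∀ j < m, IsQuadrantZeta c (cdot (w j) ω) (cdot (w (j + 1)) ω)
      (z + cdot (w (j + 1)) ω) (Z j))
    (hm : IsQuadrantZeta c (cdot (w m) ω) (cdot (w (m + 1)) ω)
      (z + cdot (w m) ω + cdot (w (m + 1)) ω) (Z m)) :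
    IsZetaContinuation C.interiorPoints c ω z (fun s => ∑ j ∈ Finset.range m, Z j s + Z m s) := by
  refine ⟨DifferentiableOn.fun_add (DifferentiableOn.fun_sum fun j hj =>
    (hZ j (Finset.mem_range.1 hj)).1) hm.1, fun s hs => ?_⟩
  refine h.hasSum_interiorPoints (F := fun n => negPow c (z + cdot n ω) s) (S := fun j => Z j s)
    (fun j hj => ?_) ?_
  · have e : (fun n : ℕ × ℕ => negPow c
        (z + cdot (((n.1 : ℤ) + 0) • w j + ((n.2 : ℤ) + 1) • w (j + 1)) ω) s) = fun n =>
        negPow c (z + cdot (w (j + 1)) ω + pt (cdot (w j) ω) (cdot (w (j + 1)) ω) n) s := by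
      funext n
      rw [cdot_smul_add_smul, pt]
      congr 1
      push_cast
      ring
    rw [e]
    exact (hZ j hj).2 s hs
  · have e : (fun n : ℕ × ℕ => negPow c
        (z + cdot (((n.1 : ℤ) + 1) • w m + ((n.2 : ℤ) + 1) • w (m + 1)) ω) s) = fun n =>
        negPow c (z + cdot (w m) ω + cdot (w (m + 1)) ω +
          pt (cdot (w m) ω) (cdot (w (m + 1)) ω) n) s := by
      funext n
      rw [cdot_smul_add_smul, pt]
      congr 1
      push_cast
      ring
    rw [e]
    exact hm.2 s hs

lemma compl_one_two_mem_nhds_zero : ({1, 2} : Set ℂ)ᶜ ∈ 𝓝 (0 : ℂ) := by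
  have hfin : ({1, 2} : Set ℂ).Finite := by simp
  exact hfin.isClosed.isOpen_compl.mem_nhds (by simp)

/-- The choice made in `zeta` is immaterial: continuations agree off {1, 2}, which is a
neighbourhood of 0. -/
lemma IsZetaContinuation.gamma_eq {L : Set (Fin 2 → ℤ)} {z : ℂ} {Z : ℂ → ℂ}
    (h : IsZetaContinuation L c ω z Z) : gamma L c ω z = Complex.exp (deriv Z 0) := by
  have hex : ∃ Z, IsZetaContinuation L c ω z Z := ⟨Z, h⟩
  have heq : Set.EqOn (fun s => zeta L c ω s z) Z ({1, 2} : Set ℂ)ᶜ := by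
    have e : (fun s => zeta L c ω s z) = hex.choose := by
      funext s
      rw [zeta, dif_pos hex]
    rw [e]
    exact eqOn_compl_one_two hex.choose_spec.1 h.1 fun s hs =>
      (hex.choose_spec.2 s hs).unique (h.2 s hs)
  rw [gamma, (heq.eventuallyEq_of_mem compl_one_two_mem_nhds_zero).deriv_eq]

lemma exp_deriv_sum {Z : ℕ → ℂ → ℂ} (hZ : ∀ j ≤ m, DifferentiableOn ℂ (Z j) ({1, 2} : Set ℂ)ᶜ) :
    Complex.exp (deriv (fun s => ∑ j ∈ Finset.range m, Z j s + Z m s) 0) =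
      (∏ j ∈ Finset.range m, Complex.exp (deriv (Z j) 0)) * Complex.exp (deriv (Z m) 0) := by
  have hd : ∀ j ≤ m, HasDerivAt (Z j) (deriv (Z j) 0) 0 := fun j hj =>
    ((hZ j hj).differentiableAt compl_one_two_mem_nhds_zero).hasDerivAt
  have := (HasDerivAt.fun_sum (u := Finset.range m) fun j hj =>
    hd j (Finset.mem_range.1 hj).le).fun_add (hd m le_rfl)
  rw [this.deriv, Complex.exp_add, Complex.exp_sum]

lemma IsFan.cross_neg (h : IsFan C i k m w) {l : ℕ} (hl0 : 0 < l) (hl : l ≤ m) :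
    cross (w (m + 1)) (w l) < 0 := by
  have h1 : 0 < cross (w 0) (w l) := by
    obtain ⟨l, rfl⟩ := Nat.exists_eq_succ_of_ne_zero hl0.ne'
    exact h.pos l (by omega)
  have key : ∀ d, l + d ≤ m → cross (w (l + d + 1)) (w l) < 0 := by
    intro d
    induction d with
    | zero => exact fun hd => (h.sign hd (w l)).2.1 h1 (by simp [cross, mul_comm])
    | succ d ih => exact fun hd => (h.sign hd (w l)).1 h1.le (ih (by omega))
  have := key (m - l) (by omega)
  rwa [show l + (m - l) + 1 = m + 1 by omega] at this

lemma cross_smul_add_smul (r p q : Fin 2 → ℤ) (x y : ℤ) :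
    cross r (x • p + y • q) = x * cross r p + y * cross r q := by
  simp only [cross, Pi.add_apply, Pi.smul_apply, smul_eq_mul]; ring

lemma cross_self (p : Fin 2 → ℤ) : cross p p = 0 := by simp [cross, mul_comm]

lemma IsFan.smul_add_smul_mem_points (h : IsFan C i k m w) {j : ℕ} (hj : j ≤ m) {x y : ℤ}
    (hx : 0 ≤ x) (hy : 0 ≤ y) : x • w j + y • w (j + 1) ∈ C.points := by
  have h1 := (h.mem_points_iff _).1 (h.mem j (by omega))
  have h2 := (h.mem_points_iff _).1 (h.mem (j + 1) (by omega))
  rw [h.mem_points_iff, cross_smul_add_smul, cross_smul_add_smul]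
  exact ⟨by nlinarith [mul_nonneg hx h1.1, mul_nonneg hy h2.1],
    by nlinarith [mul_nonneg hx (neg_nonneg.2 h1.2), mul_nonneg hy (neg_nonneg.2 h2.2)]⟩

lemma IsFan.smul_add_smul_mem_interiorPoints (h : IsFan C i k m w) {j : ℕ} (hj : j ≤ m) {x y : ℤ}
    (hx : 0 ≤ x) (hy : 0 < y) (hjx : j < m ∨ 0 < x) :
    x • w j + y • w (j + 1) ∈ C.interiorPoints := by
  have h1 := (h.mem_points_iff _).1 (h.mem j (by omega))
  have h2 := (h.mem_points_iff _).1 (h.mem (j + 1) (by omega))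
  have h3 := h.pos j hj
  rw [h.mem_interiorPoints_iff, cross_smul_add_smul, cross_smul_add_smul]
  refine ⟨by nlinarith [mul_nonneg hx h1.1, mul_pos hy h3], ?_⟩
  rcases Nat.lt_or_ge j m with hjm | hjm
  · have := h.cross_neg (l := j + 1) (by omega) (by omega)
    nlinarith [mul_nonneg hx (neg_nonneg.2 h1.2), mul_pos hy (neg_pos.2 this)]
  · obtain rfl : j = m := by omega
    have h4 := h.unimodular j le_rfl
    have h5 : cross (w (j + 1)) (w j) = -1 := by simp only [cross] at h4 ⊢; linarith
    rw [cross_self, h5]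
    omega

/-- The gamma function of the cone is a finite product of shifted quadrant gamma functions. Each of
them is regular at z because the points of its quadrant belong to the cone. -/
lemma IsFan.continuousAt_gamma_points (h : IsFan C i k m w) (hc0 : c ≠ 0)
    (hc : (fun i => (c * ω i).re) ∈ interior C.dual) {z : ℂ}
    (hz : ∀ n ∈ C.points, z + cdot n ω ≠ 0) : ContinuousAt (gamma C.points c ω) z := by
  have hex : ∀ j ≤ m, ∃ g : ℂ → ℂ, (∀ z Z, IsQuadrantZeta c (cdot (w j) ω) (cdot (w (j + 1)) ω) z Z →
      Complex.exp (deriv Z 0) = g z) ∧ ∀ z,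
      (∀ n, z + pt (cdot (w j) ω) (cdot (w (j + 1)) ω) n ≠ 0) → ContinuousAt g z := fun j hj =>
    exists_continuousAt_gamma hc0 (h.re_pos hc (by omega)) (h.re_pos hc (by omega))
  choose! g hg hgc using hex
  have e : gamma C.points c ω = fun z =>
      (∏ j ∈ Finset.range m, g j (z + cdot (w j) ω)) * g m z := by
    funext z
    have hQ : ∀ j ≤ m, ∃ Z, IsQuadrantZeta c (cdot (w j) ω) (cdot (w (j + 1)) ω)
        (if j < m then z + cdot (w j) ω else z) Z := fun j hj =>
      exists_isQuadrantZeta hc0 (h.re_pos hc (by omega)) (h.re_pos hc (by omega)) _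
    choose! Z hZ using hQ
    have hm := hZ m le_rfl
    rw [if_neg (lt_irrefl m)] at hm
    have hZ' : ∀ j < m, IsQuadrantZeta c (cdot (w j) ω) (cdot (w (j + 1)) ω)
        (z + cdot (w j) ω) (Z j) := fun j hj => by
      have := hZ j hj.le
      rwa [if_pos hj] at this
    rw [(h.isZetaContinuation_points hZ' hm).gamma_eq, exp_deriv_sum fun j hj => (hZ j hj).1,
      hg m le_rfl _ _ hm]
    congr 1
    exact Finset.prod_congr rfl fun j hj =>
      hg j (Finset.mem_range.1 hj).le _ _ (hZ' j (Finset.mem_range.1 hj))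
  rw [e]
  refine ContinuousAt.mul (tendsto_finsetProd _ fun j hj => ?_) (hgc m le_rfl _ fun n => ?_)
  · have hj := Finset.mem_range.1 hj
    refine ContinuousAt.comp (f := fun z => z + cdot (w j) ω) (hgc j hj.le _ fun n => ?_)
      (by fun_prop)
    have := hz _ (h.smul_add_smul_mem_points hj.le (x := n.1 + 1) (y := n.2) (by omega) (by omega))
    rw [cdot_smul_add_smul] at this
    convert this using 1
    rw [pt]; push_cast; ring
  · have := hz _ (h.smul_add_smul_mem_points le_rfl (x := n.1) (y := n.2) (by omega) (by omega))
    rwa [cdot_smul_add_smul] at this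

lemma IsFan.continuousAt_gamma_interiorPoints (h : IsFan C i k m w) (hc0 : c ≠ 0)
    (hc : (fun i => (c * ω i).re) ∈ interior C.dual) {z : ℂ}
    (hz : ∀ n ∈ C.interiorPoints, z + cdot n ω ≠ 0) :
    ContinuousAt (gamma C.interiorPoints c ω) z := by
  have hex : ∀ j ≤ m, ∃ g : ℂ → ℂ, (∀ z Z, IsQuadrantZeta c (cdot (w j) ω) (cdot (w (j + 1)) ω) z Z →
      Complex.exp (deriv Z 0) = g z) ∧ ∀ z,
      (∀ n, z + pt (cdot (w j) ω) (cdot (w (j + 1)) ω) n ≠ 0) → ContinuousAt g z := fun j hj =>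
    exists_continuousAt_gamma hc0 (h.re_pos hc (by omega)) (h.re_pos hc (by omega))
  choose! g hg hgc using hex
  have e : gamma C.interiorPoints c ω = fun z =>
      (∏ j ∈ Finset.range m, g j (z + cdot (w (j + 1)) ω)) *
        g m (z + cdot (w m) ω + cdot (w (m + 1)) ω) := by
    funext z
    have hQ : ∀ j ≤ m, ∃ Z, IsQuadrantZeta c (cdot (w j) ω) (cdot (w (j + 1)) ω)
        (if j < m then z + cdot (w (j + 1)) ω else z + cdot (w m) ω + cdot (w (m + 1)) ω) Z :=
      fun j hj => exists_isQuadrantZeta hc0 (h.re_pos hc (by omega)) (h.re_pos hc (by omega)) _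
    choose! Z hZ using hQ
    have hm := hZ m le_rfl
    rw [if_neg (lt_irrefl m)] at hm
    have hZ' : ∀ j < m, IsQuadrantZeta c (cdot (w j) ω) (cdot (w (j + 1)) ω)
        (z + cdot (w (j + 1)) ω) (Z j) := fun j hj => by
      have := hZ j hj.le
      rwa [if_pos hj] at this
    rw [(h.isZetaContinuation_interiorPoints hZ' hm).gamma_eq,
      exp_deriv_sum fun j hj => (hZ j hj).1, hg m le_rfl _ _ hm]
    congr 1
    exact Finset.prod_congr rfl fun j hj =>
      hg j (Finset.mem_range.1 hj).le _ _ (hZ' j (Finset.mem_range.1 hj))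
  rw [e]
  refine ContinuousAt.mul (tendsto_finsetProd _ fun j hj => ?_)
    (ContinuousAt.comp (f := fun z => z + cdot (w m) ω + cdot (w (m + 1)) ω)
      (hgc m le_rfl _ fun n => ?_) (by fun_prop))
  · have hj := Finset.mem_range.1 hj
    refine ContinuousAt.comp (f := fun z => z + cdot (w (j + 1)) ω) (hgc j hj.le _ fun n => ?_)
      (by fun_prop)
    have := hz _ (h.smul_add_smul_mem_interiorPoints hj.le (x := n.1) (y := n.2 + 1) (by omega)
      (by omega) (Or.inl hj))
    rw [cdot_smul_add_smul] at this
    convert this using 1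
    rw [pt]; push_cast; ring
  · have := hz _ (h.smul_add_smul_mem_interiorPoints le_rfl (x := n.1 + 1) (y := n.2 + 1) (by omega)
      (by omega) (Or.inr (by omega)))
    rw [cdot_smul_add_smul] at this
    convert this using 1
    rw [pt]; push_cast; ring

lemma IsFan.exists_isZetaContinuation (h : IsFan C i k m w) (hc0 : c ≠ 0)
    (hc : (fun i => (c * ω i).re) ∈ interior C.dual) (z : ℂ) :
    ∃ Z Z' : ℕ → ℂ → ℂ,
      (∀ j < m, IsQuadrantZeta c (cdot (w j) ω) (cdot (w (j + 1)) ω) (z + cdot (w j) ω) (Z j)) ∧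
      IsQuadrantZeta c (cdot (w m) ω) (cdot (w (m + 1)) ω) z (Z m) ∧
      (∀ j < m, IsQuadrantZeta c (cdot (w j) ω) (cdot (w (j + 1)) ω)
        (-z + cdot (w (j + 1)) ω) (Z' j)) ∧
      IsQuadrantZeta c (cdot (w m) ω) (cdot (w (m + 1)) ω)
        (-z + cdot (w m) ω + cdot (w (m + 1)) ω) (Z' m) := by
  have hQ : ∀ (j : ℕ) (x : ℂ), j ≤ m → ∃ Z,
      IsQuadrantZeta c (cdot (w j) ω) (cdot (w (j + 1)) ω) x Z := fun j x hj =>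
    exists_isQuadrantZeta hc0 (h.re_pos hc (by omega)) (h.re_pos hc (by omega)) _
  choose! Q hQ using hQ
  refine ⟨fun j => if j < m then Q j (z + cdot (w j) ω) else Q m z, fun j => if j < m then
    Q j (-z + cdot (w (j + 1)) ω) else Q m (-z + cdot (w m) ω + cdot (w (m + 1)) ω),
    fun j hj => ?_, ?_, fun j hj => ?_, ?_⟩
  · simp only [if_pos hj]; exact hQ _ _ hj.le
  · simp only [if_neg (lt_irrefl m)]; exact hQ _ _ le_rfl
  · simp only [if_pos hj]; exact hQ _ _ hj.le
  · simp only [if_neg (lt_irrefl m)]; exact hQ _ _ le_rfl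

lemma gamma_ne_zero (L : Set (Fin 2 → ℤ)) (z : ℂ) : gamma L c ω z ≠ 0 := Complex.exp_ne_zero _

lemma IsFan.continuousAt_doubleSine (h : IsFan C i k m w) (hc0 : c ≠ 0)
    (hc : (fun i => (c * ω i).re) ∈ interior C.dual) {z : ℂ} (hz : IsRegularPoint C ω z) :
    ContinuousAt (doubleSine C c ω) z := by
  have h1 := (h.continuousAt_gamma_points hc0 hc hz.1).inv₀ (gamma_ne_zero _ _)
  have h2 : ContinuousAt (fun z => gamma C.interiorPoints c ω (-z)) z :=
    ContinuousAt.comp (f := fun z : ℂ => -z) (h.continuousAt_gamma_interiorPoints hc0 hc hz.2)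
      (by fun_prop)
  exact h1.mul h2

end

/-! ### Bernoulli polynomials of a fan -/

lemma IsExpansion.add {F G : ℂ → ℂ} {D : Set ℂ} {b b' : ℕ → ℂ} (h : IsExpansion F D b)
    (h' : IsExpansion G D b') : IsExpansion (fun t => F t + G t) D fun k => b k + b' k := by
  obtain ⟨ε, hε, h⟩ := h
  obtain ⟨ε', hε', h'⟩ := h'
  refine ⟨min ε ε', lt_min hε hε', fun t ht hlt => ?_⟩
  have e : (fun k : ℕ => (b k + b' k) * t ^ k / (k.factorial : ℂ)) = fun k =>
      b k * t ^ k / (k.factorial : ℂ) + b' k * t ^ k / (k.factorial : ℂ) := by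
    funext k; ring
  rw [e]
  exact (h t ht (hlt.trans_le (min_le_left _ _))).add (h' t ht (hlt.trans_le (min_le_right _ _)))

lemma IsExpansion.sum {F : ℕ → ℂ → ℂ} {D : Set ℂ} {b : ℕ → ℕ → ℂ} {m : ℕ}
    (h : ∀ j < m, IsExpansion (F j) D (b j)) :
    IsExpansion (fun t => ∑ j ∈ Finset.range m, F j t) D
      fun k => ∑ j ∈ Finset.range m, b j k := by
  induction m with
  | zero =>
    refine ⟨1, one_pos, fun t _ _ => ?_⟩
    simp
  | succ m ih =>
    simp only [Finset.sum_range_succ]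
    exact (ih fun j hj => h j (by omega)).add (h m (by omega))

lemma IsExpansion.congr {F G : ℂ → ℂ} {D D' : Set ℂ} {b : ℕ → ℂ} (h : IsExpansion F D b)
    (hD : D' ⊆ D) (hF : ∀ t ∈ D', G t = F t) : IsExpansion G D' b := by
  obtain ⟨ε, hε, h⟩ := h
  exact ⟨ε, hε, fun t ht hlt => by rw [hF t ht]; exact h t (hD ht) hlt⟩

lemma norm_exp_neg_lt_one {x : ℂ} (h : 0 < x.re) : ‖Complex.exp (-x)‖ < 1 := by
  rw [Complex.norm_exp, Real.exp_lt_one_iff]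
  simpa using h

lemma hasSum_geometric_add {x : ℂ} (hx : ‖x‖ < 1) (k : ℕ) :
    HasSum (fun n : ℕ => x ^ (n + k)) (x ^ k / (1 - x)) := by
  have h1 := (hasSum_geometric_of_norm_lt_one hx).mul_left (x ^ k)
  have e : (fun n : ℕ => x ^ (n + k)) = fun n => x ^ k * x ^ n := by
    funext n; rw [pow_add, mul_comm]
  rw [e, div_eq_mul_inv]
  exact h1

lemma hasSum_mul_prod {f g : ℕ → ℂ} {a b : ℂ} (h1 : HasSum f a) (h2 : HasSum g b) :
    HasSum (fun n : ℕ × ℕ => f n.1 * g n.2) (a * b) :=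
  h1.mul h2 (summable_mul_of_summable_norm h1.summable.norm h2.summable.norm)

lemma hasSum_geometric_quadrant {x y : ℂ} (hx : ‖x‖ < 1) (hy : ‖y‖ < 1) (k l : ℕ) :
    HasSum (fun n : ℕ × ℕ => x ^ (n.1 + k) * y ^ (n.2 + l))
      (x ^ k / (1 - x) * (y ^ l / (1 - y))) :=
  hasSum_mul_prod (f := fun n => x ^ (n + k)) (g := fun n => y ^ (n + l))
    (hasSum_geometric_add hx k) (hasSum_geometric_add hy l)

lemma hasSum_exp_quadrant {a b t : ℂ} (ha : ‖Complex.exp (-(a * t))‖ < 1)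
    (hb : ‖Complex.exp (-(b * t))‖ < 1) (k l : ℕ) :
    HasSum (fun n : ℕ × ℕ => Complex.exp (-((n.1 + k) * a + (n.2 + l) * b) * t))
      (Complex.exp (-(a * t)) ^ k / (1 - Complex.exp (-(a * t))) *
        (Complex.exp (-(b * t)) ^ l / (1 - Complex.exp (-(b * t))))) := by
  have e : (fun n : ℕ × ℕ => Complex.exp (-((n.1 + k) * a + (n.2 + l) * b) * t)) = fun n =>
      Complex.exp (-(a * t)) ^ (n.1 + k) * Complex.exp (-(b * t)) ^ (n.2 + l) := by
    funext n
    rw [← Complex.exp_nat_mul, ← Complex.exp_nat_mul, ← Complex.exp_add, Nat.cast_add,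
      Nat.cast_add]
    exact congrArg Complex.exp (by ring)
  rw [e]
  exact hasSum_geometric_quadrant ha hb k l

lemma exp_ne_one_of_norm_lt_one {x : ℂ} (h : ‖Complex.exp (-x)‖ < 1) : Complex.exp x - 1 ≠ 0 := by
  intro h0
  rw [Complex.exp_neg, sub_eq_zero.1 h0] at h
  simp at h

lemma bernoulliGen_eq_mul_interior {z a b t : ℂ} (ha : ‖Complex.exp (-(a * t))‖ < 1)
    (hb : ‖Complex.exp (-(b * t))‖ < 1) :
    bernoulliGen z a b t = t ^ 2 * Complex.exp (z * t) *
      (Complex.exp (-(a * t)) ^ 1 / (1 - Complex.exp (-(a * t))) *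
        (Complex.exp (-(b * t)) ^ 1 / (1 - Complex.exp (-(b * t))))) := by
  have ha' := exp_ne_one_of_norm_lt_one ha
  have hb' := exp_ne_one_of_norm_lt_one hb
  rw [bernoulliGen, Complex.exp_neg, Complex.exp_neg]
  have h1 := Complex.exp_ne_zero (a * t)
  have h2 := Complex.exp_ne_zero (b * t)
  generalize Complex.exp (a * t) = x at *
  generalize Complex.exp (b * t) = y at *
  have e1 : x⁻¹ ^ 1 / (1 - x⁻¹) = (x - 1)⁻¹ := by
    rw [pow_one, div_eq_mul_inv, ← mul_inv, mul_sub, mul_inv_cancel₀ h1, mul_one]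
  have e2 : y⁻¹ ^ 1 / (1 - y⁻¹) = (y - 1)⁻¹ := by
    rw [pow_one, div_eq_mul_inv, ← mul_inv, mul_sub, mul_inv_cancel₀ h2, mul_one]
  rw [e1, e2, ← mul_inv, div_eq_mul_inv]

/-- Shifting z by a multiplies by e^{at}, which restores the boundary ray missing from the open
quadrant. -/
lemma bernoulliGen_eq_mul_halfOpen {z a b t : ℂ} (ha : ‖Complex.exp (-(a * t))‖ < 1)
    (hb : ‖Complex.exp (-(b * t))‖ < 1) :
    bernoulliGen (z + a) a b t = t ^ 2 * Complex.exp (z * t) *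
      (Complex.exp (-(a * t)) ^ 0 / (1 - Complex.exp (-(a * t))) *
        (Complex.exp (-(b * t)) ^ 1 / (1 - Complex.exp (-(b * t))))) := by
  rw [bernoulliGen_eq_mul_interior ha hb, add_mul, Complex.exp_add, pow_one, pow_zero,
    Complex.exp_neg (a * t)]
  have h1 := Complex.exp_ne_zero (a * t)
  generalize Complex.exp (a * t) = x at *
  field_simp

section

variable {C : Cone2} {i k : Fin 2} {m : ℕ} {w : ℕ → Fin 2 → ℤ} {c : ℂ} {ω : Fin 2 → ℂ}

lemma IsFan.hasSum_exp_interiorPoints (h : IsFan C i k m w) {t : ℂ}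
    (ht : ∀ j ≤ m + 1, ‖Complex.exp (-(cdot (w j) ω * t))‖ < 1) :
    HasSum (fun n : C.interiorPoints => Complex.exp (-(cdot n ω) * t))
      (∑ j ∈ Finset.range m, Complex.exp (-(cdot (w j) ω * t)) ^ 0 /
        (1 - Complex.exp (-(cdot (w j) ω * t))) * (Complex.exp (-(cdot (w (j + 1)) ω * t)) ^ 1 /
        (1 - Complex.exp (-(cdot (w (j + 1)) ω * t)))) +
      Complex.exp (-(cdot (w m) ω * t)) ^ 1 / (1 - Complex.exp (-(cdot (w m) ω * t))) *
        (Complex.exp (-(cdot (w (m + 1)) ω * t)) ^ 1 /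
        (1 - Complex.exp (-(cdot (w (m + 1)) ω * t))))) := by
  set S : ℕ → ℂ := fun j => Complex.exp (-(cdot (w j) ω * t)) ^ (if j < m then 0 else 1) /
        (1 - Complex.exp (-(cdot (w j) ω * t))) * (Complex.exp (-(cdot (w (j + 1)) ω * t)) ^ 1 /
        (1 - Complex.exp (-(cdot (w (j + 1)) ω * t)))) with hS
  have h1 := h.hasSum_interiorPoints (F := fun n => Complex.exp (-(cdot n ω) * t)) (S := S)
    (fun j hj => by
      simp only [hS, if_pos hj]
      have := hasSum_exp_quadrant (ht j (by omega)) (ht (j + 1) (by omega)) 0 1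
      have e : (fun n : ℕ × ℕ => Complex.exp
          (-(cdot (((n.1 : ℤ) + 0) • w j + ((n.2 : ℤ) + 1) • w (j + 1)) ω) * t)) = fun n =>
          Complex.exp (-((n.1 + (0 : ℕ)) * cdot (w j) ω +
            (n.2 + (1 : ℕ)) * cdot (w (j + 1)) ω) * t) := by
        funext n; rw [cdot_smul_add_smul]; push_cast; rfl
      rw [e]; exact this)
    (by
      simp only [hS, if_neg (lt_irrefl m)]
      have := hasSum_exp_quadrant (ht m (by omega)) (ht (m + 1) (by omega)) 1 1
      have e : (fun n : ℕ × ℕ => Complex.exp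
          (-(cdot (((n.1 : ℤ) + 1) • w m + ((n.2 : ℤ) + 1) • w (m + 1)) ω) * t)) = fun n =>
          Complex.exp (-((n.1 + (1 : ℕ)) * cdot (w m) ω +
            (n.2 + (1 : ℕ)) * cdot (w (m + 1)) ω) * t) := by
        funext n; rw [cdot_smul_add_smul]; push_cast; rfl
      rw [e]; exact this)
  have e : ∑ j ∈ Finset.range m, S j = ∑ j ∈ Finset.range m, Complex.exp (-(cdot (w j) ω * t)) ^ 0 /
        (1 - Complex.exp (-(cdot (w j) ω * t))) * (Complex.exp (-(cdot (w (j + 1)) ω * t)) ^ 1 /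
        (1 - Complex.exp (-(cdot (w (j + 1)) ω * t)))) :=
    Finset.sum_congr rfl fun j hj => by simp only [hS, if_pos (Finset.mem_range.1 hj)]
  rw [← e]
  simp only [hS, if_neg (lt_irrefl m)] at h1 ⊢
  exact h1

/-- Restricted to the points p + N w j, with p interior, the convergent sum is a geometric series,
so its ratio has modulus below 1. -/
lemma IsFan.norm_exp_lt_one (h : IsFan C i k m w) {t : ℂ} (ht : t ∈ coneBernoulliDomain C ω)
    {j : ℕ} (hj : j ≤ m + 1) : ‖Complex.exp (-(cdot (w j) ω * t))‖ < 1 := by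
  set p : Fin 2 → ℤ := (1 : ℤ) • w m + (1 : ℤ) • w (m + 1) with hp
  have hpi : p ∈ C.interiorPoints :=
    h.smul_add_smul_mem_interiorPoints le_rfl (by omega) (by omega) (Or.inr (by omega))
  have hmem : ∀ N : ℕ, (1 : ℤ) • p + (N : ℤ) • w j ∈ C.interiorPoints := by
    intro N
    rw [C.mem_interiorPoints] at hpi ⊢
    intro f
    have h1 := hpi f
    have h2 := mul_nonneg (Int.natCast_nonneg N) ((C.mem_points _).1 (h.mem j hj) f)
    simp only [Pi.add_apply, Pi.smul_apply, smul_eq_mul]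
    nlinarith
  have hinj : Function.Injective fun N : ℕ => (⟨_, hmem N⟩ : C.interiorPoints) := by
    intro N N' e
    have e1 := congrArg Subtype.val e
    simp only [add_right_inj] at e1
    have := smul_left_injective ℤ (h.ne_zero hj) e1
    exact_mod_cast this
  have hsum := (Summable.comp_injective (show Summable fun n : C.interiorPoints =>
    Complex.exp (-(cdot n ω) * t) from ht) hinj)
  have e : ((fun n : C.interiorPoints => Complex.exp (-(cdot n ω) * t)) ∘
      fun N : ℕ => (⟨_, hmem N⟩ : C.interiorPoints)) = fun N : ℕ =>
      Complex.exp (-(cdot p ω * t)) * Complex.exp (-(cdot (w j) ω * t)) ^ N := by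
    funext N
    simp only [Function.comp_apply]
    rw [cdot_smul_add_smul, ← Complex.exp_nat_mul, ← Complex.exp_add]
    congr 1
    push_cast
    ring
  rw [e, summable_mul_left_iff (Complex.exp_ne_zero _)] at hsum
  exact summable_geometric_iff_norm_lt_one.1 hsum

lemma IsFan.coneBernoulliGen_eq (h : IsFan C i k m w) {t : ℂ} (ht : t ∈ coneBernoulliDomain C ω)
    (z : ℂ) : coneBernoulliGen C ω z t =
      ∑ j ∈ Finset.range m,
        bernoulliGen (z + cdot (w j) ω) (cdot (w j) ω) (cdot (w (j + 1)) ω) t +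
      bernoulliGen z (cdot (w m) ω) (cdot (w (m + 1)) ω) t := by
  have hlt : ∀ j ≤ m + 1, ‖Complex.exp (-(cdot (w j) ω * t))‖ < 1 := fun j hj =>
    h.norm_exp_lt_one ht hj
  rw [coneBernoulliGen, (h.hasSum_exp_interiorPoints hlt).tsum_eq, mul_add, Finset.mul_sum,
    bernoulliGen_eq_mul_interior (hlt m (by omega)) (hlt (m + 1) le_rfl)]
  congr 1
  refine Finset.sum_congr rfl fun j hj => ?_
  have hj := Finset.mem_range.1 hj
  rw [bernoulliGen_eq_mul_halfOpen (hlt j (by omega)) (hlt (j + 1) (by omega))]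

/-- Small positive multiples of c lie in the domain, so it accumulates at 0 and the Bernoulli
coefficients are unique. -/
lemma IsFan.exists_mem_domain (h : IsFan C i k m w) (hc0 : c ≠ 0)
    (hc : (fun i => (c * ω i).re) ∈ interior C.dual) :
    ∀ ε > (0 : ℝ), ∃ t ∈ coneBernoulliDomain C ω, t ≠ 0 ∧ ‖t‖ < ε := by
  intro ε hε
  have hn : 0 < ‖c‖ := norm_pos_iff.2 hc0
  set r : ℝ := ε / (2 * ‖c‖) with hr
  have hr0 : 0 < r := by positivity
  refine ⟨(r : ℂ) * c, ?_, mul_ne_zero (by exact_mod_cast hr0.ne') hc0, ?_⟩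
  · refine (h.hasSum_exp_interiorPoints fun j hj => norm_exp_neg_lt_one ?_).summable
    have e : (cdot (w j) ω * (r * c)).re = r * (c * cdot (w j) ω).re := by
      rw [show cdot (w j) ω * (r * c) = (r : ℂ) * (c * cdot (w j) ω) by ring, Complex.re_ofReal_mul]
    rw [e]
    exact mul_pos hr0 (h.re_pos hc hj)
  · rw [norm_mul, Complex.norm_real, Real.norm_of_nonneg hr0.le, hr]
    field_simp
    linarith

lemma IsFan.exists_isExpansion (h : IsFan C i k m w)
    (hc : (fun i => (c * ω i).re) ∈ interior C.dual) (z : ℂ) :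
    ∃ b, IsExpansion (coneBernoulliGen C ω z) (coneBernoulliDomain C ω) b ∧
      b 2 = ∑ j ∈ Finset.range m,
        2 * halfB (cdot (w j) ω) (cdot (w (j + 1)) ω) (z + cdot (w j) ω) +
        2 * halfB (cdot (w m) ω) (cdot (w (m + 1)) ω) z := by
  have hne : ∀ j ≤ m + 1, cdot (w j) ω ≠ 0 := fun j hj => ne_zero_of_re (h.re_pos hc hj)
  have hex : ∀ (j : ℕ) (x : ℂ), j ≤ m → ∃ e : ℕ → ℂ,
      IsExpansion (bernoulliGen x (cdot (w j) ω) (cdot (w (j + 1)) ω)) {0}ᶜ e ∧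
      e 2 = 2 * halfB (cdot (w j) ω) (cdot (w (j + 1)) ω) x := fun j x hj =>
    exists_bernoulli x (hne j (by omega)) (hne (j + 1) (by omega))
  choose! e he he2 using hex
  have h0 : coneBernoulliDomain C ω ⊆ {0}ᶜ := by
    rintro t ht rfl
    have := h.norm_exp_lt_one ht (Nat.zero_le _)
    simp at this
  have h1 := IsExpansion.sum (m := m) fun j hj =>
    (he j (z + cdot (w j) ω) hj.le).congr h0 fun _ _ => rfl
  have h2 := h1.add ((he m z le_rfl).congr h0 fun _ _ => rfl)
  refine ⟨_, h2.congr subset_rfl fun t ht => h.coneBernoulliGen_eq ht z, ?_⟩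
  simp only [he2 m z le_rfl]
  congr 1
  exact Finset.sum_congr rfl fun j hj => he2 j _ (Finset.mem_range.1 hj).le

lemma IsFan.coneBernoulli_two (h : IsFan C i k m w) (hc0 : c ≠ 0)
    (hc : (fun i => (c * ω i).re) ∈ interior C.dual) (z : ℂ) :
    coneBernoulli C 2 ω z = ∑ j ∈ Finset.range m,
        2 * halfB (cdot (w j) ω) (cdot (w (j + 1)) ω) (z + cdot (w j) ω) +
        2 * halfB (cdot (w m) ω) (cdot (w (m + 1)) ω) z := by
  obtain ⟨b, hb, hb2⟩ := h.exists_isExpansion hc z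
  rw [coneBernoulli, hb.expansionCoeff_eq (h.exists_mem_domain hc0 hc), hb2]

end

/-! ### Telescoping of the infinite products -/

lemma norm_nome_ne_one {a b : ℂ} (him : (b / a).im ≠ 0) : ‖nome a b‖ ≠ 1 := by
  rw [norm_nome, Ne, Real.exp_eq_one_iff, neg_eq_zero]
  exact mul_ne_zero (by positivity) him

lemma one_sub_nome_mul_pow_ne_zero {a b z : ℂ} (ha : a ≠ 0) (hz : ∀ k l : ℤ, z ≠ k * a + l * b)
    (n : ℕ) : 1 - nome a z * nome a b ^ n ≠ 0 := by
  intro h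
  rw [← nome_nat_mul, ← nome_add] at h
  obtain ⟨k, hk⟩ := nome_eq_one ha (sub_eq_zero.1 h).symm
  apply hz k (-n)
  push_cast
  linear_combination hk

/-- For |q| < 1 the q-factorial with base q⁻¹ is by definition the reciprocal of the one with base
q, up to a shift by q. The case |q| > 1 is symmetric, and off the lattice no factor vanishes. -/
lemma qFactorial_mul_inv {a b z : ℂ} (ha : a ≠ 0) (him : (b / a).im ≠ 0)
    (hz : ∀ k l : ℤ, z ≠ k * a + l * b) :
    qFactorial (nome a z) (nome a b) *
      qFactorial (nome a z * (nome a b)⁻¹) (nome a b)⁻¹ = 1 := by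
  have hq0 := nome_ne_zero a b
  rcases lt_or_gt_of_ne (norm_nome_ne_one him) with hq | hq
  · rw [qFactorial_of_norm_lt_one _ hq, qFactorial_inv_of_norm_lt_one _ hq hq0,
      inv_mul_cancel_right₀ hq0]
    exact mul_inv_cancel₀ (qprod_ne_zero hq (one_sub_nome_mul_pow_ne_zero ha hz))
  · have hq' : ‖(nome a b)⁻¹‖ < 1 := by rw [norm_inv]; exact inv_lt_one_of_one_lt₀ hq
    have h1 := qFactorial_inv_of_norm_lt_one (nome a z) hq' (inv_ne_zero hq0)
    rw [inv_inv] at h1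
    rw [h1, qFactorial_of_norm_lt_one _ hq']
    refine inv_mul_cancel₀ (qprod_ne_zero hq' ?_)
    have hz' : ∀ k l : ℤ, z - b ≠ k * a + l * (-b) := fun k l h =>
      hz k (1 - l) (by push_cast; linear_combination h)
    rw [← nome_neg, ← nome_add, ← sub_eq_add_neg]
    exact one_sub_nome_mul_pow_ne_zero ha hz'

lemma prod_telescope {f g : ℕ → ℂ} {m : ℕ} (h : ∀ j < m, f (j + 1) * g (j + 1) = 1) :
    (∏ j ∈ Finset.range m, f j * g (j + 1)) * (f m * g (m + 1)) = f 0 * g (m + 1) := by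
  have key : ∀ l ≤ m, (∏ j ∈ Finset.range l, f j * g (j + 1)) * f l = f 0 := by
    intro l
    induction l with
    | zero => simp
    | succ l ih =>
      intro hl
      rw [Finset.prod_range_succ]
      calc (∏ j ∈ Finset.range l, f j * g (j + 1)) * (f l * g (l + 1)) * f (l + 1)
          = ((∏ j ∈ Finset.range l, f j * g (j + 1)) * f l) * (f (l + 1) * g (l + 1)) := by ring
        _ = f 0 := by rw [ih (by omega), h l (by omega), mul_one]
  rw [← mul_assoc, key m le_rfl]

section

variable {C : Cone2} {i k : Fin 2} {m : ℕ} {w : ℕ → Fin 2 → ℤ} {c : ℂ} {ω : Fin 2 → ℂ}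

lemma IsFan.im_ne_zero (h : IsFan C i k m w)
    (hω : ∀ p q : Fin 2 → ℤ, LinearIndependent ℤ ![p, q] → (cdot p ω / cdot q ω).im ≠ 0)
    {j : ℕ} (hj : j ≤ m) : (cdot (w (j + 1)) ω / cdot (w j) ω).im ≠ 0 := by
  refine hω _ _ (linearIndependent_of_cross_ne_zero fun h0 => ?_)
  have := h.unimodular j hj
  simp only [cross] at this h0
  linarith

lemma ne_cdot_add {z : ℂ} (hz : ∀ k : Fin 2 → ℤ, z ≠ cdot k ω) (p q : Fin 2 → ℤ) (x y : ℤ) :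
    z ≠ x * cdot p ω + y * cdot q ω := by
  rw [← cdot_smul_add_smul]
  exact hz _

/-- Two vectors completing `p` to a basis with the same orientation have the same nome. -/
lemma nome_cdot_eq {p q r : Fin 2 → ℤ} {d : ℤ} (hd : d = 1 ∨ d = -1) (hp : cdot p ω ≠ 0)
    (hq : cross p q = d) (hr : cross p r = d) :
    nome (cdot p ω) (cdot q ω) = nome (cdot p ω) (cdot r ω) := by
  have hd2 : d * d = 1 := by rcases hd with rfl | rfl <;> norm_num
  -- Two completions of p with equal determinant differ by an integral multiple of p, which the nome
  -- does not see.
  have e : q = (d * cross q r) • p + (1 : ℤ) • r := by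
    simp only [cross] at *
    funext f
    fin_cases f <;> simp
    · have h1 : d * q 0 = (q 0 * r 1 - q 1 * r 0) * p 0 + d * r 0 := by
        linear_combination (-q 0) * hr + r 0 * hq
      linear_combination (-q 0 + r 0) * hd2 + d * h1
    · have h1 : d * q 1 = (q 0 * r 1 - q 1 * r 0) * p 1 + d * r 1 := by
        linear_combination (-q 1) * hr + r 1 * hq
      linear_combination (-q 1 + r 1) * hd2 + d * h1
  have e2 := congrArg (fun x => cdot x ω) e
  simp only [cdot_smul_add_smul] at e2
  rw [e2, nome_add, Int.cast_one, one_mul]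
  generalize d * cross q r = n
  have : nome (cdot p ω) (n * cdot p ω) = 1 := by
    rw [nome, mul_div_assoc, div_self hp, mul_one, Complex.exp_eq_one_iff]
    exact ⟨n, by ring⟩
  rw [this, one_mul]

/-- Both w j and -w (j + 2) have determinant -1 with w (j + 1), so the two cones meeting at an inner
ray have reciprocal bases q. -/
lemma IsFan.nome_eq_inv (h : IsFan C i k m w) {j : ℕ} (hj : j < m)
    (hne : cdot (w (j + 1)) ω ≠ 0) :
    nome (cdot (w (j + 1)) ω) (cdot (w j) ω) =
      (nome (cdot (w (j + 1)) ω) (cdot (w (j + 1 + 1)) ω))⁻¹ := by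
  rw [← nome_neg]
  have e : -cdot (w (j + 1 + 1)) ω = cdot (-w (j + 1 + 1)) ω := by simp [cdot]; ring
  rw [e]
  refine nome_cdot_eq (Or.inr rfl) hne ?_ ?_
  · have := h.unimodular j (by omega)
    simp only [cross] at this ⊢
    linarith
  · have := h.unimodular (j + 1) (by omega)
    simp only [cross, Pi.neg_apply] at this ⊢
    linarith

/-- Cone j < m contributes a quadrant sine at z + a j. Its first factor is unaffected by the shift.
Its second is multiplied in the argument by its own base, which is the form that cancels the first
factor of cone j + 1. -/
lemma IsFan.doubleSine_eq (h : IsFan C i k m w) (hc0 : c ≠ 0)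
    (hc : (fun i => (c * ω i).re) ∈ interior C.dual)
    (hω : ∀ p q : Fin 2 → ℤ, LinearIndependent ℤ ![p, q] → (cdot p ω / cdot q ω).im ≠ 0)
    {z : ℂ} (hz : ∀ k : Fin 2 → ℤ, z ≠ cdot k ω) :
    doubleSine C c ω z = Complex.exp (Real.pi * Complex.I / 2 * coneBernoulli C 2 ω z) *
      (qFactorial (nome (cdot (w 0) ω) z) (nome (cdot (w 0) ω) (cdot (w 1) ω)) *
        qFactorial (nome (cdot (w (m + 1)) ω) z)
          (nome (cdot (w (m + 1)) ω) (cdot (w m) ω))) := by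
  obtain ⟨Z, Z', h1, h2, h3, h4⟩ := h.exists_isZetaContinuation (z := z) (ω := ω) hc0 hc
  set a : ℕ → ℂ := fun j => cdot (w j) ω with ha
  have hne : ∀ j ≤ m + 1, a j ≠ 0 := fun j hj => ne_zero_of_re (h.re_pos hc hj)
  set f : ℕ → ℂ := fun j => qFactorial (nome (a j) z) (nome (a j) (a (j + 1))) with hf
  set g' : ℕ → ℂ := fun j => qFactorial (nome (a (j + 1)) z * nome (a (j + 1)) (a j))
    (nome (a (j + 1)) (a j)) with hg'
  have hE : ∀ j < m, (Complex.exp (deriv (Z j) 0))⁻¹ * Complex.exp (deriv (Z' j) 0) =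
      Complex.exp (Real.pi * Complex.I * halfB (a j) (a (j + 1)) (z + a j)) * (f j * g' j) := by
    intro j hj
    have h3' := h3 j hj
    rw [show -z + cdot (w (j + 1)) ω = cdot (w j) ω + cdot (w (j + 1)) ω - (z + cdot (w j) ω) by
      ring] at h3'
    have := (h1 j hj).reflection hc0 (h.re_pos hc (by omega)) (h.re_pos hc (by omega))
      (h.im_ne_zero hω hj.le) (fun k l e => ne_cdot_add hz (w j) (w (j + 1)) (k - 1) l (by
        push_cast; linear_combination e)) h3'
    rw [Complex.exp_add, Complex.exp_neg, nome_add, nome_add, nome_self (hne j (by omega)),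
      mul_one] at this
    exact this
  have hEm : (Complex.exp (deriv (Z m) 0))⁻¹ * Complex.exp (deriv (Z' m) 0) =
      Complex.exp (Real.pi * Complex.I * halfB (a m) (a (m + 1)) z) * (f m *
        qFactorial (nome (a (m + 1)) z) (nome (a (m + 1)) (a m))) := by
    rw [show -z + cdot (w m) ω + cdot (w (m + 1)) ω = cdot (w m) ω + cdot (w (m + 1)) ω - z by
      ring] at h4
    have := h2.reflection hc0 (h.re_pos hc (by omega)) (h.re_pos hc (by omega))
      (h.im_ne_zero hω le_rfl) (fun k l e => ne_cdot_add hz (w m) (w (m + 1)) k l e) h4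
    rw [Complex.exp_add, Complex.exp_neg] at this
    exact this
  -- The last cone is not shifted, so its second factor differs in form from the others and is the
  -- one that survives.
  set g : ℕ → ℂ := fun j => if j = m + 1 then qFactorial (nome (a (m + 1)) z)
    (nome (a (m + 1)) (a m)) else g' (j - 1) with hg
  have hfg := prod_telescope (f := f) (g := g) (m := m) fun j hj => by
    have e : g (j + 1) = g' j := by
      simp only [hg]
      rw [if_neg (by omega), Nat.add_sub_cancel]
    rw [e]
    simp only [hf, hg']
    rw [h.nome_eq_inv hj (hne (j + 1) (by omega))]
    exact qFactorial_mul_inv (hne (j + 1) (by omega)) (h.im_ne_zero hω (by omega))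
      fun k l => ne_cdot_add hz _ _ k l
  have e1 : ∀ j ∈ Finset.range m, f j * g (j + 1) = f j * g' j := fun j hj => by
    have := Finset.mem_range.1 hj
    simp only [hg]
    rw [if_neg (by omega), Nat.add_sub_cancel]
  have e2 : g (m + 1) = qFactorial (nome (a (m + 1)) z) (nome (a (m + 1)) (a m)) := by
    simp only [hg, if_true]
  rw [Finset.prod_congr rfl e1, e2] at hfg
  rw [doubleSine, (h.isZetaContinuation_points h1 h2).gamma_eq,
    (h.isZetaContinuation_interiorPoints h3 h4).gamma_eq]
  rw [exp_deriv_sum (Z := Z) (fun j hj => ?_), exp_deriv_sum (Z := Z') (fun j hj => ?_)]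
  · rw [mul_inv, mul_mul_mul_comm, ← Finset.prod_inv_distrib, ← Finset.prod_mul_distrib, hEm,
      Finset.prod_congr rfl fun j hj => hE j (Finset.mem_range.1 hj), Finset.prod_mul_distrib,
      mul_mul_mul_comm, hfg, ← Complex.exp_sum, ← Complex.exp_add, h.coneBernoulli_two hc0 hc]
    congr 2
    rw [mul_add, Finset.mul_sum]
    congr 1
    · exact Finset.sum_congr rfl fun j hj => by ring
    · ring
  · rcases Nat.lt_or_ge j m with hjm | hjm
    · exact (h3 j hjm).1
    · obtain rfl : j = m := by omega
      exact h4.1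
  · rcases Nat.lt_or_ge j m with hjm | hjm
    · exact (h1 j hjm).1
    · obtain rfl : j = m := by omega
      exact h2.1

end

/-! ### The parameters attached to the faces -/

lemma smallK_eq {n v : Fin 2 → ℤ} {d : ℤ} (hd : d = 1 ∨ d = -1) (h : cross n v = d) :
    smallK n v = !![d * v 1, -(d * v 0); -(d * n 1), d * n 0] := by
  have hd2 : d * d = 1 := by rcases hd with rfl | rfl <;> norm_num
  refine Matrix.inv_eq_left_inv ?_
  simp only [cross] at h
  ext r s
  fin_cases r <;> fin_cases s <;> simp [Matrix.mul_apply, Fin.sum_univ_two]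
  · linear_combination d * h + hd2
  · ring
  · ring
  · linear_combination d * h + hd2

/-- S puts the first coordinate of K(ω₁, ω₂, 1) in third place and fixes the second. So τ₃ and τ₂
are ω paired with the two rows of [n, v]⁻¹, the first of which is ± v turned by a right angle. -/
lemma tau_eq {n v : Fin 2 → ℤ} {d : ℤ} (hd : d = 1 ∨ d = -1) (h : cross n v = d)
    (ω : Fin 2 → ℂ) : tau n v ω 2 = cdot ![d * v 1, -(d * v 0)] ω ∧
      tau n v ω 1 = cdot ![-(d * n 1), d * n 0] ω := by
  constructor <;>
    simp [tau, bigK, matS, smallK_eq hd h, cdot, Matrix.mulVec, dotProduct,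
      Fin.sum_univ_three]

/-- The second row of [n, v]⁻¹ completes the ray generator p with determinant d. By `nome_cdot_eq`
it may be replaced by the neighbouring ray of the fan. -/
lemma face_factor {n v p q : Fin 2 → ℤ} {d : ℤ} {ω : Fin 2 → ℂ} (hd : d = 1 ∨ d = -1)
    (h : cross n v = d) (hp : p = ![d * v 1, -(d * v 0)]) (hpq : cross p q = d)
    (hp0 : cdot p ω ≠ 0) (z : ℂ) :
    qFactorial (Complex.exp (2 * Real.pi * Complex.I * (z / tau n v ω 2)))
      (Complex.exp (2 * Real.pi * Complex.I * (tau n v ω 1 / tau n v ω 2))) =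
    qFactorial (nome (cdot p ω) z) (nome (cdot p ω) (cdot q ω)) := by
  obtain ⟨e2, e1⟩ := tau_eq hd h ω
  rw [← hp] at e2
  rw [e1, e2]
  change qFactorial (nome _ _) (nome _ _) = _
  congr 1
  refine nome_cdot_eq hd hp0 ?_ hpq
  have hd2 : d * d = 1 := by rcases hd with rfl | rfl <;> norm_num
  rw [hp]
  simp only [cross, Matrix.cons_val_zero, Matrix.cons_val_one] at h ⊢
  linear_combination d * d * h + d * hd2

section

variable {C : Cone2} {i k : Fin 2} {m : ℕ} {w : ℕ → Fin 2 → ℤ} {c : ℂ} {ω : Fin 2 → ℂ}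

/-- The ray w 0 is the normal turned by a right angle, so n · w 0 = det [n, v_i], and positivity on
the face fixes the sign. At the other end the turn is opposite, hence -1 in `IsFan.cross_last`. -/
lemma IsFan.cross_first (h : IsFan C i k m w) {n : Fin 2 → ℤ} (hn : C.IsFaceVector i n) :
    cross n (C.normal i) = 1 := by
  refine hn.1.resolve_right fun hneg => ?_
  have := hn.2 (toReal (w 0)) ⟨h.mem 0 (Nat.zero_le _), ?_⟩
    (toReal_ne_zero (h.ne_zero (Nat.zero_le _)))
  · rw [rdot_toReal, Int.cast_pos, h.first] at this
    simp only [cross, Matrix.cons_val_zero, Matrix.cons_val_one] at this hneg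
    linarith
  · rw [rdot_toReal, h.first]
    simp only [Matrix.cons_val_zero, Matrix.cons_val_one]
    rw [Int.cast_eq_zero]
    ring

lemma IsFan.cross_last (h : IsFan C i k m w) {n : Fin 2 → ℤ} (hn : C.IsFaceVector k n) :
    cross n (C.normal k) = -1 := by
  refine hn.1.resolve_left fun hpos => ?_
  have := hn.2 (toReal (w (m + 1))) ⟨h.mem (m + 1) le_rfl, ?_⟩
    (toReal_ne_zero (h.ne_zero le_rfl))
  · rw [rdot_toReal, Int.cast_pos, h.last] at this
    simp only [cross, Matrix.cons_val_zero, Matrix.cons_val_one] at this hpos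
    linarith
  · rw [rdot_toReal, h.last]
    simp only [Matrix.cons_val_zero, Matrix.cons_val_one]
    rw [Int.cast_eq_zero]
    ring

lemma IsFan.productSide_eq (h : IsFan C i k m w)
    (hc : (fun i => (c * ω i).re) ∈ interior C.dual) {n : Fin 2 → Fin 2 → ℤ}
    (hn : ∀ f, C.IsFaceVector f (n f)) (z : ℂ) :
    productSide C ω n z = Complex.exp (Real.pi * Complex.I / 2 * coneBernoulli C 2 ω z) *
      (qFactorial (nome (cdot (w 0) ω) z) (nome (cdot (w 0) ω) (cdot (w 1) ω)) *
        qFactorial (nome (cdot (w (m + 1)) ω) z)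
          (nome (cdot (w (m + 1)) ω) (cdot (w m) ω))) := by
  have hne : ∀ j ≤ m + 1, cdot (w j) ω ≠ 0 := fun j hj => ne_zero_of_re (h.re_pos hc hj)
  have hu := h.unimodular m le_rfl
  rw [productSide, prod_fin_two_of_ne h.ne,
    face_factor (Or.inl rfl) (h.cross_first (hn i)) (p := w 0) (q := w 1)
      (by simp [h.first]) (h.unimodular 0 (Nat.zero_le _)) (hne 0 (Nat.zero_le _)),
    face_factor (Or.inr rfl) (h.cross_last (hn k)) (p := w (m + 1)) (q := w m)
      (by simp [h.last]) (by simp only [cross] at hu ⊢; linarith) (hne (m + 1) le_rfl)]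

end

/-- Nonzero periods have modulus at least δ, so a ball of radius δ/2 contains at most one lattice
point. -/
lemma eventually_ne_cdot {ω : Fin 2 → ℂ}
    (hω : ∀ p q : Fin 2 → ℤ, LinearIndependent ℤ ![p, q] → (cdot p ω / cdot q ω).im ≠ 0) (z : ℂ) :
    ∀ᶠ x in 𝓝[≠] z, ∀ k : Fin 2 → ℤ, x ≠ cdot k ω := by
  have him : (ω 1 / ω 0).im ≠ 0 := by
    have := hω ![0, 1] ![1, 0] (linearIndependent_of_cross_ne_zero (by simp [cross]))
    simpa [cdot] using this
  have h0 : ω 0 ≠ 0 := by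
    intro h0
    simp [h0] at him
  -- If k 1 = 0 the bound comes from |k 0| ≥ 1, and otherwise from the imaginary part of k 0 + k 1 ω
  -- 1/ω 0.
  set δ : ℝ := ‖ω 0‖ * min 1 |(ω 1 / ω 0).im| with hδ
  have hδ0 : 0 < δ := mul_pos (norm_pos_iff.2 h0) (lt_min one_pos (abs_pos.2 him))
  have hnorm : ∀ k : Fin 2 → ℤ, k ≠ 0 → δ ≤ ‖cdot k ω‖ := by
    intro k hk
    have e : cdot k ω = ω 0 * (k 0 + k 1 * (ω 1 / ω 0)) := by
      rw [cdot]; field_simp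
    rw [e, norm_mul, hδ]
    refine mul_le_mul_of_nonneg_left ?_ (norm_nonneg _)
    by_cases hk1 : k 1 = 0
    · have hk0 : k 0 ≠ 0 := fun hk0 => hk (funext fun f => by fin_cases f; exacts [hk0, hk1])
      have : (1 : ℝ) ≤ |(k 0 : ℝ)| := by exact_mod_cast Int.one_le_abs hk0
      refine (min_le_left _ _).trans ?_
      simpa [hk1] using this
    · have h1 : (1 : ℝ) ≤ |(k 1 : ℝ)| := by exact_mod_cast Int.one_le_abs hk1
      refine (min_le_right _ _).trans (le_trans ?_ (Complex.abs_im_le_norm _))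
      have e2 : ((k 0 : ℂ) + k 1 * (ω 1 / ω 0)).im = k 1 * (ω 1 / ω 0).im := by
        rw [Complex.add_im, Complex.intCast_im, zero_add, ← Complex.ofReal_intCast,
          Complex.im_ofReal_mul]
      rw [e2, abs_mul]
      exact le_mul_of_one_le_left (abs_nonneg _) h1
  set T : Set ℂ := {p | p ∈ Metric.ball z (δ / 2) ∧ p ≠ z ∧ ∃ k, p = cdot k ω} with hT
  have hsub : T.Subsingleton := by
    rintro p ⟨hp, -, k, rfl⟩ p' ⟨hp', -, k', rfl⟩
    by_contra hne
    have hk : k - k' ≠ 0 := fun h => hne (by rw [sub_eq_zero.1 h])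
    have h1 := hnorm _ hk
    have e : cdot (k - k') ω = cdot k ω - cdot k' ω := by simp [cdot]; ring
    rw [e, ← dist_eq_norm] at h1
    have h2 := dist_triangle_right (cdot k ω) (cdot k' ω) z
    rw [Metric.mem_ball] at hp hp'
    linarith
  have hTc : Tᶜ ∈ 𝓝 z := hsub.finite.isClosed.isOpen_compl.mem_nhds fun h => h.2.1 rfl
  filter_upwards [nhdsWithin_le_nhds hTc, nhdsWithin_le_nhds (Metric.ball_mem_nhds z (half_pos hδ0)),
    self_mem_nhdsWithin] with x h1 h2 h3 k hk
  exact h1 ⟨h2, h3, k, hk⟩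

end GenSine

end

theorem mainTheorem3 (C : GenSine.Cone2) (hC : C.IsGood) (ω : Fin 2 → ℂ)
    (hω : ∀ p q : Fin 2 → ℤ, LinearIndependent ℤ ![p, q] →
      (GenSine.cdot p ω / GenSine.cdot q ω).im ≠ 0)
    (c : ℂ) (hc0 : c ≠ 0) (hc : (fun i => (c * ω i).re) ∈ interior C.dual)
    (n : Fin 2 → Fin 2 → ℤ) (hn : ∀ f, C.IsFaceVector f (n f)) :
    -- the objects entering the formula are well defined
    (∀ z : ℂ, GenSine.IsRegularPoint C ω z →
      (∃ Z, GenSine.IsZetaContinuation C.points c ω z Z) ∧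
      (∃ Z, GenSine.IsZetaContinuation C.interiorPoints c ω (-z) Z)) ∧
    (∀ z : ℂ, ∃ b, GenSine.IsExpansion (GenSine.coneBernoulliGen C ω z)
      (GenSine.coneBernoulliDomain C ω) b) ∧
    -- the infinite product representation, off the lattice of possible zeros and poles
    (∀ z : ℂ, (∀ k : Fin 2 → ℤ, z ≠ GenSine.cdot k ω) →
      GenSine.doubleSine C c ω z = GenSine.productSide C ω n z) ∧
    -- at the remaining points where the double sine is defined, the product has at most a
    -- removable singularity and is extended by its limit
    (∀ z : ℂ, GenSine.IsRegularPoint C ω z →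
      Tendsto (GenSine.productSide C ω n) (𝓝[≠] z) (𝓝 (GenSine.doubleSine C c ω z))) ∧
    -- the explicit form of the generalized Bernoulli polynomial
    (GenSine.cross (C.normal 0) (C.normal 1) < 0 → ∃ m u, C.IsSubdivision m u) ∧
    (∀ m u, C.IsSubdivision m u → ∀ z : ℂ,
      GenSine.coneBernoulli C 2 ω z =
        GenSine.bernoulli2 2 z (GenSine.ccross ω (u m)) (GenSine.ccross ω (u (m + 1))) +
        ∑ j ∈ Finset.range m,
          GenSine.bernoulli2 2 (z + GenSine.ccross ω (u j))
            (GenSine.ccross ω (u j)) (GenSine.ccross ω (u (j + 1)))) := by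

  obtain ⟨i, k, m, w, h⟩ := C.exists_isFan
  have hprod : ∀ z : ℂ, (∀ k : Fin 2 → ℤ, z ≠ GenSine.cdot k ω) →
      GenSine.doubleSine C c ω z = GenSine.productSide C ω n z := fun z hz => by
    rw [h.doubleSine_eq hc0 hc hω hz, h.productSide_eq hc hn]
  refine ⟨fun z _ => ?_, fun z => ?_, hprod, fun z hz => ?_, fun hneg => ?_, fun m u hu z => ?_⟩
  · obtain ⟨Z, Z', h1, h2, h3, h4⟩ := h.exists_isZetaContinuation (z := z) hc0 hc
    exact ⟨⟨_, h.isZetaContinuation_points h1 h2⟩, ⟨_, h.isZetaContinuation_interiorPoints h3 h4⟩⟩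
  · obtain ⟨b, hb, -⟩ := h.exists_isExpansion hc z
    exact ⟨b, hb⟩
  -- The double sine is continuous at regular points and equals the product on a punctured
  -- neighbourhood, by discreteness of the lattice.
  · refine ((h.continuousAt_doubleSine hc0 hc hz).tendsto.mono_left nhdsWithin_le_nhds).congr' ?_
    filter_upwards [GenSine.eventually_ne_cdot hω z] with x hx using hprod x hx
  · obtain ⟨m, w, hw⟩ := C.exists_isFan_of_cross_neg (by decide) hneg
    exact ⟨m, _, hw.isSubdivision⟩
  · have hu' := GenSine.IsFan.of_isSubdivision hu
    have e : ∀ j, GenSine.ccross ω (u j) = GenSine.cdot ![u j 1, -u j 0] ω := fun j => by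
      simp [GenSine.ccross, GenSine.cdot]; ring
    have hne : ∀ j ≤ m + 1, GenSine.cdot ![u j 1, -u j 0] ω ≠ 0 := fun j hj =>
      GenSine.ne_zero_of_re (hu'.re_pos hc hj)
    simp only [e]
    rw [hu'.coneBernoulli_two hc0 hc z, add_comm,
      GenSine.bernoulli2_two _ (hne m (by omega)) (hne (m + 1) le_rfl)]
    congr 1
    refine Finset.sum_congr rfl fun j hj => ?_
    have hj := Finset.mem_range.1 hj
    rw [GenSine.bernoulli2_two _ (hne j (by omega)) (hne (j + 1) (by omega))]
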